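/- **Setting.** Let $\rho:\mathrm{SL}_2(\mathbb Z)\to\mathrm{GL}_d(\mathbb C)$ be a matrix representation with $\rho(-1)=1$ and with $T=\rho\left(\begin{smallmatrix}1&1\\0&1\end{smallmatrix}\right)$ diagonal of finite order. An exponent matrix of $\rho$ is a rational diagonal matrix $\Lambda$ with $T=\exp(2\pi i\Lambda)$. Put $q=e^{2\pi i\tau}$, and let $\mathcal M(\rho)$ be the space of holomorphic maps $\mathbb X:\mathbf H\to\mathbb C^d$ on the upper half-plane with $\mathbb X(\gamma\tau)=\rho(\gamma)\mathbb X(\tau)$ for $\gamma\in\mathrm{SL}_2(\mathbb Z)$ whose expansion $q^{-\Lambda}\mathbb X=\sum_{n\in\mathbb Z}\mathbb X[n]q^n$ has a finite principal part $\mathcal P\mathbb X=\sum_{n<0}\mathbb X[n]q^n$. Say that $\mathcal P$ is invertible for $(\rho,\Lambda)$ if it is a bijection from $\mathcal M(\rho)$ onto the finite sums of negative powers of $q$ with coefficients in $\mathbb C^d$. The fundamental matrix $\Xi$ of $(\rho,\Lambda)$ is the matrix whose $\eta$-th column is the element of $\mathcal M(\rho)$ with principal part $q^{-1}e_\eta$,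 and the characteristic matrix $\mathcal X$ is the matrix whose columns are the constant terms $\mathbb X[0]$ of these columns. Let $E_k$ be the normalized Eisenstein series, $\Delta=q\prod_{n\ge1}(1-q^n)^{24}$, $\Delta^{7/6}=q^{7/6}\prod_{n\ge1}(1-q^n)^{28}$, $J=E_4^3/\Delta-744=q^{-1}+196884q+\cdots$ and $\nabla=\frac{E_{10}}{\Delta}\frac1{2\pi i}\frac{d}{d\tau}$. For a pair $(\Lambda,\mathcal X)$ of complex $d\times d$ matrices with $\Lambda$ diagonal and rational, put $$\mathcal A=\tfrac{31}{36}(1-\Lambda)-\tfrac1{864}\bigl(\mathcal X+[\Lambda,\mathcal X]\bigr),\qquad \mathcal B=\tfrac{41}{24}(1-\Lambda)+\tfrac1{576}\bigl(\mathcal X+[\Lambda,\mathcal X]\bigr).$$ The pair satisfies the spectral condition if $\mathcal A$ and $\mathcal B$ are diagonalizable, the eigenvalues of $\mathcal A$ lie in $\{0,1\}$ and those of $\mathcal B$ lie in $\{0,1,2\}$. A fundamental matrix corresponding to the pair $(\Lambda,\mathcal X)$ is a holomorphic $\Xi:\mathbf H\to M_d(\mathbb C)$ with $$\nabla\Xi=\Xi\bigl((J-240)(\Lambda-1)+\mathcal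 X+[\Lambda,\mathcal X]\bigr),\qquad q^{1-\Lambda}\,\Xi=1+\mathcal X q+O(q^2),$$ the second as a power series in $q$. Let $\varkappa$ be the one-dimensional representation of $\mathrm{SL}_2(\mathbb Z)$ with $\varkappa\left(\begin{smallmatrix}0&-1\\1&0\end{smallmatrix}\right)=-1$ and $\varkappa\left(\begin{smallmatrix}1&1\\0&1\end{smallmatrix}\right)=e^{2\pi i\cdot5/6}$, let $\overline\rho(\gamma)={}^t\rho(\gamma)^{-1}$ be the contragredient of $\rho$, and call elliptic the points of the $\mathrm{SL}_2(\mathbb Z)$-orbits of $i$ and $e^{2\pi i/3}$. **Theorem (duality).** Put $\Lambda^\vee=\frac56-\Lambda$ and $\mathcal X^\vee=4-{}^t\mathcal X$. 1. The map $(\Lambda,\mathcal X)\mapsto(\Lambda^\vee,\mathcal X^\vee)$ is an involution. The matrices $\mathcal A^\vee,\mathcal B^\vee$ of the dual pair are $\mathcal A^\vee=1-{}^t\mathcal A$ and $\mathcal B^\vee=2-{}^t\mathcal B$. If $(\Lambda,\mathcal X)$ satisfies the spectral condition, so does $(\Lambda^\vee,\mathcal X^\vee)$. 2. Let $(\Lambda,\mathcal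 X)$ satisfy the spectral condition and let $\Xi$ be a fundamental matrix corresponding to it. There is exactly one representation $\rho$ with $\Xi(\gamma\tau)=\rho(\gamma)\Xi(\tau)$ for all $\gamma,\tau$. The matrix $\Xi(\tau)$ is invertible for every non-elliptic $\tau$, and $$\Xi^\vee(\tau)=\frac{E_{14}(\tau)}{\Delta^{7/6}(\tau)}\bigl({}^t\Xi(\tau)\bigr)^{-1}$$ extends from the non-elliptic points to a holomorphic function on $\mathbf H$, which is a fundamental matrix corresponding to the dual pair $(\Lambda^\vee,\mathcal X^\vee)$ and satisfies $\Xi^\vee(\gamma\tau)=\bigl(\varkappa\otimes\overline\rho\bigr)(\gamma)\,\Xi^\vee(\tau)$. If $\Xi'$ is any fundamental matrix corresponding to the dual pair and $\sigma$ is a representation with $\Xi'(\gamma\tau)=\sigma(\gamma)\Xi'(\tau)$ for all $\gamma,\tau$, then $\sigma$ is equivalent to $\varkappa\otimes\overline\rho$. 3. Let $\rho$ be as in the setting, $\Lambda$ an exponent matrix of $\rho$ for which $\mathcal P$ is invertible, $\Xi$ the fundamental matrix and $\mathcal X$ the characteristic matrix of $(\rho,\Lambda)$. Then $\rho^\vee=\varkappa\otimes\overline\rho$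 is trivial on $-1$, $\rho^\vee\left(\begin{smallmatrix}1&1\\0&1\end{smallmatrix}\right)$ is diagonal of finite order, $\Lambda^\vee$ is an exponent matrix of $\rho^\vee$, and $\mathcal P$ is invertible for $(\rho^\vee,\Lambda^\vee)$. The matrix $\Xi(\tau)$ is invertible for every non-elliptic $\tau$, and the function $\Xi^\vee$ given by the formula in 2 extends to a holomorphic function on $\mathbf H$, which is the fundamental matrix of $(\rho^\vee,\Lambda^\vee)$, with characteristic matrix $\mathcal X^\vee$, and is also a fundamental matrix corresponding to the pair $(\Lambda^\vee,\mathcal X^\vee)$. -/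

import Mathlib

open scoped MatrixGroups

noncomputable section

namespace VVMF

open UpperHalfPlane

/-! ### Classical modular functions -/

/-- The normalized Eisenstein series of weights 4, 10 and 14 for `SL(2, ℤ)`. -/
def E4 (τ : ℍ) : ℂ := ModularForm.E (k := 4) (by norm_num) τ

def E10 (τ : ℍ) : ℂ := ModularForm.E (k := 10) (by norm_num) τ

def E14 (τ : ℍ) : ℂ := ModularForm.E (k := 14) (by norm_num) τ

/-- `J = E₄³ / Δ - 744 = q⁻¹ + 196884 q + ⋯`. -/
def J (τ : ℍ) : ℂ := E4 τ ^ 3 / ModularForm.discriminant τ - 744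

/-- `ℰ = E₁₀ / Δ = q⁻¹ - 240 - 141444 q - ⋯`. -/
def curlyE (τ : ℍ) : ℂ := E10 τ / ModularForm.discriminant τ

/-- The operator `∇ = (ℰ / 2πi) d/dτ`. -/
def nabla (f : ℍ → ℂ) (τ : ℍ) : ℂ := curlyE τ * Derivative.normalizedDerivOfComplex f τ

/-- `Δ^(7/6)`, that is `η ^ 28 = q^(7/6) ∏ (1 - q ^ n) ^ 28`, as `Δ = η ^ 24`. -/
def discPow (τ : ℍ) : ℂ := ModularForm.eta τ ^ 28

/-- The point `exp (2πi/3)` of the upper half-plane. -/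
def omegaPoint : ℍ := ⟨⟨-1 / 2, Real.sqrt 3 / 2⟩, by simp⟩

/-- Elliptic points: the `SL(2, ℤ)`-orbits of `i` and of `exp (2πi/3)`. -/
def IsElliptic (τ : ℍ) : Prop :=
  ∃ γ : SL(2, ℤ), τ = γ • UpperHalfPlane.I ∨ τ = γ • omegaPoint

/-! ### The one-dimensional representation `ϰ`

It is the representation with `ϰ S = -1` and `ϰ T = exp (2πi·5/6)` (see `kappa_S`, `kappa_T`),
written as the product of a sign character that factors through `SL(2, ℤ/2)` and a cubic character
that factors through `SL(2, ℤ/3)`. -/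

def kappaTwo (γ : SL(2, ℤ)) : ZMod 2 :=
  (γ 0 1 : ZMod 2) + (γ 1 0 : ZMod 2)
    + (γ 0 1 : ZMod 2) * (γ 1 0 : ZMod 2) * (1 + (γ 0 0 : ZMod 2) + (γ 1 1 : ZMod 2))

def kappaThree (γ : SL(2, ℤ)) : ZMod 3 :=
  (1 - (γ 1 0 : ZMod 3) ^ 2) * (γ 0 1 : ZMod 3) * (γ 1 1 : ZMod 3)
    + (γ 1 0 : ZMod 3) * ((γ 0 0 : ZMod 3) + (γ 1 1 : ZMod 3))

theorem kappaTwo_aux : ∀ a b c d a' b' c' d' : ZMod 2,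
    a * d - b * c = 1 → a' * d' - b' * c' = 1 →
    (fun a b c d : ZMod 2 => b + c + b * c * (1 + a + d))
        (a * a' + b * c') (a * b' + b * d') (c * a' + d * c') (c * b' + d * d')
      = (b + c + b * c * (1 + a + d)) + (b' + c' + b' * c' * (1 + a' + d')) := by
  decide +kernel

theorem kappaThree_aux : ∀ a b c d a' b' c' d' : ZMod 3,
    a * d - b * c = 1 → a' * d' - b' * c' = 1 →
    (fun a b c d : ZMod 3 => (1 - c ^ 2) * b * d + c * (a + d))
        (a * a' + b * c') (a * b' + b * d') (c * a' + d * c') (c * b' + d * d')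
      = ((1 - c ^ 2) * b * d + c * (a + d))
        + ((1 - c' ^ 2) * b' * d' + c' * (a' + d')) := by
  decide +kernel

theorem det_cast (γ : SL(2, ℤ)) (R : Type*) [CommRing R] :
    (γ 0 0 : R) * (γ 1 1 : R) - (γ 0 1 : R) * (γ 1 0 : R) = 1 := by
  have h := γ.det_coe
  rw [Matrix.det_fin_two] at h
  exact_mod_cast congrArg (Int.cast : ℤ → R) h

theorem kappaTwo_mul (γ δ : SL(2, ℤ)) : kappaTwo (γ * δ) = kappaTwo γ + kappaTwo δ := by
  have h := kappaTwo_aux (γ 0 0) (γ 0 1) (γ 1 0) (γ 1 1) (δ 0 0) (δ 0 1) (δ 1 0) (δ 1 1)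
    (det_cast γ _) (det_cast δ _)
  simpa [kappaTwo, Matrix.mul_apply, Fin.sum_univ_two] using h

theorem kappaThree_mul (γ δ : SL(2, ℤ)) :
    kappaThree (γ * δ) = kappaThree γ + kappaThree δ := by
  have h := kappaThree_aux (γ 0 0) (γ 0 1) (γ 1 0) (γ 1 1) (δ 0 0) (δ 0 1) (δ 1 0) (δ 1 1)
    (det_cast γ _) (det_cast δ _)
  simpa [kappaThree, Matrix.mul_apply, Fin.sum_univ_two] using h

/-- `ϰ γ = exp (2πi · kappaTwo γ / 2) · exp (2πi · kappaThree γ / 3)`. -/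
def kappa : SL(2, ℤ) →* ℂˣ :=
  MonoidHom.toHomUnits
    { toFun := fun γ => ZMod.stdAddChar (kappaTwo γ) * ZMod.stdAddChar (kappaThree γ)
      map_one' := by simp [kappaTwo, kappaThree]
      map_mul' := fun γ δ => by
        rw [kappaTwo_mul, kappaThree_mul, AddChar.map_add_eq_mul, AddChar.map_add_eq_mul]
        ring }

theorem kappa_S : (kappa ModularGroup.S : ℂ) = -1 := by
  have h2 : kappaTwo ModularGroup.S = ((1 : ℤ) : ZMod 2) := by
    simp [kappaTwo, ModularGroup.S]; decide
  have h3 : kappaThree ModularGroup.S = ((0 : ℤ) : ZMod 3) := by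
    simp [kappaThree, ModularGroup.S]
  have : (kappa ModularGroup.S : ℂ)
      = ZMod.stdAddChar (kappaTwo ModularGroup.S)
        * ZMod.stdAddChar (kappaThree ModularGroup.S) := rfl
  rw [this, h2, h3, ZMod.stdAddChar_coe, ZMod.stdAddChar_coe, ← Complex.exp_add,
    ← Complex.exp_pi_mul_I]
  congr 1
  push_cast
  ring

theorem kappa_T : (kappa ModularGroup.T : ℂ) = Complex.exp (2 * Real.pi * Complex.I * (5 / 6)) := by
  have h2 : kappaTwo ModularGroup.T = ((1 : ℤ) : ZMod 2) := by
    simp [kappaTwo, ModularGroup.T]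
  have h3 : kappaThree ModularGroup.T = ((1 : ℤ) : ZMod 3) := by
    simp [kappaThree, ModularGroup.T]
  have : (kappa ModularGroup.T : ℂ)
      = ZMod.stdAddChar (kappaTwo ModularGroup.T)
        * ZMod.stdAddChar (kappaThree ModularGroup.T) := rfl
  rw [this, h2, h3, ZMod.stdAddChar_coe, ZMod.stdAddChar_coe, ← Complex.exp_add]
  congr 1
  push_cast
  ring

/-! ### Representations -/

variable {d : ℕ}

/-- The standing assumptions on `ρ`: it is trivial on `-1`, and `T = ρ (1 1; 0 1)` is a diagonal
matrix of finite order. -/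
structure IsAdmissible (ρ : SL(2, ℤ) →* GL (Fin d) ℂ) : Prop where
  neg_one : ρ (-1) = 1
  diag : (ρ ModularGroup.T : Matrix (Fin d) (Fin d) ℂ).IsDiag
  finOrder : IsOfFinOrder (ρ ModularGroup.T)

/-- The contragredient `γ ↦ ᵗ(ρ γ)⁻¹`. -/
def contragredient (ρ : SL(2, ℤ) →* GL (Fin d) ℂ) : SL(2, ℤ) →* GL (Fin d) ℂ where
  toFun γ :=
    { val := (ρ γ⁻¹ : Matrix (Fin d) (Fin d) ℂ).transpose
      inv := (ρ γ : Matrix (Fin d) (Fin d) ℂ).transpose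
      val_inv := by
        rw [← Matrix.transpose_mul, ← Units.val_mul, ← map_mul]; simp
      inv_val := by
        rw [← Matrix.transpose_mul, ← Units.val_mul, ← map_mul]; simp }
  map_one' := by apply Units.ext; simp
  map_mul' γ δ := by apply Units.ext; simp [Matrix.transpose_mul]

/-- The tensor product of a one-dimensional representation `χ` with `ρ`. -/
def twist (χ : SL(2, ℤ) →* ℂˣ) (ρ : SL(2, ℤ) →* GL (Fin d) ℂ) : SL(2, ℤ) →* GL (Fin d) ℂ where
  toFun γ :=
    { val := (χ γ : ℂ) • (ρ γ : Matrix (Fin d) (Fin d) ℂ)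
      inv := (χ γ⁻¹ : ℂ) • (ρ γ⁻¹ : Matrix (Fin d) (Fin d) ℂ)
      val_inv := by
        rw [smul_mul_smul_comm, ← Units.val_mul, ← Units.val_mul, ← map_mul, ← map_mul]; simp
      inv_val := by
        rw [smul_mul_smul_comm, ← Units.val_mul, ← Units.val_mul, ← map_mul, ← map_mul]; simp }
  map_one' := by apply Units.ext; simp
  map_mul' γ δ := by
    apply Units.ext
    simp only [map_mul, Units.val_mul]
    rw [smul_mul_smul_comm]

/-- The tensor product of the contragredient of `ρ` with `ϰ`. -/
def dualRep (ρ : SL(2, ℤ) →* GL (Fin d) ℂ) : SL(2, ℤ) →* GL (Fin d) ℂ :=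
  twist kappa (contragredient ρ)

/-! ### Exponents, characteristic matrices and the duality -/

/-- The diagonal matrix `Λ` with the given rational diagonal elements. -/
def expMat (Λ : Fin d → ℚ) : Matrix (Fin d) (Fin d) ℂ := Matrix.diagonal fun ξ => (Λ ξ : ℂ)

/-- `Λ` is an exponent matrix of `ρ`: `ρ (1 1; 0 1) = exp (2πi Λ)`. -/
def IsExponent (ρ : SL(2, ℤ) →* GL (Fin d) ℂ) (Λ : Fin d → ℚ) : Prop :=
  (ρ ModularGroup.T : Matrix (Fin d) (Fin d) ℂ)
    = Matrix.diagonal fun ξ => Complex.exp (2 * Real.pi * Complex.I * (Λ ξ : ℂ))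

/-- `𝒳 + [Λ, 𝒳]`. -/
def commPart (Λ : Fin d → ℚ) (X : Matrix (Fin d) (Fin d) ℂ) : Matrix (Fin d) (Fin d) ℂ :=
  X + (expMat Λ * X - X * expMat Λ)

/-- `𝒜 = 31/36 (1 - Λ) - 1/864 (𝒳 + [Λ, 𝒳])`. -/
def matA (Λ : Fin d → ℚ) (X : Matrix (Fin d) (Fin d) ℂ) : Matrix (Fin d) (Fin d) ℂ :=
  (31 / 36 : ℂ) • (1 - expMat Λ) - (1 / 864 : ℂ) • commPart Λ X

/-- `ℬ = 41/24 (1 - Λ) + 1/576 (𝒳 + [Λ, 𝒳])`. -/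
def matB (Λ : Fin d → ℚ) (X : Matrix (Fin d) (Fin d) ℂ) : Matrix (Fin d) (Fin d) ℂ :=
  (41 / 24 : ℂ) • (1 - expMat Λ) + (1 / 576 : ℂ) • commPart Λ X

/-- `M` is diagonalizable and its eigenvalues lie in `s`. -/
def DiagonalizableWithin (M : Matrix (Fin d) (Fin d) ℂ) (s : Set ℂ) : Prop :=
  ∃ (P : GL (Fin d) ℂ) (v : Fin d → ℂ), (∀ ξ, v ξ ∈ s) ∧
    M = (P : Matrix (Fin d) (Fin d) ℂ) * Matrix.diagonal v
      * ((P⁻¹ : GL (Fin d) ℂ) : Matrix (Fin d) (Fin d) ℂ)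

/-- The spectral condition for the pair `(Λ, 𝒳)`. -/
def SpectralCondition (Λ : Fin d → ℚ) (X : Matrix (Fin d) (Fin d) ℂ) : Prop :=
  DiagonalizableWithin (matA Λ X) {0, 1} ∧ DiagonalizableWithin (matB Λ X) {0, 1, 2}

/-- The diagonal elements of `5/6 - Λ`. -/
def dualExp (Λ : Fin d → ℚ) : Fin d → ℚ := fun ξ => 5 / 6 - Λ ξ

theorem expMat_dualExp (Λ : Fin d → ℚ) :
    expMat (dualExp Λ) = (5 / 6 : ℂ) • (1 : Matrix (Fin d) (Fin d) ℂ) - expMat Λ := by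
  ext i j
  by_cases h : i = j
  · subst h; simp [expMat, dualExp]
  · simp [expMat, dualExp, h]

/-- `4 - ᵗ𝒳`. -/
def dualChar (X : Matrix (Fin d) (Fin d) ℂ) : Matrix (Fin d) (Fin d) ℂ :=
  (4 : ℂ) • (1 : Matrix (Fin d) (Fin d) ℂ) - X.transpose

/-- The transformation `(Λ, 𝒳) ↦ (5/6 - Λ, 4 - ᵗ𝒳)`. -/
def dualPair (p : (Fin d → ℚ) × Matrix (Fin d) (Fin d) ℂ) :
    (Fin d → ℚ) × Matrix (Fin d) (Fin d) ℂ :=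
  (dualExp p.1, dualChar p.2)

/-! ### Vector-valued modular functions -/

/-- `q^(-Λ) 𝕏(τ) = ∑ a[n] q^n` (sum over `n : ℤ`), with `q = exp (2πiτ)`. -/
def HasQExpansion (Λ : Fin d → ℚ) (𝕏 : ℍ → Fin d → ℂ) (a : ℤ → Fin d → ℂ) : Prop :=
  ∀ (τ : ℍ) (ξ : Fin d),
    HasSum (fun n : ℤ => a n ξ * Complex.exp (2 * Real.pi * Complex.I * n * τ))
      (Complex.exp (-(2 * Real.pi * Complex.I * (Λ ξ : ℂ) * τ)) * 𝕏 τ ξ)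

/-- Membership of `𝕏` in the space `ℳ(ρ)`, where `Λ` is an exponent matrix of `ρ`: `𝕏` is
holomorphic in `ℍ`, transforms according to `ρ`, and its `q`-expansion has only finitely many terms
with a negative power of `q`. (Adding integers to the diagonal elements of `Λ` does not change the
space.) -/
structure MemModular (ρ : SL(2, ℤ) →* GL (Fin d) ℂ) (Λ : Fin d → ℚ) (𝕏 : ℍ → Fin d → ℂ) :
    Prop where
  holo : ∀ ξ, MDifferentiable (modelWithCornersSelf ℂ ℂ) (modelWithCornersSelf ℂ ℂ)
    fun τ => 𝕏 τ ξ
  trans : ∀ (γ : SL(2, ℤ)) (τ : ℍ),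
    𝕏 (γ • τ) = (ρ γ : Matrix (Fin d) (Fin d) ℂ).mulVec (𝕏 τ)
  cusp : ∃ a : ℤ → Fin d → ℂ, HasQExpansion Λ 𝕏 a ∧ ∃ N : ℤ, ∀ n < N, a n = 0

/-- The principal part of `𝕏` is `∑ p[n] q^(-(n+1))` (sum over `n : ℕ`). -/
def HasPrincipalPart (Λ : Fin d → ℚ) (𝕏 : ℍ → Fin d → ℂ) (p : ℕ → Fin d → ℂ) : Prop :=
  ∃ a : ℤ → Fin d → ℂ, HasQExpansion Λ 𝕏 a ∧ ∀ n : ℕ, a (-((n : ℤ) + 1)) = p n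

/-- The principal part map is a bijection of `ℳ(ρ)` onto the finite sums of negative powers
of `q` with vector coefficients. -/
def PrincipalPartInvertible (ρ : SL(2, ℤ) →* GL (Fin d) ℂ) (Λ : Fin d → ℚ) : Prop :=
  ∀ p : ℕ →₀ (Fin d → ℂ), ∃! 𝕏 : ℍ → Fin d → ℂ,
    MemModular ρ Λ 𝕏 ∧ HasPrincipalPart Λ 𝕏 p

/-- `Ξ` has the `q`-expansion `q^Λ (q⁻¹ + 𝒳 + O(q))`, with a power series in `q` in brackets. -/
def HasBoundaryExpansion (Λ : Fin d → ℚ) (X : Matrix (Fin d) (Fin d) ℂ)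
    (Ξ : ℍ → Matrix (Fin d) (Fin d) ℂ) : Prop :=
  ∀ η : Fin d, ∃ a : ℤ → Fin d → ℂ, HasQExpansion Λ (fun τ ξ => Ξ τ ξ η) a ∧
    (∀ n < -1, a n = 0) ∧ a (-1) = Pi.single η 1 ∧ ∀ ξ, a 0 ξ = X ξ η

/-- `Ξ` is the fundamental matrix and `𝒳` the characteristic matrix of `ℳ(ρ)` for the exponent
matrix `Λ`: the columns of `Ξ` are the canonical basis vectors with principal parts `q⁻¹ e_η`, and
the columns of `𝒳` are their constant parts. -/
structure IsFundamentalMatrix (ρ : SL(2, ℤ) →* GL (Fin d) ℂ) (Λ : Fin d → ℚ)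
    (X : Matrix (Fin d) (Fin d) ℂ) (Ξ : ℍ → Matrix (Fin d) (Fin d) ℂ) : Prop where
  mem : ∀ η, MemModular ρ Λ fun τ ξ => Ξ τ ξ η
  expansion : HasBoundaryExpansion Λ X Ξ

/-- Holomorphy of a matrix-valued function on `ℍ`. -/
def IsHolomorphic (Ξ : ℍ → Matrix (Fin d) (Fin d) ℂ) : Prop :=
  ∀ ξ η, MDifferentiable (modelWithCornersSelf ℂ ℂ) (modelWithCornersSelf ℂ ℂ)
    fun τ => Ξ τ ξ η

/-- `Ξ` is a fundamental matrix corresponding to the pair `(Λ, 𝒳)`: a holomorphic solution on `ℍ`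
of the compatibility equation `∇Ξ = Ξ ((J - 240)(Λ - 1) + 𝒳 + [Λ, 𝒳])`, with the boundary
condition `q^(1-Λ) Ξ = 1 + 𝒳 q + O(q²)`. -/
structure IsFundamentalSolution (Λ : Fin d → ℚ) (X : Matrix (Fin d) (Fin d) ℂ)
    (Ξ : ℍ → Matrix (Fin d) (Fin d) ℂ) : Prop where
  holo : IsHolomorphic Ξ
  compat : ∀ (τ : ℍ) (ξ η : Fin d), nabla (fun z => Ξ z ξ η) τ
    = (Ξ τ * ((J τ - 240) • (expMat Λ - 1) + commPart Λ X)) ξ η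
  expansion : HasBoundaryExpansion Λ X Ξ

/-- `Ξ (γ τ) = ρ γ · Ξ τ`. -/
def TransformsBy (ρ : SL(2, ℤ) →* GL (Fin d) ℂ) (Ξ : ℍ → Matrix (Fin d) (Fin d) ℂ) : Prop :=
  ∀ (γ : SL(2, ℤ)) (τ : ℍ), Ξ (γ • τ) = (ρ γ : Matrix (Fin d) (Fin d) ℂ) * Ξ τ

/-- `Ξd` is the holomorphic function on `ℍ` given by `(E₁₄ / Δ^(7/6)) (ᵗΞ)⁻¹` off the elliptic
points, where `Ξ` is invertible. -/
structure IsDualMatrix (Ξ Ξd : ℍ → Matrix (Fin d) (Fin d) ℂ) : Prop where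
  holo : IsHolomorphic Ξd
  isUnit_det : ∀ τ, ¬ IsElliptic τ → IsUnit (Ξ τ).det
  formula : ∀ τ, ¬ IsElliptic τ →
    Ξd τ = (E14 τ / discPow τ) • ((Ξ τ).transpose)⁻¹

/-- Equivalence of matrix representations. -/
def RepEquiv (σ ρ : SL(2, ℤ) →* GL (Fin d) ℂ) : Prop :=
  ∃ C : GL (Fin d) ℂ, ∀ γ, σ γ = C * ρ γ * C⁻¹

end VVMF

end

/-!
The pair `(Λ, 𝒳)` enters through the connection matrix `D = (J - 240)(Λ - 1) + 𝒳 + [Λ, 𝒳]`, which is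
`-(j - 1728)/3 · ℬ - j/2 · 𝒜` with `j = J + 744` (`connMat_eq`). The operator `∇ = ℰ/(2πi) d/dτ`
degenerates exactly at the zeros of `ℰ = E₄ E₆ / Δ`. All of them are elliptic, and they are simple:
in units of `2πi`, the slope of `ℰ` is `576` at the zeros of `E₄` and `-864` at those of `E₆`. So
`∇Ξ = Ξ D` has regular singularities there, with residue matrices `ℬ` where `j = 0` and `𝒜` where
`j = 1728`, and is regular elsewhere. Since `∇` and `j` are invariant, `γ ↦ Ξ(γτ)` solves the same
equation, which gives the monodromy representation; `det Ξ` does not vanish where `ℰ ≠ 0` by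
uniqueness of solutions (`eq_zero_of_nabla_eq`).

Put `s = E₁₄ / Δ^(7/6)`. From `s⁶ = j⁴ (j - 1728)³` one gets `∇s = -(7j - 6912)/6 · s`, and
`D^∨ = -(7j - 6912)/6 - ᵗD` (`connMat_dual`), so that `Ξ^∨ = s · ᵗΞ⁻¹` formally solves
`∇Ξ^∨ = Ξ^∨ D^∨`. It is meromorphic, and the leading coefficient at a pole of order `m` at an
elliptic point would be an eigenvector of `𝒜^∨ = 1 - ᵗ𝒜` or `ℬ^∨ = 2 - ᵗℬ` with eigenvalue `-m`
(`exists_eq_pow_mul_of_regularSingular`). The spectral condition, which is stable under the duality,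
excludes this. The boundary condition of `Ξ^∨` is read off from
`Ξ^∨ · ᵗΞ = s = q^(-7/6)(1 + 4q + ⋯)`, and its transformation law from `s(γτ) = ϰ(γ) s(τ)`.

For a space `ℳ(ρ)` with invertible principal part map, everything is reduced to this case by
exhibiting elements of `ℳ(ρ)` without principal part. The columns of `∇Ξ - Ξ D` are such elements,
whence the compatibility equation. At a zero of `E₄` the equation shows that multiplication by
`ℬ - n` on the right raises the order of vanishing from `n` to `n + 1` for `n < 3`, as `j` vanishes
to order three; so `Ξ ℬ(ℬ - 1)(ℬ - 2)` is divisible by `j`, the columns of the quotient have no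
principal part, and `ℬ(ℬ - 1)(ℬ - 2) = 0`. In the same way `𝒜(𝒜 - 1) = 0`, with `j - 1728` in place
of `j` (`IsFundamentalMatrix.spectralCondition`). Finally, the principal part map of the dual is onto
because of the vectors `J ^ n Ξ^∨ c`, and one-to-one because `Δ^(7/6) · ᵗΞ 𝕐` is a vector of cusp
forms of weight 14, hence zero, if `𝕐` has no principal part
(`IsFundamentalMatrix.eq_zero_of_dualRep`).
-/

open scoped MatrixGroups
noncomputable section
namespace VVMF
open UpperHalfPlane

open scoped Manifold Topology ModularForm
open Function.Periodic (qParam)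

/-! ### Expansions in fractional powers of the nome -/

/-- `f τ = q ^ l · F q` with `q = exp (2πiτ)` and `F` holomorphic on the open unit disc. The
factor `q ^ l` is read as `exp (2πi l τ)`. -/
structure HasQForm (l : ℂ) (F : ℂ → ℂ) (f : ℍ → ℂ) : Prop where
  diff : DifferentiableOn ℂ F (Metric.ball 0 1)
  eq : ∀ τ : ℍ, f τ = Complex.exp (2 * Real.pi * Complex.I * l * τ) * F (qParam 1 τ)

theorem qParam_mem_ball (τ : ℍ) : qParam 1 (τ : ℂ) ∈ Metric.ball (0 : ℂ) 1 := by
  simpa using Function.Periodic.norm_qParam_lt_one one_pos τ.im_pos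

theorem qParam_one_eq (z : ℂ) : qParam 1 z = Complex.exp (2 * Real.pi * Complex.I * z) := by
  simp [qParam]

theorem exists_qParam_eq {q : ℂ} (h : q ∈ Metric.ball (0 : ℂ) 1) (h0 : q ≠ 0) :
    ∃ τ : ℍ, qParam 1 (τ : ℂ) = q :=
  ⟨⟨Function.Periodic.invQParam 1 q, Function.Periodic.im_invQParam_pos_of_norm_lt_one one_pos
    (by simpa using h) h0⟩, Function.Periodic.qParam_right_inv one_ne_zero h0⟩

/-- The values `qParam 1 τ` fill the punctured unit disc, which is dense in the disc. -/
theorem eqOn_ball_of_qParam {F G : ℂ → ℂ} (hF : ContinuousOn F (Metric.ball 0 1))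
    (hG : ContinuousOn G (Metric.ball 0 1))
    (h : ∀ τ : ℍ, F (qParam 1 τ) = G (qParam 1 τ)) : Set.EqOn F G (Metric.ball 0 1) := by
  have hball : Metric.ball (0 : ℂ) 1 ∈ 𝓝 (0 : ℂ) := Metric.ball_mem_nhds _ one_pos
  have key : ∀ q ∈ Metric.ball (0 : ℂ) 1, q ≠ 0 → F q = G q := by
    intro q hq h0
    obtain ⟨τ, rfl⟩ := exists_qParam_eq hq h0
    exact h τ
  intro q hq
  by_cases h0 : q = 0
  · subst h0
    have h1 : Filter.Tendsto F (𝓝[≠] 0) (𝓝 (F 0)) :=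
      ((hF.continuousAt hball).tendsto).mono_left nhdsWithin_le_nhds
    have h2 : Filter.Tendsto G (𝓝[≠] 0) (𝓝 (G 0)) :=
      ((hG.continuousAt hball).tendsto).mono_left nhdsWithin_le_nhds
    refine tendsto_nhds_unique h1 (h2.congr' ?_)
    filter_upwards [self_mem_nhdsWithin, mem_nhdsWithin_of_mem_nhds hball] with x hx hx'
    exact (key x hx' hx).symm
  · exact key q hq h0

namespace HasQForm

variable {l m : ℂ} {F G : ℂ → ℂ} {f g : ℍ → ℂ}

theorem differentiableAt (h : HasQForm l F f) {q : ℂ} (hq : q ∈ Metric.ball (0 : ℂ) 1) :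
    DifferentiableAt ℂ F q :=
  (h.diff q hq).differentiableAt (Metric.isOpen_ball.mem_nhds hq)

theorem differentiableAt_zero (h : HasQForm l F f) : DifferentiableAt ℂ F 0 :=
  h.differentiableAt (Metric.mem_ball_self one_pos)

theorem const (c : ℂ) : HasQForm 0 (fun _ => c) (fun _ => c) :=
  ⟨differentiableOn_const c, fun τ => by simp⟩

theorem add (hf : HasQForm l F f) (hg : HasQForm l G g) :
    HasQForm l (fun q => F q + G q) (fun τ => f τ + g τ) :=
  ⟨hf.diff.add hg.diff, fun τ => by rw [hf.eq, hg.eq]; ring⟩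

theorem sub (hf : HasQForm l F f) (hg : HasQForm l G g) :
    HasQForm l (fun q => F q - G q) (fun τ => f τ - g τ) :=
  ⟨hf.diff.sub hg.diff, fun τ => by rw [hf.eq, hg.eq]; ring⟩

theorem mul (hf : HasQForm l F f) (hg : HasQForm m G g) :
    HasQForm (l + m) (fun q => F q * G q) (fun τ => f τ * g τ) :=
  ⟨hf.diff.mul hg.diff, fun τ => by
    rw [hf.eq, hg.eq, mul_add, add_mul, Complex.exp_add]; ring⟩

theorem mul_const (hf : HasQForm l F f) (c : ℂ) :
    HasQForm l (fun q => F q * c) (fun τ => f τ * c) :=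
  ⟨hf.diff.mul_const c, fun τ => by rw [hf.eq]; ring⟩

theorem pow (hf : HasQForm l F f) (n : ℕ) :
    HasQForm (n * l) (fun q => F q ^ n) (fun τ => f τ ^ n) :=
  ⟨hf.diff.pow n, fun τ => by
    rw [hf.eq, mul_pow, ← Complex.exp_nat_mul]; congr 2; ring⟩

theorem sum {ι : Type*} (s : Finset ι) {F : ι → ℂ → ℂ} {f : ι → ℍ → ℂ}
    (h : ∀ i ∈ s, HasQForm l (F i) (f i)) :
    HasQForm l (fun q => ∑ i ∈ s, F i q) (fun τ => ∑ i ∈ s, f i τ) :=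
  ⟨DifferentiableOn.fun_sum fun i hi => (h i hi).diff, fun τ => by
    rw [Finset.mul_sum]; exact Finset.sum_congr rfl fun i hi => (h i hi).eq τ⟩

theorem congr_index (h : HasQForm l F f) (e : l = m) : HasQForm m F f := e ▸ h

/-- Integral powers of the nome may be moved into the power series. -/
theorem shift (n : ℕ) (h : HasQForm (l + n) F f) : HasQForm l (fun q => q ^ n * F q) f :=
  ⟨(differentiableOn_id.pow n).mul h.diff, fun τ => by
    rw [h.eq, qParam_one_eq, ← Complex.exp_nat_mul, ← mul_assoc, ← Complex.exp_add]
    congr 2; ring⟩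

theorem unique (hF : HasQForm l F f) (hG : HasQForm l G f) :
    Set.EqOn F G (Metric.ball 0 1) := by
  refine eqOn_ball_of_qParam hF.diff.continuousOn hG.diff.continuousOn fun τ => ?_
  have := (hF.eq τ).symm.trans (hG.eq τ)
  exact mul_left_cancel₀ (Complex.exp_ne_zero _) this

/-- A power series without constant term is divisible by the nome. -/
theorem exists_unshift (h : HasQForm l F f) (h0 : F 0 = 0) :
    ∃ G, HasQForm (l + 1) G f ∧ G 0 = deriv F 0 := by
  have hball : Metric.ball (0 : ℂ) 1 ∈ 𝓝 (0 : ℂ) := Metric.ball_mem_nhds _ one_pos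
  refine ⟨dslope F 0, ⟨(Complex.differentiableOn_dslope hball).mpr h.diff, fun τ => ?_⟩,
    dslope_same F 0⟩
  have h1 := sub_smul_dslope F 0 (qParam 1 (τ : ℂ))
  rw [h0, sub_zero, sub_zero, smul_eq_mul] at h1
  rw [h.eq, ← h1, qParam_one_eq, ← mul_assoc, ← Complex.exp_add]
  congr 2; ring

theorem hasDerivAt_comp_ofComplex (h : HasQForm l F f) (τ : ℍ) :
    HasDerivAt (f ∘ ofComplex) (2 * Real.pi * Complex.I *
      (Complex.exp (2 * Real.pi * Complex.I * l * τ) *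
        (l * F (qParam 1 τ) + qParam 1 τ * deriv F (qParam 1 τ)))) (τ : ℂ) := by
  have h1 : HasDerivAt (fun z : ℂ => Complex.exp (2 * Real.pi * Complex.I * l * z))
      (Complex.exp (2 * Real.pi * Complex.I * l * τ) * (2 * Real.pi * Complex.I * l * 1)) (τ : ℂ) :=
    ((hasDerivAt_id (τ : ℂ)).const_mul _).cexp
  have h2 : HasDerivAt (qParam 1) (qParam 1 τ * (2 * Real.pi * Complex.I * 1)) (τ : ℂ) := by
    have := ((hasDerivAt_id (τ : ℂ)).const_mul (2 * Real.pi * Complex.I)).cexp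
    simp only [id] at this
    rw [← qParam_one_eq] at this
    exact this.congr_of_eventuallyEq (.of_forall fun z => qParam_one_eq z)
  have h3 : HasDerivAt (F ∘ qParam 1)
      (deriv F (qParam 1 τ) * (qParam 1 τ * (2 * Real.pi * Complex.I * 1))) (τ : ℂ) :=
    (h.differentiableAt (qParam_mem_ball τ)).hasDerivAt.comp (τ : ℂ) h2
  have h4 := h1.mul h3
  refine (h4.congr_of_eventuallyEq ?_).congr_deriv ?_
  · filter_upwards [isOpen_upperHalfPlaneSet.mem_nhds τ.im_pos] with z hz
    have := h.eq ⟨z, hz⟩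
    simpa [ofComplex_apply_of_im_pos hz] using this
  · simp only [Function.comp_apply]; ring

theorem mdifferentiable (h : HasQForm l F f) : MDiff f := fun τ =>
  mdifferentiableAt_iff.mpr (hasDerivAt_comp_ofComplex h τ).differentiableAt

theorem deriv (h : HasQForm l F f) :
    HasQForm l (fun q => l * F q + q * _root_.deriv F q)
      (Derivative.normalizedDerivOfComplex f) :=
  ⟨(h.diff.const_mul l).add (differentiableOn_id.mul (h.diff.deriv Metric.isOpen_ball)),
    fun τ => by
      rw [Derivative.normalizedDerivOfComplex, (hasDerivAt_comp_ofComplex h τ).deriv, ← mul_assoc,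
        inv_mul_cancel₀ Complex.two_pi_I_ne_zero, one_mul]⟩

theorem tendsto_series (h : HasQForm l F f) :
    Filter.Tendsto (fun τ : ℍ => F (qParam 1 τ)) atImInfty (𝓝 (F 0)) :=
  h.differentiableAt_zero.continuousAt.tendsto.comp (qParam_tendsto_atImInfty one_pos)

end HasQForm

theorem periodic_comp_ofComplex_of_vadd {f : ℍ → ℂ} (h : ∀ τ : ℍ, f ((1 : ℝ) +ᵥ τ) = f τ) :
    Function.Periodic (f ∘ ofComplex) ((1 : ℝ) : ℂ) := by
  intro w
  by_cases hw : 0 < w.im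
  · have hw' : 0 < (w + ((1 : ℝ) : ℂ)).im := by simpa using hw
    simp only [Function.comp_apply, ofComplex_apply_of_im_pos hw, ofComplex_apply_of_im_pos hw']
    rw [← h ⟨w, hw⟩]
    congr 1
    ext
    simp [add_comm]
  · have hw' : ¬ 0 < (w + ((1 : ℝ) : ℂ)).im := by simpa using hw
    simp only [Function.comp_apply, ofComplex_apply_of_im_nonpos (not_lt.mp hw),
      ofComplex_apply_of_im_nonpos (not_lt.mp hw')]

/-- A holomorphic function of period one that is bounded at the cusp is a power series in the
nome. -/
theorem exists_hasQForm_of_periodic {f : ℍ → ℂ} (hf : MDiff f)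
    (hper : ∀ τ : ℍ, f ((1 : ℝ) +ᵥ τ) = f τ) (hb : IsBoundedAtImInfty f) :
    ∃ F, HasQForm 0 F f := by
  have hp := periodic_comp_ofComplex_of_vadd hper
  refine ⟨cuspFunction 1 f, differentiableOn_cuspFunction_ball one_pos hp hf hb, fun τ => ?_⟩
  rw [eq_cuspFunction τ one_ne_zero hp]; simp

theorem exists_ne_zero_of_hasQForm {l : ℂ} {P : ℂ → ℂ} {f : ℍ → ℂ} (hf : HasQForm l P f)
    (h0 : P 0 ≠ 0) : ∃ τ, f τ ≠ 0 := by
  obtain ⟨τ, hτ⟩ := (hf.tendsto_series.eventually_ne h0).exists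
  exact ⟨τ, by rw [hf.eq]; exact mul_ne_zero (Complex.exp_ne_zero _) hτ⟩

/-- A holomorphic quotient of two expansions is an expansion, provided that the leading
coefficient of the denominator does not vanish. -/
theorem exists_hasQForm_of_mul_eq {l m : ℂ} {P F : ℂ → ℂ} {f g h : ℍ → ℂ}
    (hf : HasQForm l P f) (h0 : P 0 ≠ 0) (hg : HasQForm m F g) (hh : MDiff h)
    (e : ∀ τ, f τ * h τ = g τ) :
    ∃ H, HasQForm (m - l) H h ∧ ∀ q ∈ Metric.ball (0 : ℂ) 1, P q * H q = F q := by
  -- `k` is `h` without its fractional power; as `P · k = F`, it is periodic and bounded at the cusp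
  set k : ℍ → ℂ := fun τ => Complex.exp (2 * Real.pi * Complex.I * (-(m - l)) * τ) * h τ with hk
  have hexp : HasQForm (-(m - l)) (fun _ => 1)
      (fun τ => Complex.exp (2 * Real.pi * Complex.I * (-(m - l)) * τ)) :=
    ⟨differentiableOn_const _, fun τ => by simp⟩
  have hkd : MDiff k := hexp.mdifferentiable.mul hh
  have hPk : ∀ τ : ℍ, P (qParam 1 τ) * k τ = F (qParam 1 τ) := by
    intro τ
    have h1 := e τ
    rw [hf.eq, hg.eq] at h1
    have h2 : Complex.exp (2 * Real.pi * Complex.I * m * τ)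
        = Complex.exp (2 * Real.pi * Complex.I * (m - l) * τ)
          * Complex.exp (2 * Real.pi * Complex.I * l * τ) := by
      rw [← Complex.exp_add]; congr 1; ring
    have h3 : Complex.exp (2 * Real.pi * Complex.I * (-(m - l)) * τ)
        * Complex.exp (2 * Real.pi * Complex.I * (m - l) * τ) = 1 := by
      rw [← Complex.exp_add, ← Complex.exp_zero]; congr 1; ring
    apply mul_left_cancel₀ (Complex.exp_ne_zero (2 * Real.pi * Complex.I * l * τ))
    simp only [hk]
    linear_combination Complex.exp (2 * Real.pi * Complex.I * (-(m - l)) * τ) * h1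
      + Complex.exp (2 * Real.pi * Complex.I * (-(m - l)) * τ) * F (qParam 1 τ) * h2
      + Complex.exp (2 * Real.pi * Complex.I * l * τ) * F (qParam 1 τ) * h3
  have hPq : HasQForm 0 P (fun τ : ℍ => P (qParam 1 τ)) := ⟨hf.diff, fun τ => by simp⟩
  have hq1 : ∀ τ : ℍ, qParam 1 ((((1 : ℝ) +ᵥ τ : ℍ)) : ℂ) = qParam 1 (τ : ℂ) := by
    intro τ
    rw [qParam_one_eq, qParam_one_eq, coe_vadd, mul_add, Complex.exp_add]
    simp
  have hper : ∀ τ : ℍ, k ((1 : ℝ) +ᵥ τ) = k τ := by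
    have hkd' : MDiff (fun τ : ℍ => k ((1 : ℝ) +ᵥ τ)) := by
      rw [mdifferentiable_iff] at hkd ⊢
      have : DifferentiableOn ℂ ((k ∘ ofComplex) ∘ fun z => z + 1) {z | 0 < z.im} :=
        hkd.comp (by fun_prop) (fun z hz => by simpa using hz)
      refine this.congr fun z hz => ?_
      have hz' : 0 < (z + 1).im := by simpa using hz
      simp only [Function.comp_apply, ofComplex_apply_of_im_pos hz, ofComplex_apply_of_im_pos hz']
      congr 1
      ext
      simp [add_comm]
    have hz : (fun τ : ℍ => P (qParam 1 τ)) * (fun τ => k ((1 : ℝ) +ᵥ τ) - k τ) = 0 := by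
      ext τ
      have h1 := hPk ((1 : ℝ) +ᵥ τ)
      rw [hq1] at h1
      simp only [Pi.mul_apply, Pi.zero_apply]
      linear_combination h1 - hPk τ
    rcases (UpperHalfPlane.mul_eq_zero_iff hPq.mdifferentiable (hkd'.sub hkd)).mp hz with h | h
    · obtain ⟨τ, hτ⟩ := exists_ne_zero_of_hasQForm hPq h0
      exact absurd (congrFun h τ) hτ
    · intro τ
      exact sub_eq_zero.mp (congrFun h τ)
  have hb : IsBoundedAtImInfty k := by
    have ht : Filter.Tendsto (fun τ : ℍ => F (qParam 1 τ) / P (qParam 1 τ)) atImInfty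
        (𝓝 (F 0 / P 0)) := hg.tendsto_series.div hf.tendsto_series h0
    have ht' : Filter.Tendsto k atImInfty (𝓝 (F 0 / P 0)) := by
      refine ht.congr' ?_
      filter_upwards [hf.tendsto_series.eventually_ne h0] with τ hτ
      rw [← hPk τ, mul_div_cancel_left₀ _ hτ]
    exact ht'.isBigO_one ℝ
  obtain ⟨H, hH⟩ := exists_hasQForm_of_periodic hkd hper hb
  refine ⟨H, ⟨hH.diff, fun τ => ?_⟩, ?_⟩
  · have h1 := hH.eq τ
    simp only [mul_zero, zero_mul, Complex.exp_zero, one_mul] at h1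
    rw [← h1, hk, ← mul_assoc, ← Complex.exp_add]
    simp [← add_mul, ← mul_add]
  · refine eqOn_ball_of_qParam (hf.diff.mul hH.diff).continuousOn hg.diff.continuousOn fun τ => ?_
    have h1 := hH.eq τ
    simp only [mul_zero, zero_mul, Complex.exp_zero, one_mul] at h1
    show P _ * H _ = F _
    rw [← h1, hPk]

/-! ### Laurent series indexed by the integers -/

/-- A series over `ℤ` without terms of index less than `N` defines an expansion with leading
exponent `l + N`. -/
theorem exists_hasQForm_of_hasSum {l : ℂ} {f : ℍ → ℂ} {a : ℤ → ℂ} (N : ℤ)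
    (h : ∀ τ : ℍ, HasSum (fun n : ℤ => a n * Complex.exp (2 * Real.pi * Complex.I * n * τ))
      (Complex.exp (-(2 * Real.pi * Complex.I * l * τ)) * f τ))
    (hN : ∀ n < N, a n = 0) :
    ∃ F, HasQForm (l + N) F f ∧ F 0 = a N ∧ deriv F 0 = a (N + 1) := by
  have hinj : Function.Injective fun n : ℕ => N + (n : ℤ) := fun x y hxy => by
    simpa using hxy
  have hs : ∀ τ : ℍ, HasSum (fun n : ℕ => a (N + n) * qParam 1 (τ : ℂ) ^ n)
      (Complex.exp (-(2 * Real.pi * Complex.I * (l + N) * τ)) * f τ) := by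
    intro τ
    have h1 := (hinj.hasSum_iff (fun n hn => ?_)).mpr (h τ)
    · have h2 := h1.mul_left (Complex.exp (-(2 * Real.pi * Complex.I * N * τ)))
      rw [← mul_assoc, ← Complex.exp_add] at h2
      convert! h2 using 1
      · ext n
        have : Complex.exp (n * (2 * Real.pi * Complex.I * τ))
            = Complex.exp (-(2 * Real.pi * Complex.I * N * τ))
              * Complex.exp (2 * Real.pi * Complex.I * ((N + (n : ℤ) : ℤ) : ℂ) * τ) := by
          rw [← Complex.exp_add]; congr 1; push_cast; ring
        rw [qParam_one_eq, ← Complex.exp_nat_mul, this, Function.comp_apply]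
        ring
      · congr 2; ring
    · rw [hN n, zero_mul]
      by_contra hlt
      exact hn ⟨(n - N).toNat, by simp; omega⟩
  set c : ℕ → ℂ := fun n => a (N + n) with hc
  set p := FormalMultilinearSeries.ofScalars ℂ c with hp
  have hpn : ∀ n, ‖p n‖ = ‖c n‖ := fun n => by
    simp [hp]
  have hr : 1 ≤ p.radius := by
    refine le_of_forall_lt_imp_le_of_dense fun r hr => ?_
    rcases eq_or_ne r 0 with rfl | hr0
    · simp
    lift r to NNReal using hr.ne_top
    obtain ⟨τ, hτ⟩ := exists_qParam_eq (q := ((r : ℝ) : ℂ)) (by simpa using hr) (by simpa using hr0)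
    refine p.le_radius_of_summable ?_
    have h1 := (hs τ).summable.norm
    rw [hτ] at h1
    simpa [hpn] using h1
  have hsum : HasFPowerSeriesOnBall p.sum p 0 1 :=
    (p.hasFPowerSeriesOnBall (one_pos.trans_le hr)).mono one_pos hr
  have hball : Metric.ball (0 : ℂ) 1 = Metric.eball 0 1 := by
    rw [← ENNReal.coe_one, Metric.eball_coe, NNReal.coe_one]
  have hsumq : ∀ τ : ℍ, p.sum (qParam 1 (τ : ℂ))
      = Complex.exp (-(2 * Real.pi * Complex.I * (l + N) * τ)) * f τ := by
    intro τ
    have h1 := hsum.hasSum (y := qParam 1 (τ : ℂ))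
      (hball ▸ qParam_mem_ball τ)
    rw [zero_add] at h1
    refine h1.unique ?_
    convert! hs τ using 1
    ext n
    simp [hp, mul_comm, hc]
  refine ⟨p.sum, ⟨?_, fun τ => ?_⟩, ?_, ?_⟩
  · intro q hq
    refine (hsum.analyticAt_of_mem ?_).differentiableAt.differentiableWithinAt
    exact hball ▸ hq
  · rw [hsumq, ← mul_assoc, ← Complex.exp_add]; simp
  · rw [← hsum.coeff_zero (fun _ => 0)]
    simp [hp, FormalMultilinearSeries.ofScalars, hc]
  · rw [hsum.hasFPowerSeriesAt.deriv]
    simp [hp, hc]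

/-- The Taylor series of an expansion with leading exponent `l + N`, as a series over `ℤ`. -/
theorem HasQForm.hasSum {l : ℂ} {F : ℂ → ℂ} {f : ℍ → ℂ} (N : ℤ) (h : HasQForm (l + N) F f) :
    ∃ a : ℤ → ℂ, (∀ τ : ℍ,
      HasSum (fun n : ℤ => a n * Complex.exp (2 * Real.pi * Complex.I * n * τ))
        (Complex.exp (-(2 * Real.pi * Complex.I * l * τ)) * f τ)) ∧
      (∀ n < N, a n = 0) ∧ a N = F 0 ∧ a (N + 1) = _root_.deriv F 0 := by
  have hinj : Function.Injective fun n : ℕ => N + (n : ℤ) := fun x y hxy => by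
    simpa using hxy
  refine ⟨fun n => if n < N then 0 else
    ((n - N).toNat.factorial : ℂ)⁻¹ * iteratedDeriv (n - N).toNat F 0, fun τ => ?_,
    fun n hn => by simp [hn], by simp, by simp⟩
  refine (hinj.hasSum_iff (fun n hn => ?_)).mp ?_
  · have : n < N := by
      by_contra hlt
      exact hn ⟨(n - N).toNat, by simp; omega⟩
    simp [this]
  · have h1 := (Complex.hasSum_taylorSeries_on_ball h.diff (qParam_mem_ball τ)).mul_left
      (Complex.exp (2 * Real.pi * Complex.I * N * τ))
    convert! h1 using 1
    · ext n
      simp only [Function.comp_apply, add_lt_iff_neg_left, Int.natCast_nonneg, not_lt,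
        sub_zero, smul_eq_mul, add_sub_cancel_left, Int.toNat_natCast, if_neg]
      rw [qParam_one_eq, ← Complex.exp_nat_mul]
      have : Complex.exp (2 * Real.pi * Complex.I * ((N + (n : ℤ) : ℤ) : ℂ) * τ)
          = Complex.exp (2 * Real.pi * Complex.I * N * τ)
            * Complex.exp (n * (2 * Real.pi * Complex.I * τ)) := by
        rw [← Complex.exp_add]; congr 1; push_cast; ring
      rw [this]; ring
    · rw [h.eq, ← mul_assoc, ← Complex.exp_add]
      congr 2; ring

/-! ### Classical modular forms -/

/-- The normalized Eisenstein series of weight 6. -/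
def E6 (τ : ℍ) : ℂ := ModularForm.E (k := 6) (by norm_num) τ

/-- The modular invariant `j = E₄³ / Δ = J + 744`. -/
def jInv (τ : ℍ) : ℂ := E4 τ ^ 3 / ModularForm.discriminant τ

/-- The factor `E₁₄ / Δ^(7/6)` in the definition of the dual fundamental matrix. -/
def dualFactor (τ : ℍ) : ℂ := E14 τ / discPow τ

theorem J_eq (τ : ℍ) : J τ = jInv τ - 744 := rfl

theorem normalizedDeriv_mul {f g : ℍ → ℂ} (hf : MDiff f) (hg : MDiff g) (τ : ℍ) :
    Derivative.normalizedDerivOfComplex (fun z => f z * g z) τ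
      = Derivative.normalizedDerivOfComplex f τ * g τ
        + f τ * Derivative.normalizedDerivOfComplex g τ :=
  congrFun (Derivative.normalizedDerivOfComplex_mul f g hf hg) τ

theorem normalizedDeriv_pow {f : ℍ → ℂ} (hf : MDiff f) (n : ℕ) (τ : ℍ) :
    Derivative.normalizedDerivOfComplex (fun z => f z ^ n) τ
      = n * f τ ^ (n - 1) * Derivative.normalizedDerivOfComplex f τ :=
  congrFun (Derivative.normalizedDerivOfComplex_pow f n hf) τ

theorem mdifferentiable_div {f g : ℍ → ℂ} (hf : MDiff f) (hg : MDiff g) (h0 : ∀ τ, g τ ≠ 0) :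
    MDiff (fun τ => f τ / g τ) := by
  rw [mdifferentiable_iff] at *
  exact (hf.div hg fun z hz => h0 _).congr fun z hz => rfl

theorem mdifferentiable_pow {f : ℍ → ℂ} (hf : MDiff f) (n : ℕ) : MDiff (fun τ => f τ ^ n) := by
  rw [mdifferentiable_iff] at *
  exact (hf.pow n).congr fun z hz => rfl

theorem mdifferentiable_sum {ι : Type*} (s : Finset ι) {f : ι → ℍ → ℂ}
    (hf : ∀ i ∈ s, MDiff (f i)) : MDiff (fun τ => ∑ i ∈ s, f i τ) := by
  simp only [mdifferentiable_iff] at *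
  exact (DifferentiableOn.fun_sum hf).congr fun z hz => rfl

theorem mdifferentiable_prod {ι : Type*} (s : Finset ι) {f : ι → ℍ → ℂ}
    (hf : ∀ i ∈ s, MDiff (f i)) : MDiff (fun τ => ∏ i ∈ s, f i τ) := by
  simp only [mdifferentiable_iff] at *
  exact (DifferentiableOn.fun_finsetProd hf).congr fun z hz => rfl

/-- Holomorphic functions on the upper half-plane have no zero divisors. -/
theorem eq_zero_of_mul_eq_zero {f g : ℍ → ℂ} (hf : MDiff f) (hg : MDiff g)
    (hne : ∃ τ, f τ ≠ 0) (h : ∀ τ, f τ * g τ = 0) (τ : ℍ) : g τ = 0 := by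
  rcases (UpperHalfPlane.mul_eq_zero_iff hf hg).mp (funext h) with h1 | h1
  · obtain ⟨z, hz⟩ := hne
    exact absurd (congrFun h1 z) hz
  · exact congrFun h1 τ

theorem eq_of_mul_eq_mul {f g h : ℍ → ℂ} (hf : MDiff f) (hg : MDiff g) (hh : MDiff h)
    (hne : ∃ τ, f τ ≠ 0) (e : ∀ τ, f τ * g τ = f τ * h τ) (τ : ℍ) : g τ = h τ :=
  sub_eq_zero.mp (eq_zero_of_mul_eq_zero hf (hg.sub hh) hne
    (fun z => by simp only [Pi.sub_apply]; linear_combination e z) τ)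

theorem mdifferentiable_E4 : MDiff E4 := (ModularForm.E (k := 4) (by norm_num)).holo'

theorem mdifferentiable_E6 : MDiff E6 := (ModularForm.E (k := 6) (by norm_num)).holo'

theorem mdifferentiable_E10 : MDiff E10 := (ModularForm.E (k := 10) (by norm_num)).holo'

theorem mdifferentiable_E14 : MDiff E14 := (ModularForm.E (k := 14) (by norm_num)).holo'

theorem mdifferentiable_discriminant : MDiff ModularForm.discriminant :=
  CuspForm.discriminant.holo'

theorem mdifferentiable_eta : MDiff (fun τ : ℍ => ModularForm.eta τ) := by
  rw [mdifferentiable_iff]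
  refine DifferentiableOn.congr (fun z hz => ?_) (f := ModularForm.eta) fun z hz => ?_
  · exact (ModularForm.differentiableAt_eta_of_mem_upperHalfPlaneSet hz).differentiableWithinAt
  · simp [ofComplex_apply_of_im_pos hz]

theorem mdifferentiable_discPow : MDiff discPow := mdifferentiable_pow mdifferentiable_eta 28

theorem discPow_ne_zero (τ : ℍ) : discPow τ ≠ 0 :=
  pow_ne_zero _ (ModularForm.eta_ne_zero τ.im_pos)

theorem mdifferentiable_jInv : MDiff jInv :=
  mdifferentiable_div (mdifferentiable_pow mdifferentiable_E4 3) mdifferentiable_discriminant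
    ModularForm.discriminant_ne_zero

theorem mdifferentiable_curlyE : MDiff curlyE :=
  mdifferentiable_div mdifferentiable_E10 mdifferentiable_discriminant
    ModularForm.discriminant_ne_zero

theorem mdifferentiable_dualFactor : MDiff dualFactor :=
  mdifferentiable_div mdifferentiable_E14 mdifferentiable_discPow discPow_ne_zero

/-! ### Modular transformations -/

theorem modularForm_smul {k : ℤ} (f : ModularForm 𝒮ℒ k) (γ : SL(2, ℤ)) (τ : ℍ) :
    f (γ • τ) = denom γ τ ^ k * f τ := by
  have h := congrFun (SlashInvariantForm.slash_action_eqn f (γ : GL (Fin 2) ℝ) ⟨γ, rfl⟩) τ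
  rw [← ModularForm.SL_slash, ModularForm.SL_slash_apply] at h
  rw [← h, zpow_neg, mul_comm, mul_assoc, inv_mul_cancel₀ (zpow_ne_zero _ (denom_ne_zero _ _)),
    mul_one]

theorem E4_smul (γ : SL(2, ℤ)) (τ : ℍ) : E4 (γ • τ) = denom γ τ ^ 4 * E4 τ := by
  simpa using! modularForm_smul (ModularForm.E (k := 4) (by norm_num)) γ τ

theorem E6_smul (γ : SL(2, ℤ)) (τ : ℍ) : E6 (γ • τ) = denom γ τ ^ 6 * E6 τ := by
  simpa using! modularForm_smul (ModularForm.E (k := 6) (by norm_num)) γ τ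

theorem E10_smul (γ : SL(2, ℤ)) (τ : ℍ) : E10 (γ • τ) = denom γ τ ^ 10 * E10 τ := by
  simpa using! modularForm_smul (ModularForm.E (k := 10) (by norm_num)) γ τ

theorem E14_smul (γ : SL(2, ℤ)) (τ : ℍ) : E14 (γ • τ) = denom γ τ ^ 14 * E14 τ := by
  simpa using! modularForm_smul (ModularForm.E (k := 14) (by norm_num)) γ τ

theorem discriminant_smul (γ : SL(2, ℤ)) (τ : ℍ) : ModularForm.discriminant (γ • τ)
    = denom γ τ ^ 12 * ModularForm.discriminant τ := by
  have h := congrFun (SlashInvariantForm.slash_action_eqn CuspForm.discriminant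
    (γ : GL (Fin 2) ℝ) ⟨γ, rfl⟩) τ
  rw [← ModularForm.SL_slash, ModularForm.SL_slash_apply, CuspForm.coe_discriminant] at h
  rw [← h, zpow_neg, mul_comm, mul_assoc]
  rw [show denom (γ : GL (Fin 2) ℝ) τ ^ (12 : ℤ) = denom (γ : GL (Fin 2) ℝ) τ ^ 12 by norm_cast,
    inv_mul_cancel₀ (pow_ne_zero _ (denom_ne_zero _ _)), mul_one]

theorem jInv_smul (γ : SL(2, ℤ)) (τ : ℍ) : jInv (γ • τ) = jInv τ := by
  have h := denom_ne_zero (γ : GL (Fin 2) ℝ) τ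
  have h' := ModularForm.discriminant_ne_zero τ
  rw [jInv, E4_smul, discriminant_smul, jInv]
  field_simp

theorem normalizedDeriv_comp_smul {f : ℍ → ℂ} (hf : MDiff f) (γ : SL(2, ℤ)) (τ : ℍ) :
    Derivative.normalizedDerivOfComplex (fun z => f (γ • z)) τ * denom γ τ ^ 2
      = Derivative.normalizedDerivOfComplex f (γ • τ) := by
  have h := congrFun (Derivative.normalizedDerivOfComplex_SL_slash (k := 0) hf (γ := γ)) τ
  have h0 : (f ∣[(0 : ℤ)] γ) = fun z => f (γ • z) := by
    ext z; simp [ModularForm.SL_slash_apply]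
  rw [h0] at h
  rw [h]
  simp only [Pi.sub_apply, ModularForm.SL_slash_apply]
  have hd := denom_ne_zero (γ : GL (Fin 2) ℝ) τ
  simp only [zero_add, Int.cast_zero, zero_mul, sub_zero, zpow_neg]
  rw [mul_assoc]
  rw [show denom (γ : GL (Fin 2) ℝ) τ ^ (2 : ℤ) = denom (γ : GL (Fin 2) ℝ) τ ^ 2 by norm_cast,
    inv_mul_cancel₀ (pow_ne_zero _ (denom_ne_zero _ _)), mul_one]

/-- `∇` commutes with the action of the modular group, as `ℰ` has weight `-2`. -/
theorem nabla_comp_smul {f : ℍ → ℂ} (hf : MDiff f) (γ : SL(2, ℤ)) (τ : ℍ) :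
    nabla (fun z => f (γ • z)) τ = nabla f (γ • τ) := by
  have h := denom_ne_zero (γ : GL (Fin 2) ℝ) τ
  have h' := ModularForm.discriminant_ne_zero τ
  rw [nabla, nabla, ← normalizedDeriv_comp_smul hf, curlyE, curlyE, E10_smul, discriminant_smul]
  field_simp

theorem mdifferentiable_comp_smul {f : ℍ → ℂ} (hf : MDiff f) (γ : SL(2, ℤ)) :
    MDiff (fun z => f (γ • z)) := by
  have := hf.comp (mdifferentiable_smul (g := (γ : GL (Fin 2) ℝ)) (by simp))
  exact this

/-- If there are no cusp forms of weight `k`, a function that transforms with weight `k` and whose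
expansion has no constant term is zero. -/
theorem eq_zero_of_cuspForm {k : ℤ} (hk : ∀ g : CuspForm 𝒮ℒ k, g = 0) {f : ℍ → ℂ} {F : ℂ → ℂ}
    (hf : ∀ (γ : SL(2, ℤ)) (τ : ℍ), f (γ • τ) = denom γ τ ^ k * f τ)
    (hq : HasQForm 0 F f) (h0 : F 0 = 0) (τ : ℍ) : f τ = 0 := by
  have hslash : ∀ γ : SL(2, ℤ), (f ∣[k] γ) = f := by
    intro γ
    ext z
    rw [ModularForm.SL_slash_apply, hf, zpow_neg, mul_comm, ← mul_assoc,
      inv_mul_cancel₀ (zpow_ne_zero _ (denom_ne_zero _ _)), one_mul]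
  have hzero : IsZeroAtImInfty f := by
    have h1 := hq.tendsto_series
    rw [h0] at h1
    refine h1.congr fun z => ?_
    rw [hq.eq]; simp
  let g : CuspForm 𝒮ℒ k :=
    { toFun := f
      slash_action_eq' := by
        rintro _ ⟨A, rfl⟩
        exact hslash A
      holo' := hq.mdifferentiable
      zero_at_cusps' := fun hc => by
        rw [Subgroup.IsArithmetic.isCusp_iff_isCusp_SL2Z] at hc
        rw [OnePoint.isZeroAt_iff_forall_SL2Z hc]
        intro γ _
        rw [hslash]
        exact hzero }
  have h2 : (g : ℍ → ℂ) = 0 := by rw [hk g]; rfl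
  exact congrFun h2 τ

theorem cuspForm_ten_eq_zero (g : CuspForm 𝒮ℒ 10) : g = 0 :=
  rank_zero_iff_forall_zero.mp (CuspForm.rank_eq_zero_of_weight_lt_twelve (by norm_num)) g

/-- Division by `Δ` turns a cusp form of weight 14 into a modular form of weight 2. -/
theorem cuspForm_fourteen_eq_zero (g : CuspForm 𝒮ℒ 14) : g = 0 := by
  have h : Module.rank ℂ (CuspForm 𝒮ℒ 14) = 0 := by
    rw [CuspForm.discriminantEquiv.rank_eq]
    exact ModularForm.levelOne_weight_two_rank_zero
  exact rank_zero_iff_forall_zero.mp h g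

/-! ### Expansions of the classical forms -/

theorem exists_hasQForm_modularForm {k : ℤ} (f : ModularForm 𝒮ℒ k) :
    ∃ F, HasQForm 0 F f ∧ F 0 = (qExpansion 1 f).coeff 0 ∧
      deriv F 0 = (qExpansion 1 f).coeff 1 := by
  have h1 := one_mem_strictPeriods_SL
  refine ⟨cuspFunction 1 f, ⟨fun q hq => ?_, fun τ => ?_⟩, ?_, ?_⟩
  · exact (ModularFormClass.differentiableAt_cuspFunction f one_pos h1
      (by simpa using hq)).differentiableWithinAt
  · rw [SlashInvariantFormClass.eq_cuspFunction f τ h1 one_ne_zero]; simp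
  · rw [qExpansion_coeff]; simp
  · rw [qExpansion_coeff]; simp

theorem exists_hasQForm_E4 : ∃ F, HasQForm 0 F E4 ∧ F 0 = 1 ∧ deriv F 0 = 240 := by
  obtain ⟨F, h, h0, h1⟩ := exists_hasQForm_modularForm (ModularForm.E (k := 4) (by norm_num))
  exact ⟨F, h, h0.trans (EisensteinSeries.E_qExpansion_coeff_zero _ ⟨2, rfl⟩),
    h1.trans ModularForm.E₄_qExpansion_coeff_one⟩

theorem exists_hasQForm_E6 : ∃ F, HasQForm 0 F E6 ∧ F 0 = 1 ∧ deriv F 0 = -504 := by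
  obtain ⟨F, h, h0, h1⟩ := exists_hasQForm_modularForm (ModularForm.E (k := 6) (by norm_num))
  exact ⟨F, h, h0.trans (EisensteinSeries.E_qExpansion_coeff_zero _ ⟨3, rfl⟩),
    h1.trans ModularForm.E₆_qExpansion_coeff_one⟩

theorem E10_eq (τ : ℍ) : E10 τ = E4 τ * E6 τ := by
  obtain ⟨F, h, h0, -⟩ := exists_hasQForm_modularForm (ModularForm.E (k := 10) (by norm_num))
  obtain ⟨F4, h4, h40, -⟩ := exists_hasQForm_E4
  obtain ⟨F6, h6, h60, -⟩ := exists_hasQForm_E6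
  have hq := h.sub ((h4.mul h6).congr_index (add_zero 0))
  refine sub_eq_zero.mp (eq_zero_of_cuspForm cuspForm_ten_eq_zero (fun γ z => ?_) hq ?_ τ)
  · have := E10_smul γ z
    simp only [E10] at this
    rw [this, E4_smul, E6_smul]
    rw [show denom (γ : GL (Fin 2) ℝ) z ^ (10 : ℤ) = denom (γ : GL (Fin 2) ℝ) z ^ 10 by norm_cast]
    ring
  · simp only [h0, h40, h60]
    rw [EisensteinSeries.E_qExpansion_coeff_zero _ ⟨5, rfl⟩]; ring

theorem E14_eq (τ : ℍ) : E14 τ = E4 τ ^ 2 * E6 τ := by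
  obtain ⟨F, h, h0, -⟩ := exists_hasQForm_modularForm (ModularForm.E (k := 14) (by norm_num))
  obtain ⟨F4, h4, h40, -⟩ := exists_hasQForm_E4
  obtain ⟨F6, h6, h60, -⟩ := exists_hasQForm_E6
  have hq := h.sub (((h4.pow 2).mul h6).congr_index (by simp))
  refine sub_eq_zero.mp (eq_zero_of_cuspForm cuspForm_fourteen_eq_zero (fun γ z => ?_) hq ?_ τ)
  · have := E14_smul γ z
    simp only [E14] at this
    rw [this, E4_smul, E6_smul]
    rw [show denom (γ : GL (Fin 2) ℝ) z ^ (14 : ℤ) = denom (γ : GL (Fin 2) ℝ) z ^ 14 by norm_cast]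
    ring
  · simp only [h0, h40, h60]
    rw [EisensteinSeries.E_qExpansion_coeff_zero _ ⟨7, rfl⟩]; ring

theorem discriminant_eq (τ : ℍ) :
    1728 * ModularForm.discriminant τ = E4 τ ^ 3 - E6 τ ^ 2 := by
  have h : ModularForm.discriminant τ = (E4 τ ^ 3 - E6 τ ^ 2) / 1728 :=
    ModularForm.discriminant_eq_E₄_cube_sub_E₆_sq τ
  rw [h]; ring

theorem jInv_mul_discriminant (τ : ℍ) : jInv τ * ModularForm.discriminant τ = E4 τ ^ 3 :=
  div_mul_cancel₀ _ (ModularForm.discriminant_ne_zero τ)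

theorem jInv_sub_mul_discriminant (τ : ℍ) :
    (jInv τ - 1728) * ModularForm.discriminant τ = E6 τ ^ 2 := by
  linear_combination jInv_mul_discriminant τ - discriminant_eq τ

theorem curlyE_mul_discriminant (τ : ℍ) :
    curlyE τ * ModularForm.discriminant τ = E4 τ * E6 τ := by
  rw [← E10_eq]; exact div_mul_cancel₀ _ (ModularForm.discriminant_ne_zero τ)

theorem dualFactor_mul_discPow (τ : ℍ) : dualFactor τ * discPow τ = E14 τ :=
  div_mul_cancel₀ _ (discPow_ne_zero τ)

theorem exists_hasQForm_discriminant_leading :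
    ∃ F, HasQForm 1 F ModularForm.discriminant ∧ F 0 = 1 := by
  have hm := one_mem_strictPeriods_SL
  have h : HasQForm 0 (cuspFunction 1 ModularForm.discriminant) ModularForm.discriminant := by
    refine ⟨fun q hq => ?_, fun τ => ?_⟩
    · exact (ModularFormClass.differentiableAt_cuspFunction CuspForm.discriminant one_pos hm
        (by simpa using hq)).differentiableWithinAt
    · have := SlashInvariantFormClass.eq_cuspFunction CuspForm.discriminant τ hm one_ne_zero
      rw [CuspForm.coe_discriminant] at this
      rw [this]; simp
  obtain ⟨G, hG, hG0⟩ := h.exists_unshift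
    (CuspFormClass.cuspFunction_apply_zero CuspForm.discriminant one_pos hm)
  refine ⟨G, hG.congr_index (by simp), ?_⟩
  have := ModularForm.discriminant_qExpansion_coeff_one
  rw [qExpansion_coeff] at this
  rw [hG0]
  simpa using this

theorem exists_hasQForm_E14 : ∃ F, HasQForm 0 F E14 ∧ F 0 = 1 ∧ deriv F 0 = -24 := by
  obtain ⟨F4, h4, h40, h41⟩ := exists_hasQForm_E4
  obtain ⟨F6, h6, h60, h61⟩ := exists_hasQForm_E6
  refine ⟨_, ⟨((h4.pow 2).mul h6).diff, fun τ => ?_⟩, ?_, ?_⟩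
  · rw [E14_eq, ((h4.pow 2).mul h6).eq]; simp
  · simp [h40, h60]
  · have d4 := h4.differentiableAt_zero
    have d6 := h6.differentiableAt_zero
    rw [deriv_fun_mul (d4.fun_pow 2) d6, deriv_fun_pow d4, h40, h60, h41, h61]; norm_num

/-- `Δ · θ j = -E₁₄`, where `θ = q d/dq`: the weight 14 form on the left has constant term `-1`. -/
theorem discriminant_mul_deriv_jInv (τ : ℍ) :
    ModularForm.discriminant τ * Derivative.normalizedDerivOfComplex jInv τ
      = -(E4 τ ^ 2 * E6 τ) := by
  obtain ⟨PD, hD, hD0⟩ := exists_hasQForm_discriminant_leading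
  obtain ⟨F4, h4, h40, -⟩ := exists_hasQForm_E4
  obtain ⟨F14, h14, h140, -⟩ := exists_hasQForm_E14
  obtain ⟨H, hH, hHe⟩ := exists_hasQForm_of_mul_eq hD (by simp [hD0]) (h4.pow 3)
    mdifferentiable_jInv (fun z => (mul_comm _ _).trans (jInv_mul_discriminant z))
  have hH0 : H 0 = 1 := by
    have := hHe 0 (Metric.mem_ball_self one_pos)
    simpa [hD0, h40] using this
  have hq := ((hD.mul hH.deriv).congr_index (by simp)).add h14
  rw [← E14_eq]
  refine eq_neg_of_add_eq_zero_left (eq_zero_of_cuspForm cuspForm_fourteen_eq_zero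
    (fun γ z => ?_) hq ?_ τ)
  · rw [E14_smul, discriminant_smul, ← normalizedDeriv_comp_smul mdifferentiable_jInv]
    simp only [jInv_smul]
    rw [show denom (γ : GL (Fin 2) ℝ) z ^ (14 : ℤ) = denom (γ : GL (Fin 2) ℝ) z ^ 14 by norm_cast]
    simp only [show (fun z => jInv z) = jInv from rfl]
    ring
  · simp [hD0, hH0, h140]

/-- `Δ = q (1 - 24 q + ⋯)`. The second coefficient is obtained by comparing coefficients in
`Δ · θ (E₄³ / Δ) = -E₁₄`. -/
theorem exists_hasQForm_discriminant :
    ∃ F, HasQForm 1 F ModularForm.discriminant ∧ F 0 = 1 ∧ deriv F 0 = -24 := by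
  obtain ⟨PD, hD, hD0⟩ := exists_hasQForm_discriminant_leading
  obtain ⟨F4, h4, h40, -⟩ := exists_hasQForm_E4
  obtain ⟨F14, h14, h140, h141⟩ := exists_hasQForm_E14
  obtain ⟨H, hH, hHe⟩ := exists_hasQForm_of_mul_eq hD (by simp [hD0]) (h4.pow 3)
    mdifferentiable_jInv (fun z => (mul_comm _ _).trans (jInv_mul_discriminant z))
  have hH0 : H 0 = 1 := by
    have := hHe 0 (Metric.mem_ball_self one_pos)
    simpa [hD0, h40] using this
  refine ⟨PD, hD, hD0, ?_⟩
  have hE := (((hD.mul hH.deriv).congr_index (m := 0) (by simp)).add h14)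
  have hz : HasQForm 0 (fun _ => 0) (fun τ => ModularForm.discriminant τ *
      Derivative.normalizedDerivOfComplex jInv τ + E14 τ) :=
    ⟨differentiableOn_const _, fun τ => by rw [discriminant_mul_deriv_jInv, E14_eq]; ring⟩
  have he := hE.unique hz
  have hd : deriv (fun q => PD q * (((3 : ℕ) * 0 - 1) * H q + q * deriv H q) + F14 q) 0
      = deriv (fun _ : ℂ => (0 : ℂ)) 0 :=
    (he.eventuallyEq_of_mem (Metric.ball_mem_nhds _ one_pos)).deriv_eq
  have dD := hD.differentiableAt_zero
  have dH := hH.differentiableAt_zero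
  have d14 := h14.differentiableAt_zero
  have dH' : DifferentiableAt ℂ (deriv H) 0 :=
    (hH.diff.deriv Metric.isOpen_ball).differentiableAt (Metric.ball_mem_nhds _ one_pos)
  rw [deriv_fun_add (by fun_prop) d14, deriv_fun_mul dD (by fun_prop),
    deriv_fun_add (by fun_prop) (by fun_prop), deriv_const_mul _ dH,
    deriv_fun_mul (by fun_prop) dH', hD0, hH0, h141] at hd
  simp only [Nat.cast_ofNat, mul_zero, zero_sub, deriv_id'', deriv_const] at hd
  linear_combination -hd

/-- The second coefficient is that of `Δ = η ^ 24`, divided by 24. -/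
theorem exists_hasQForm_eta : ∃ F, HasQForm (1 / 24) F (fun τ : ℍ => ModularForm.eta τ) ∧
    F 0 = 1 ∧ deriv F 0 = -1 := by
  have h : HasQForm (1 / 24) (fun q => ∏' n : ℕ, (1 - q ^ (n + 1)))
      (fun τ : ℍ => ModularForm.eta τ) := by
    refine ⟨ModularForm.differentiableOn_tprod_one_sub_pow, fun τ => ?_⟩
    rw [ModularForm.eta]
    congr 1
    · simp only [qParam]; congr 1; push_cast; ring
  obtain ⟨PD, hD, hD0, hD1⟩ := exists_hasQForm_discriminant
  refine ⟨_, h, by simp, ?_⟩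
  have h24 := (h.pow 24).congr_index (m := 1) (by norm_num)
  have he : deriv (fun q : ℂ => (∏' n : ℕ, (1 - q ^ (n + 1))) ^ 24) 0 = deriv PD 0 :=
    ((h24.unique hD).eventuallyEq_of_mem (Metric.ball_mem_nhds _ one_pos)).deriv_eq
  rw [deriv_fun_pow h.differentiableAt_zero, hD1] at he
  simp at he
  linear_combination he / 24

theorem exists_hasQForm_discPow : ∃ F, HasQForm (7 / 6) F discPow ∧
    F 0 = 1 ∧ deriv F 0 = -28 := by
  obtain ⟨P, h, h0, h1⟩ := exists_hasQForm_eta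
  refine ⟨_, (h.pow 28).congr_index (by norm_num), by simp [h0], ?_⟩
  rw [deriv_fun_pow h.differentiableAt_zero, h0, h1]; norm_num

theorem exists_hasQForm_dualFactor : ∃ F, HasQForm (-(7 / 6)) F dualFactor ∧
    F 0 = 1 ∧ deriv F 0 = 4 := by
  obtain ⟨P, h, h0, h1⟩ := exists_hasQForm_discPow
  obtain ⟨F14, h14, h140, h141⟩ := exists_hasQForm_E14
  obtain ⟨S, hS, hSe⟩ := exists_hasQForm_of_mul_eq h (by simp [h0]) h14
    mdifferentiable_dualFactor (fun z => (mul_comm _ _).trans (dualFactor_mul_discPow z))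
  have hS0 : S 0 = 1 := by
    have := hSe 0 (Metric.mem_ball_self one_pos)
    simpa [h0, h140] using this
  refine ⟨S, hS.congr_index (by ring), hS0, ?_⟩
  have hd : deriv (fun q => P q * S q) 0 = deriv F14 0 :=
    (Set.EqOn.eventuallyEq_of_mem (s := Metric.ball 0 1) hSe
      (Metric.ball_mem_nhds _ one_pos)).deriv_eq
  rw [deriv_fun_mul h.differentiableAt_zero hS.differentiableAt_zero, h0, h1, hS0, h141] at hd
  linear_combination hd

theorem exists_hasQForm_curlyE : ∃ F, HasQForm (-1) F curlyE ∧
    F 0 = 1 ∧ deriv F 0 = -240 := by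
  obtain ⟨P, h, h0, h1⟩ := exists_hasQForm_discriminant
  obtain ⟨F4, h4, h40, h41⟩ := exists_hasQForm_E4
  obtain ⟨F6, h6, h60, h61⟩ := exists_hasQForm_E6
  obtain ⟨S, hS, hSe⟩ := exists_hasQForm_of_mul_eq h (by simp [h0]) (h4.mul h6)
    mdifferentiable_curlyE (fun z => (mul_comm _ _).trans (curlyE_mul_discriminant z))
  have hS0 : S 0 = 1 := by
    have := hSe 0 (Metric.mem_ball_self one_pos)
    simpa [h0, h40, h60] using this
  refine ⟨S, hS.congr_index (by ring), hS0, ?_⟩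
  have hd : deriv (fun q => P q * S q) 0 = deriv (fun q => F4 q * F6 q) 0 :=
    (Set.EqOn.eventuallyEq_of_mem (s := Metric.ball 0 1) hSe
      (Metric.ball_mem_nhds _ one_pos)).deriv_eq
  rw [deriv_fun_mul h.differentiableAt_zero hS.differentiableAt_zero,
    deriv_fun_mul h4.differentiableAt_zero h6.differentiableAt_zero,
    h0, h1, hS0, h40, h41, h60, h61] at hd
  linear_combination hd

theorem exists_hasQForm_J : ∃ F, HasQForm (-1) F J ∧ F 0 = 1 ∧ deriv F 0 = 0 := by
  obtain ⟨P, h, h0, h1⟩ := exists_hasQForm_discriminant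
  obtain ⟨F4, h4, h40, h41⟩ := exists_hasQForm_E4
  obtain ⟨S, hS, hSe⟩ := exists_hasQForm_of_mul_eq h (by simp [h0]) (h4.pow 3)
    mdifferentiable_jInv (fun z => (mul_comm _ _).trans (jInv_mul_discriminant z))
  have hS0 : S 0 = 1 := by
    have := hSe 0 (Metric.mem_ball_self one_pos)
    simpa [h0, h40] using this
  have hd : deriv (fun q => P q * S q) 0 = deriv (fun q => F4 q ^ 3) 0 :=
    (Set.EqOn.eventuallyEq_of_mem (s := Metric.ball 0 1) hSe
      (Metric.ball_mem_nhds _ one_pos)).deriv_eq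
  rw [deriv_fun_mul h.differentiableAt_zero hS.differentiableAt_zero,
    deriv_fun_pow h4.differentiableAt_zero, h0, h1, hS0, h40, h41] at hd
  have h744 : HasQForm (-1) (fun q => q ^ 1 * 744) (fun _ => (744 : ℂ)) :=
    HasQForm.shift 1 ((HasQForm.const 744).congr_index (by norm_num))
  refine ⟨_, (hS.congr_index (by ring)).sub h744, by simp [hS0], ?_⟩
  rw [deriv_fun_sub hS.differentiableAt_zero (by fun_prop)]
  simp
  linear_combination hd

/-! ### Differential identities -/

theorem exists_E4_ne_zero : ∃ τ, E4 τ ≠ 0 := by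
  obtain ⟨F, h, h0, -⟩ := exists_hasQForm_E4
  exact exists_ne_zero_of_hasQForm h (by simp [h0])

theorem exists_E6_ne_zero : ∃ τ, E6 τ ≠ 0 := by
  obtain ⟨F, h, h0, -⟩ := exists_hasQForm_E6
  exact exists_ne_zero_of_hasQForm h (by simp [h0])

theorem exists_dualFactor_ne_zero : ∃ τ, dualFactor τ ≠ 0 := by
  obtain ⟨F, h, h0, -⟩ := exists_hasQForm_dualFactor
  exact exists_ne_zero_of_hasQForm h (by simp [h0])

theorem nabla_jInv (τ : ℍ) : nabla jInv τ = -(jInv τ * (jInv τ - 1728)) := by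
  have hD := ModularForm.discriminant_ne_zero τ
  have h1 := discriminant_mul_deriv_jInv τ
  have h2 := jInv_mul_discriminant τ
  have h3 := jInv_sub_mul_discriminant τ
  have h4 := curlyE_mul_discriminant τ
  rw [nabla]
  apply mul_right_cancel₀ (pow_ne_zero 2 hD)
  linear_combination (curlyE τ * ModularForm.discriminant τ) * h1 - (E4 τ ^ 2 * E6 τ) * h4
    + E6 τ ^ 2 * h2 + jInv τ * ModularForm.discriminant τ * h3

/-- The Ramanujan identity `3 θE₄ = E₂ E₄ - E₆`, with `E₂ = θΔ / Δ`. -/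
theorem deriv_E4 (τ : ℍ) : ModularForm.discriminant τ *
      (3 * Derivative.normalizedDerivOfComplex E4 τ + E6 τ)
    = E4 τ * Derivative.normalizedDerivOfComplex ModularForm.discriminant τ := by
  have mD := mdifferentiable_discriminant
  have mD' := Derivative.normalizedDerivOfComplex_mdifferentiable mD
  have m4 := mdifferentiable_E4
  have m4' := Derivative.normalizedDerivOfComplex_mdifferentiable m4
  have hf : (fun z => jInv z * ModularForm.discriminant z) = fun z => E4 z ^ 3 :=
    funext jInv_mul_discriminant
  refine eq_of_mul_eq_mul (mdifferentiable_pow m4 2)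
    (mD.mul ((m4'.const_smul (3 : ℂ)).add mdifferentiable_E6)) (m4.mul mD')
    (exists_E4_ne_zero.imp fun z hz => pow_ne_zero 2 hz) (fun z => ?_) τ
  have h := normalizedDeriv_mul mdifferentiable_jInv mD z
  rw [hf, normalizedDeriv_pow m4] at h
  have h1 := discriminant_mul_deriv_jInv z
  have h2 := jInv_mul_discriminant z
  simp only [Pi.mul_apply, Pi.add_apply, Pi.smul_apply, smul_eq_mul]
  push_cast at h
  linear_combination ModularForm.discriminant z * h + ModularForm.discriminant z * h1
    + Derivative.normalizedDerivOfComplex ModularForm.discriminant z * h2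

/-- The Ramanujan identity `2 θE₆ = E₂ E₆ - E₄²`, with `E₂ = θΔ / Δ`. -/
theorem deriv_E6 (τ : ℍ) : ModularForm.discriminant τ *
      (2 * Derivative.normalizedDerivOfComplex E6 τ + E4 τ ^ 2)
    = E6 τ * Derivative.normalizedDerivOfComplex ModularForm.discriminant τ := by
  have mD := mdifferentiable_discriminant
  have mD' := Derivative.normalizedDerivOfComplex_mdifferentiable mD
  have m4 := mdifferentiable_E4
  have m6 := mdifferentiable_E6
  have m6' := Derivative.normalizedDerivOfComplex_mdifferentiable m6
  have hf : (fun z => jInv z * ModularForm.discriminant z)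
      = fun z => E6 z ^ 2 + 1728 * ModularForm.discriminant z := by
    ext z; linear_combination jInv_mul_discriminant z - discriminant_eq z
  refine eq_of_mul_eq_mul m6
    (mD.mul ((m6'.const_smul (2 : ℂ)).add (mdifferentiable_pow m4 2))) (m6.mul mD')
    exists_E6_ne_zero (fun z => ?_) τ
  have h := normalizedDeriv_mul mdifferentiable_jInv mD z
  have h0 : Derivative.normalizedDerivOfComplex
      (fun z => E6 z ^ 2 + 1728 * ModularForm.discriminant z) z
      = 2 * E6 z * Derivative.normalizedDerivOfComplex E6 z
        + 1728 * Derivative.normalizedDerivOfComplex ModularForm.discriminant z := by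
    have e1 := congrFun (Derivative.normalizedDerivOfComplex_add (fun z => E6 z ^ 2)
      ((1728 : ℂ) • ModularForm.discriminant) (mdifferentiable_pow m6 2)
      (mD.const_smul (1728 : ℂ))) z
    rw [Derivative.normalizedDerivOfComplex_smul _ _ mD] at e1
    refine Eq.trans e1 ?_
    rw [Pi.add_apply, normalizedDeriv_pow m6]
    simp
  rw [hf, h0] at h
  have h1 := discriminant_mul_deriv_jInv z
  have h2 := jInv_sub_mul_discriminant z
  simp only [Pi.mul_apply, Pi.add_apply, Pi.smul_apply, smul_eq_mul]
  linear_combination ModularForm.discriminant z * h + ModularForm.discriminant z * h1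
    + Derivative.normalizedDerivOfComplex ModularForm.discriminant z * h2

theorem E4_ne_zero_or_E6_ne_zero (τ : ℍ) : E4 τ ≠ 0 ∨ E6 τ ≠ 0 := by
  by_contra! h
  have := discriminant_eq τ
  rw [h.1, h.2] at this
  simp [ModularForm.discriminant_ne_zero] at this

/-- The derivative of `ℰ Δ = E₄ E₆`. -/
theorem deriv_curlyE_mul_discriminant (τ : ℍ) :
    Derivative.normalizedDerivOfComplex curlyE τ * ModularForm.discriminant τ
      + curlyE τ * Derivative.normalizedDerivOfComplex ModularForm.discriminant τ
      = Derivative.normalizedDerivOfComplex E4 τ * E6 τ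
        + E4 τ * Derivative.normalizedDerivOfComplex E6 τ := by
  rw [← normalizedDeriv_mul mdifferentiable_curlyE mdifferentiable_discriminant,
    ← normalizedDeriv_mul mdifferentiable_E4 mdifferentiable_E6]
  congr 1; ext z; exact curlyE_mul_discriminant z

theorem curlyE_eq_zero_iff (τ : ℍ) : curlyE τ = 0 ↔ E4 τ = 0 ∨ E6 τ = 0 := by
  have h := curlyE_mul_discriminant τ
  rw [← mul_eq_zero, ← h, mul_eq_zero, or_iff_left (ModularForm.discriminant_ne_zero τ)]

theorem deriv_curlyE_of_E4_eq_zero {τ : ℍ} (h : E4 τ = 0) :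
    Derivative.normalizedDerivOfComplex curlyE τ = 576 := by
  have hD := ModularForm.discriminant_ne_zero τ
  have h1 := deriv_curlyE_mul_discriminant τ
  have h2 := deriv_E4 τ
  have h3 := discriminant_eq τ
  have h4 := (curlyE_eq_zero_iff τ).mpr (Or.inl h)
  rw [h4, h] at h1
  rw [h] at h2 h3
  apply mul_right_cancel₀ (pow_ne_zero 2 hD)
  linear_combination ModularForm.discriminant τ * h1 + E6 τ * h2 / 3
    - ModularForm.discriminant τ * h3 / 3

theorem deriv_curlyE_of_E6_eq_zero {τ : ℍ} (h : E6 τ = 0) :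
    Derivative.normalizedDerivOfComplex curlyE τ = -864 := by
  have hD := ModularForm.discriminant_ne_zero τ
  have h1 := deriv_curlyE_mul_discriminant τ
  have h2 := deriv_E6 τ
  have h3 := discriminant_eq τ
  have h4 := (curlyE_eq_zero_iff τ).mpr (Or.inr h)
  rw [h4, h] at h1
  rw [h] at h2 h3
  apply mul_right_cancel₀ (pow_ne_zero 2 hD)
  linear_combination ModularForm.discriminant τ * h1 + E4 τ * h2 / 2
    + ModularForm.discriminant τ * h3 / 2

theorem deriv_E4_ne_zero {τ : ℍ} (h : E4 τ = 0) :
    Derivative.normalizedDerivOfComplex E4 τ ≠ 0 := by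
  intro h0
  have h2 := deriv_E4 τ
  rw [h0, h] at h2
  have h6 := (E4_ne_zero_or_E6_ne_zero τ).resolve_left (by simp [h])
  simp [ModularForm.discriminant_ne_zero, h6] at h2

theorem deriv_E6_ne_zero {τ : ℍ} (h : E6 τ = 0) :
    Derivative.normalizedDerivOfComplex E6 τ ≠ 0 := by
  intro h0
  have h2 := deriv_E6 τ
  rw [h0, h] at h2
  have h4 := (E4_ne_zero_or_E6_ne_zero τ).resolve_right (by simp [h])
  simp [ModularForm.discriminant_ne_zero, h4] at h2

theorem dualFactor_pow_six (τ : ℍ) :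
    dualFactor τ ^ 6 = jInv τ ^ 4 * (jInv τ - 1728) ^ 3 := by
  have hD := ModularForm.discriminant_ne_zero τ
  have h1 : discPow τ ^ 6 = ModularForm.discriminant τ ^ 7 := by
    rw [discPow, ModularForm.discriminant, ← pow_mul, ← pow_mul]
  apply mul_right_cancel₀ (pow_ne_zero 7 hD)
  calc dualFactor τ ^ 6 * ModularForm.discriminant τ ^ 7
      = (dualFactor τ * discPow τ) ^ 6 := by rw [mul_pow, h1]
    _ = (jInv τ * ModularForm.discriminant τ) ^ 4
        * ((jInv τ - 1728) * ModularForm.discriminant τ) ^ 3 := by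
      rw [dualFactor_mul_discPow, jInv_mul_discriminant, jInv_sub_mul_discriminant, E14_eq]; ring
    _ = _ := by ring

/-- Logarithmic derivative of `s = E₁₄ / Δ^(7/6)`, obtained from `s⁶ = j⁴ (j - 1728)³`. -/
theorem nabla_dualFactor (τ : ℍ) :
    nabla dualFactor τ = -((7 * jInv τ - 6912) / 6) * dualFactor τ := by
  have ms := mdifferentiable_dualFactor
  have mj := mdifferentiable_jInv
  have ms' := Derivative.normalizedDerivOfComplex_mdifferentiable ms
  have mc : ∀ c : ℂ, MDiff (fun _ : ℍ => c) := fun c => mdifferentiable_const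
  have mj' : MDiff (fun z => jInv z - 1728) := mj.sub (mc 1728)
  refine eq_of_mul_eq_mul (mdifferentiable_pow ms 5) (mdifferentiable_curlyE.mul ms')
    (MDifferentiable.mul (p := fun τ => -((7 * jInv τ - 6912) / 6)) ?_ ms)
    (exists_dualFactor_ne_zero.imp fun z hz => pow_ne_zero 5 hz) (fun z => ?_) τ
  · have : MDiff (fun τ => (-(7 / 6 : ℂ)) * jInv τ + 1152) :=
      ((mc (-(7 / 6 : ℂ))).mul mj).add (mc 1152)
    refine (congrArg _ ?_).mp this
    ext τ; ring
  have hsub : Derivative.normalizedDerivOfComplex (fun z => jInv z - 1728) z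
      = Derivative.normalizedDerivOfComplex jInv z := by
    have := congrFun (Derivative.normalizedDerivOfComplex_sub jInv (fun _ => 1728) mj (mc _)) z
    refine Eq.trans this ?_
    simp
  have h1 : Derivative.normalizedDerivOfComplex (fun z => dualFactor z ^ 6) z
      = Derivative.normalizedDerivOfComplex
        (fun z => jInv z ^ 4 * (jInv z - 1728) ^ 3) z := by
    congr 1; ext z; exact dualFactor_pow_six z
  rw [normalizedDeriv_pow ms,
    normalizedDeriv_mul (mdifferentiable_pow mj 4) (mdifferentiable_pow mj' 3),
    normalizedDeriv_pow mj, normalizedDeriv_pow mj', hsub] at h1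
  have h2 := nabla_jInv z
  have h3 := dualFactor_pow_six z
  rw [nabla] at h2
  simp only [Pi.mul_apply]
  push_cast at h1
  linear_combination curlyE z * h1 / 6 + (4 * jInv z ^ 3 * (jInv z - 1728) ^ 3
    + 3 * jInv z ^ 4 * (jInv z - 1728) ^ 2) / 6 * h2 - ((7 * jInv z - 6912) / 6) * (-h3)

/-! ### Zeros of the Eisenstein series of weights 4 and 6 -/

theorem norm_pow_sub_pow_le {q q' : ℂ} {r : ℝ} (hq : ‖q‖ ≤ r) (hq' : ‖q'‖ ≤ r) (n : ℕ) :
    ‖q ^ (n + 1) - q' ^ (n + 1)‖ ≤ (n + 1) * r ^ n * ‖q - q'‖ := by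
  have hr : 0 ≤ r := (norm_nonneg _).trans hq
  rw [← (Commute.all q q').geom_sum₂_mul, norm_mul]
  refine mul_le_mul_of_nonneg_right ?_ (norm_nonneg _)
  calc ‖∑ i ∈ Finset.range (n + 1), q ^ i * q' ^ (n + 1 - 1 - i)‖
      ≤ ∑ i ∈ Finset.range (n + 1), r ^ n := by
        refine norm_sum_le_of_le _ fun i hi => ?_
        have hi' : i ≤ n := Nat.lt_succ_iff.mp (Finset.mem_range.mp hi)
        rw [norm_mul, norm_pow, norm_pow, add_tsub_cancel_right]
        calc ‖q‖ ^ i * ‖q'‖ ^ (n - i) ≤ r ^ i * r ^ (n - i) := by gcongr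
          _ = r ^ n := by rw [← pow_add, Nat.add_sub_cancel' hi']
    _ = (n + 1) * r ^ n := by simp

/-- A power series `q + ⋯` whose coefficients satisfy `n |c n| ≤ 66 ^ (n - 1)` is injective on the
disc `|q| ≤ 1 / 200`: the linear term dominates the difference of the others. -/
theorem eq_of_hasSum_eq {c : ℕ → ℂ} (hc1 : c 1 = 1)
    (hc : ∀ n : ℕ, (n + 2) * ‖c (n + 2)‖ ≤ 66 ^ (n + 1)) {q q' v : ℂ}
    (hq : ‖q‖ ≤ 1 / 200) (hq' : ‖q'‖ ≤ 1 / 200)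
    (h : HasSum (fun n => c n * q ^ n) v) (h' : HasSum (fun n => c n * q' ^ n) v) : q = q' := by
  have h1 : HasSum (fun n => c n * q ^ n - c n * q' ^ n) 0 := by simpa using h.sub h'
  have h2 := (hasSum_nat_add_iff' 2).mpr h1
  simp only [Finset.sum_range_succ, Finset.sum_range_zero, hc1, pow_zero, pow_one] at h2
  have h3 : HasSum (fun n : ℕ => (33 / 100 : ℝ) * (33 / 100 : ℝ) ^ n * ‖q - q'‖)
      ((33 / 100 : ℝ) * (1 - 33 / 100)⁻¹ * ‖q - q'‖) :=
    ((hasSum_geometric_of_lt_one (by norm_num) (by norm_num)).mul_left _).mul_right _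
  have h4 : ‖(0 : ℂ) - (0 + (c 0 * 1 - c 0 * 1) + (1 * q - 1 * q'))‖
      ≤ (33 / 100 : ℝ) * (1 - 33 / 100)⁻¹ * ‖q - q'‖ := by
    rw [← h2.tsum_eq]
    refine tsum_of_norm_bounded h3 fun n => ?_
    rw [← mul_sub, norm_mul]
    have h5 := norm_pow_sub_pow_le hq hq' (n + 1)
    push_cast at h5
    calc ‖c (n + 2)‖ * ‖q ^ (n + 2) - q' ^ (n + 2)‖
        ≤ ‖c (n + 2)‖ * ((n + 1 + 1) * (1 / 200) ^ (n + 1) * ‖q - q'‖) := by gcongr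
      _ = ((n + 2) * ‖c (n + 2)‖) * ((1 / 200) ^ (n + 1) * ‖q - q'‖) := by ring
      _ ≤ 66 ^ (n + 1) * ((1 / 200) ^ (n + 1) * ‖q - q'‖) :=
        mul_le_mul_of_nonneg_right (hc n) (by positivity)
      _ = (66 * (1 / 200)) ^ (n + 1) * ‖q - q'‖ := by rw [mul_pow]; ring
      _ = _ := by
        rw [pow_succ]
        norm_num
        exact Or.inl (mul_comm _ _)
  have h6 : ‖(0 : ℂ) - (0 + (c 0 * 1 - c 0 * 1) + (1 * q - 1 * q'))‖ = ‖q - q'‖ := by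
    rw [← norm_neg]; congr 1; ring
  rw [h6] at h4
  have h7 : ‖q - q'‖ ≤ 0 := by
    norm_num at h4
    linarith [norm_nonneg (q - q')]
  exact sub_eq_zero.mp (norm_le_zero_iff.mp h7)

theorem pow_seven_le (n : ℕ) : (n + 3) ^ 7 ≤ 66 ^ (n + 2) := by
  induction n with
  | zero => norm_num
  | succ n ih =>
    have h : (n + 1 + 3) ^ 7 ≤ (2 * (n + 3)) ^ 7 * 1 := by
      rw [mul_one]; exact Nat.pow_le_pow_left (by omega) 7
    have h2 : 3 * (n + 1 + 3) ≤ 4 * (n + 3) := by omega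
    have h3 := Nat.pow_le_pow_left h2 7
    rw [mul_pow, mul_pow] at h3
    have h4 : (66 : ℕ) ^ (n + 1 + 2) = 66 * 66 ^ (n + 2) := by ring
    rw [h4]
    norm_num at h3
    nlinarith [h3, ih]

/-- The coefficients of the Eisenstein series of weights 4 and 6 satisfy the hypothesis of
`eq_of_hasSum_eq`. The base 66 comes from the coefficient `2 σ₅(2) = 66`. -/
theorem mul_sigma_le {k : ℕ} (hk : k ≤ 5) (n : ℕ) :
    (n + 2) * ArithmeticFunction.sigma k (n + 2) ≤ 66 ^ (n + 1) := by
  rcases n with _ | n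
  · have h2 : Nat.divisors 2 = {1, 2} := by decide
    rw [ArithmeticFunction.sigma_apply, zero_add, h2]
    have := Nat.pow_le_pow_right (show 0 < 2 by norm_num) hk
    simp at this ⊢
    omega
  · calc (n + 1 + 2) * ArithmeticFunction.sigma k (n + 1 + 2)
        ≤ (n + 3) * (n + 3) ^ (k + 1) :=
          Nat.mul_le_mul_left _ (ArithmeticFunction.sigma_le_pow_succ k (n + 3))
      _ = (n + 3) ^ (k + 2) := by ring
      _ ≤ (n + 3) ^ 7 := Nat.pow_le_pow_right (by omega) (by omega)
      _ ≤ 66 ^ (n + 2) := pow_seven_le n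

/-- In the standard fundamental domain `|q| ≤ exp (-π √3) < 1 / 200`. -/
theorem norm_qParam_le_of_im {τ : ℍ} (h : 3 ≤ 4 * τ.im ^ 2) : ‖qParam 1 (τ : ℂ)‖ ≤ 1 / 200 := by
  rw [Function.Periodic.norm_qParam]
  have hs : (0.865 : ℝ) ≤ τ.im := by
    by_contra! hlt
    nlinarith [τ.im_pos]
  have hpi : (3.14 : ℝ) ≤ Real.pi := Real.pi_gt_d2.le
  have h1 : (5.4 : ℝ) ≤ 2 * Real.pi * τ.im := by nlinarith
  have h2 : (200 : ℝ) ≤ Real.exp 5.4 := by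
    have h3 : (200 : ℝ) ^ 5 ≤ Real.exp 5.4 ^ 5 := by
      rw [← Real.exp_nat_mul]
      have h4 : ((5 : ℕ) : ℝ) * 5.4 = ((27 : ℕ) : ℝ) * 1 := by norm_num
      rw [h4, Real.exp_nat_mul]
      calc (200 : ℝ) ^ 5 ≤ 2.7182 ^ 27 := by norm_num
        _ ≤ Real.exp 1 ^ 27 := by
          gcongr
          exact (by norm_num : (2.7182 : ℝ) ≤ 2.7182818283).trans Real.exp_one_gt_d9.le
    exact le_of_pow_le_pow_left₀ (by norm_num) (Real.exp_pos _).le h3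
  have h5 : -2 * Real.pi * (τ : ℂ).im / 1 = -(2 * Real.pi * τ.im) := by
    rw [UpperHalfPlane.coe_im]; ring
  rw [h5, Real.exp_neg, ← one_div]
  exact one_div_le_one_div_of_le (by norm_num) (h2.trans (Real.exp_le_exp.mpr h1))

/-- The Eisenstein series of weights 4 and 6 have at most one zero modulo translations in the
region `Im τ ≥ √3 / 2`, since they are injective functions of the nome there. -/
theorem eq_of_eisenstein_eq_zero {k : ℕ} (hk : 3 ≤ k) (hk2 : Even k) (hk6 : k ≤ 6) {τ τ' : ℍ}
    (h : 3 ≤ 4 * τ.im ^ 2) (h' : 3 ≤ 4 * τ'.im ^ 2) (h0 : ModularForm.E hk τ = 0)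
    (h0' : ModularForm.E hk τ' = 0) : qParam 1 (τ : ℂ) = qParam 1 (τ' : ℂ) := by
  have key : ∀ z : ℍ, ∃ v : ℂ, HasSum
      (fun n : ℕ => (ArithmeticFunction.sigma (k - 1) n : ℂ) * qParam 1 (z : ℂ) ^ n) v ∧
      ModularForm.E hk z = 1 - (2 * k / bernoulli k) * v := by
    intro z
    have hs := EisensteinSeries.summable_sigma_mul_cexp_pow (k := k) (by omega) z
    simp only [qParam_one_eq]
    refine ⟨_, hs.hasSum, ?_⟩
    rw [EisensteinSeries.q_expansion_bernoulli hk hk2, ← tsum_zero_pnat_eq_tsum_nat hs]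
    simp
  obtain ⟨v, h1, e1⟩ := key τ
  obtain ⟨v', h2, e2⟩ := key τ'
  rw [h0] at e1
  rw [h0'] at e2
  have hv : v = v' := by
    have hb : (2 * k / bernoulli k : ℂ) ≠ 0 := by
      intro hb
      rw [hb] at e1
      simp at e1
    apply mul_left_cancel₀ hb
    linear_combination e1 - e2
  rw [← hv] at h2
  refine eq_of_hasSum_eq ?_ (fun n => ?_) (norm_qParam_le_of_im h) (norm_qParam_le_of_im h') h1 h2
  · simp
  · have := mul_sigma_le (k := k - 1) (by omega) n
    rw [Complex.norm_natCast]
    exact_mod_cast this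

theorem exists_eq_T_zpow_smul {τ τ' : ℍ} (h : qParam 1 (τ : ℂ) = qParam 1 (τ' : ℂ)) :
    ∃ n : ℤ, τ = ModularGroup.T ^ n • τ' := by
  rw [qParam_one_eq, qParam_one_eq, Complex.exp_eq_exp_iff_exists_int] at h
  obtain ⟨n, hn⟩ := h
  refine ⟨n, ?_⟩
  rw [modular_T_zpow_smul]
  ext
  rw [coe_vadd]
  apply mul_left_cancel₀ Complex.two_pi_I_ne_zero
  rw [hn]; push_cast; ring

theorem coe_omegaPoint_sq : (omegaPoint : ℂ) ^ 2 = -1 - omegaPoint := by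
  have h3 : Real.sqrt 3 * Real.sqrt 3 = 3 := Real.mul_self_sqrt (by norm_num)
  have h : (omegaPoint : ℂ) = ⟨-1 / 2, Real.sqrt 3 / 2⟩ := rfl
  rw [h]
  apply Complex.ext
  · simp [pow_two]; nlinarith
  · simp [pow_two]; ring

/-- The point `ω = exp (2πi/3)` is fixed by `S T`, whose factor of automorphy `(ω + 1) ^ 4` is not
one. -/
theorem E4_omegaPoint : E4 omegaPoint = 0 := by
  have hω := coe_omegaPoint_sq
  have h1 : (omegaPoint : ℂ) + 1 ≠ 0 := by
    intro h0
    have := congrArg Complex.im h0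
    simp [omegaPoint] at this
  have hfix : (ModularGroup.S * ModularGroup.T) • omegaPoint = omegaPoint := by
    rw [mul_smul, modular_T_smul, modular_S_smul]
    ext
    rw [coe_mk, coe_vadd, inv_eq_iff_eq_inv, ← one_div, eq_div_iff omegaPoint.ne_zero]
    push_cast
    linear_combination -hω
  have h := E4_smul (ModularGroup.S * ModularGroup.T) omegaPoint
  have hd : denom ((ModularGroup.S * ModularGroup.T : SL(2, ℤ)) : GL (Fin 2) ℝ) omegaPoint
      = omegaPoint + 1 := by
    have e1 : (ModularGroup.S * ModularGroup.T) 1 0 = 1 := by decide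
    have e2 : (ModularGroup.S * ModularGroup.T) 1 1 = 1 := by decide
    rw [ModularGroup.denom_apply, e1, e2]; simp
  have h4 : ((omegaPoint : ℂ) + 1) ^ 4 = -1 - omegaPoint := by
    linear_combination (omegaPoint ^ 2 + 3 * omegaPoint + 2 : ℂ) * hω
  rw [hfix, hd, h4] at h
  have h5 : (2 + (omegaPoint : ℂ)) ≠ 0 := by
    intro h0
    have := congrArg Complex.im h0
    simp [omegaPoint] at this
  exact (mul_eq_zero.mp (by linear_combination h : (2 + (omegaPoint : ℂ)) * E4 omegaPoint = 0)
    ).resolve_left h5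

theorem E6_I : E6 UpperHalfPlane.I = 0 := by
  have hfix : ModularGroup.S • UpperHalfPlane.I = UpperHalfPlane.I := by
    rw [modular_S_smul]
    ext
    simp
  have h := E6_smul ModularGroup.S UpperHalfPlane.I
  have h6 : Complex.I ^ 6 = -1 := by
    rw [show 6 = 2 * 3 by norm_num, pow_mul, Complex.I_sq]; norm_num
  rw [hfix, ModularGroup.denom_S, UpperHalfPlane.coe_I, h6] at h
  linear_combination h / 2

theorem isElliptic_of_E4_eq_zero {τ : ℍ} (h : E4 τ = 0) : IsElliptic τ := by
  obtain ⟨γ, hγ⟩ := ModularGroup.exists_smul_mem_fd τ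
  have h1 : E4 (γ • τ) = 0 := by rw [E4_smul, h, mul_zero]
  have h2 := eq_of_eisenstein_eq_zero (k := 4) (by norm_num) ⟨2, rfl⟩ (by norm_num)
    (ModularGroup.three_le_four_mul_im_sq_of_mem_fd hγ) (τ' := omegaPoint) ?_ h1 E4_omegaPoint
  · obtain ⟨n, hn⟩ := exists_eq_T_zpow_smul h2
    exact ⟨γ⁻¹ * ModularGroup.T ^ n, Or.inr (by rw [mul_smul, ← hn, inv_smul_smul])⟩
  · have : omegaPoint.im = Real.sqrt 3 / 2 := rfl
    rw [this, div_pow, Real.sq_sqrt (by norm_num)]; norm_num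

theorem isElliptic_of_E6_eq_zero {τ : ℍ} (h : E6 τ = 0) : IsElliptic τ := by
  obtain ⟨γ, hγ⟩ := ModularGroup.exists_smul_mem_fd τ
  have h1 : E6 (γ • τ) = 0 := by rw [E6_smul, h, mul_zero]
  have h2 := eq_of_eisenstein_eq_zero (k := 6) (by norm_num) ⟨3, rfl⟩ (by norm_num)
    (ModularGroup.three_le_four_mul_im_sq_of_mem_fd hγ) (τ' := UpperHalfPlane.I) ?_ h1 E6_I
  · obtain ⟨n, hn⟩ := exists_eq_T_zpow_smul h2
    exact ⟨γ⁻¹ * ModularGroup.T ^ n, Or.inl (by rw [mul_smul, ← hn, inv_smul_smul])⟩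
  · norm_num

theorem curlyE_ne_zero_of_not_isElliptic {τ : ℍ} (h : ¬ IsElliptic τ) : curlyE τ ≠ 0 := by
  rw [Ne, curlyE_eq_zero_iff]
  rintro (h1 | h1)
  · exact h (isElliptic_of_E4_eq_zero h1)
  · exact h (isElliptic_of_E6_eq_zero h1)

/-! ### The multiplier system of `E₁₄ / Δ^(7/6)` -/

theorem discPow_S (τ : ℍ) : discPow (ModularGroup.S • τ) = -(τ : ℂ) ^ 14 * discPow τ := by
  have h := ModularForm.eta_comp_eq_csqrt_I_inv τ.im_pos
  simp only [Function.comp_apply, Pi.smul_apply, Pi.mul_apply, smul_eq_mul] at h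
  have hpow : ∀ z : ℂ, z ≠ 0 → Complex.sqrt z ^ 28 = z ^ 14 := by
    intro z hz
    rw [Complex.sqrt, Complex.cpow_def_of_ne_zero hz, ← Complex.exp_nat_mul]
    rw [show ((28 : ℕ) : ℂ) * (Complex.log z * 2⁻¹) = ((14 : ℕ) : ℂ) * Complex.log z by
      push_cast; ring, Complex.exp_nat_mul, Complex.exp_log hz]
  have hI : Complex.I ^ 14 = -1 := by
    rw [show 14 = 2 * 7 by norm_num, pow_mul, Complex.I_sq]; norm_num
  rw [discPow, discPow, modular_S_smul, coe_mk, inv_neg, ← one_div, ← neg_div, h, mul_pow, mul_pow,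
    inv_pow, hpow _ Complex.I_ne_zero, hpow _ τ.ne_zero, hI]
  ring

theorem discPow_T (τ : ℍ) : discPow (ModularGroup.T • τ)
    = Complex.exp (2 * Real.pi * Complex.I * (7 / 6)) * discPow τ := by
  obtain ⟨F, hF, -, -⟩ := exists_hasQForm_discPow
  rw [hF.eq, hF.eq, modular_T_smul]
  have : qParam 1 ((((1 : ℝ) +ᵥ τ : ℍ)) : ℂ) = qParam 1 (τ : ℂ) := by
    rw [qParam_one_eq, qParam_one_eq, coe_vadd, mul_add, Complex.exp_add]
    simp
  rw [this, ← mul_assoc, ← Complex.exp_add]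
  congr 2
  rw [coe_vadd]; push_cast; ring

/-- `E₁₄ / Δ^(7/6)` is invariant up to the character `ϰ`, as one checks on the generators `S` and
`T`. -/
theorem dualFactor_smul (γ : SL(2, ℤ)) (τ : ℍ) :
    dualFactor (γ • τ) = (kappa γ : ℂ) * dualFactor τ := by
  have hγ : γ ∈ Subgroup.closure {ModularGroup.S, ModularGroup.T} := by
    simp [SpecialLinearGroup.SL2Z_generators]
  induction hγ using Subgroup.closure_induction generalizing τ with
  | mem x hx =>
    rcases hx with rfl | rfl
    · rw [kappa_S, dualFactor, dualFactor, E14_smul, discPow_S, ModularGroup.denom_S]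
      have := τ.ne_zero
      have := discPow_ne_zero τ
      field_simp
    · rw [kappa_T, dualFactor, dualFactor, E14_smul, discPow_T]
      have h1 : denom (ModularGroup.T : GL (Fin 2) ℝ) τ = 1 := by
        rw [ModularGroup.denom_apply]; simp [ModularGroup.T]
      have h2 : Complex.exp (2 * Real.pi * Complex.I * (5 / 6))
          * Complex.exp (2 * Real.pi * Complex.I * (7 / 6)) = 1 := by
        rw [← Complex.exp_add]
        have := Complex.exp_int_mul_two_pi_mul_I 2
        rw [← this]; congr 1; push_cast; ring
      have h3 := Complex.exp_ne_zero (2 * Real.pi * Complex.I * (7 / 6))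
      have h4 := discPow_ne_zero τ
      rw [h1, one_pow, one_mul, div_eq_iff (mul_ne_zero h3 h4)]
      rw [mul_assoc, div_mul_eq_mul_div, mul_div_assoc', eq_div_iff h4]
      linear_combination (-E14 τ * discPow τ) * h2
  | one => simp
  | mul x y _ _ hx hy => rw [mul_smul, hx, hy, map_mul, Units.val_mul, mul_assoc]
  | inv x _ hx =>
    have h := hx (x⁻¹ • τ)
    rw [smul_inv_smul] at h
    rw [h, map_inv, ← mul_assoc, ← Units.val_mul, inv_mul_cancel, Units.val_one, one_mul]

theorem discPow_smul (γ : SL(2, ℤ)) (τ : ℍ) :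
    (kappa γ : ℂ) * discPow (γ • τ) = denom γ τ ^ 14 * discPow τ := by
  have hd : MDiff (fun z : ℍ => denom (γ : GL (Fin 2) ℝ) z ^ 14) :=
    mdifferentiable_pow (mdifferentiable_denom _) 14
  refine eq_of_mul_eq_mul mdifferentiable_dualFactor
    ((mdifferentiable_comp_smul mdifferentiable_discPow γ).const_smul (kappa γ : ℂ))
    (hd.mul mdifferentiable_discPow) exists_dualFactor_ne_zero (fun z => ?_) τ
  have h1 := dualFactor_mul_discPow (γ • z)
  have h2 := dualFactor_mul_discPow z
  rw [dualFactor_smul, E14_smul] at h1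
  simp only [Pi.mul_apply, Pi.smul_apply, smul_eq_mul]
  linear_combination h1 - denom (γ : GL (Fin 2) ℝ) z ^ 14 * h2

/-! ### Local analysis -/

/-- `f` is `(z - p) ^ n` times an analytic function near `p`. -/
def VanishesTo (n : ℕ) (p : ℂ) (f : ℂ → ℂ) : Prop :=
  ∃ g, AnalyticAt ℂ g p ∧ f =ᶠ[𝓝 p] fun z => (z - p) ^ n * g z

namespace VanishesTo

variable {n : ℕ} {p : ℂ} {f g : ℂ → ℂ}

theorem zero (hf : AnalyticAt ℂ f p) : VanishesTo 0 p f :=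
  ⟨f, hf, .of_forall fun z => by simp⟩

theorem congr (hf : VanishesTo n p f) (h : g =ᶠ[𝓝 p] f) : VanishesTo n p g := by
  obtain ⟨u, hu, e⟩ := hf
  exact ⟨u, hu, h.trans e⟩

theorem sub (hf : VanishesTo n p f) (hg : VanishesTo n p g) :
    VanishesTo n p (fun z => f z - g z) := by
  obtain ⟨u, hu, e⟩ := hf
  obtain ⟨v, hv, e'⟩ := hg
  refine ⟨fun z => u z - v z, hu.sub hv, ?_⟩
  filter_upwards [e, e'] with z h h'
  rw [h, h']; ring

theorem mul_left (hf : VanishesTo n p f) (hg : AnalyticAt ℂ g p) :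
    VanishesTo n p (fun z => g z * f z) := by
  obtain ⟨u, hu, e⟩ := hf
  refine ⟨fun z => g z * u z, hg.mul hu, ?_⟩
  filter_upwards [e] with z h
  rw [h]; ring

theorem const_mul (c : ℂ) (hf : VanishesTo n p f) : VanishesTo n p (fun z => c * f z) :=
  hf.mul_left analyticAt_const

theorem sum {ι : Type*} (s : Finset ι) {f : ι → ℂ → ℂ} (hf : ∀ i, VanishesTo n p (f i)) :
    VanishesTo n p (fun z => ∑ i ∈ s, f i z) := by
  choose u hu e using hf
  refine ⟨fun z => ∑ i ∈ s, u i z, Finset.analyticAt_fun_sum s fun i _ => hu i, ?_⟩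
  filter_upwards [(Filter.eventually_all_finset s).mpr fun i _ => e i] with z h
  rw [Finset.mul_sum]
  exact Finset.sum_congr rfl fun i hi => h i hi

theorem mono {m : ℕ} (hf : VanishesTo n p f) (h : m ≤ n) : VanishesTo m p f := by
  obtain ⟨u, hu, e⟩ := hf
  refine ⟨fun z => (z - p) ^ (n - m) * u z, ((analyticAt_id.sub analyticAt_const).pow _).mul hu, ?_⟩
  filter_upwards [e] with z hz
  rw [hz, ← mul_assoc, ← pow_add, Nat.add_sub_cancel' h]

end VanishesTo

/-- The cofactor of a simple zero, with its value at the zero. -/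
theorem vanishesTo_one {p : ℂ} {f : ℂ → ℂ} (hf : AnalyticAt ℂ f p) (h0 : f p = 0) :
    ∃ g, AnalyticAt ℂ g p ∧ g p = deriv f p ∧ f =ᶠ[𝓝 p] fun z => (z - p) * g z := by
  refine ⟨dslope f p, ?_, dslope_same f p, .of_forall fun z => ?_⟩
  · obtain ⟨P, hP⟩ := hf
    exact ⟨_, hP.has_fpower_series_dslope_fslope⟩
  · have := sub_smul_dslope f p z
    rw [h0, sub_zero, smul_eq_mul] at this
    exact this.symm

/-- If the operator `e · d/dz` has a simple zero with `e'(p) = κ`, it acts on functions vanishing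
to order `n` at `p` as multiplication by `n κ`, up to functions vanishing to order `n + 1`. -/
theorem VanishesTo.deriv_sub {n : ℕ} {p : ℂ} {e f : ℂ → ℂ} (he : AnalyticAt ℂ e p)
    (he0 : e p = 0) (hf : VanishesTo n p f) :
    VanishesTo (n + 1) p (fun z => e z * deriv f z - n * deriv e p * f z) := by
  obtain ⟨e1, he1, he1p, hee⟩ := vanishesTo_one he he0
  obtain ⟨e2, he2, -, hee2⟩ := vanishesTo_one (he1.sub (analyticAt_const (v := e1 p)))
    (by simp)
  obtain ⟨g, hg, hfg⟩ := hf
  refine ⟨fun z => n * e2 z * g z + e1 z * deriv g z,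
    ((analyticAt_const.mul he2).mul hg).add (he1.mul hg.deriv), ?_⟩
  have hd : deriv f =ᶠ[𝓝 p] deriv fun z => (z - p) ^ n * g z := hfg.deriv
  filter_upwards [hee, hee2, hfg, hd, hg.eventually_analyticAt] with z h1 h2 h3 h4 h5
  have h6 : HasDerivAt (fun z => (z - p) ^ n * g z)
      (n * (z - p) ^ (n - 1) * 1 * g z + (z - p) ^ n * deriv g z) z :=
    (((hasDerivAt_id z).sub_const p).pow n).mul h5.differentiableAt.hasDerivAt
  rw [h4, h6.deriv, h3, h1]
  simp only [Pi.sub_apply] at h2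
  rw [← he1p]
  rcases n with _ | n
  · simp; ring
  · rw [add_tsub_cancel_right]
    push_cast
    linear_combination ((n + 1 : ℂ) * (z - p) ^ (n + 1) * g z) * h2

/-- A step in the filtration by the order of vanishing: if `e M' = M (κ B + R)`, where `R`
vanishes to order `N > n` at `p`, and `M C` vanishes to order `n`, then `M (B - n) C` vanishes to
order `n + 1`. -/
theorem vanishesTo_mul_sub {ι : Type*} [Fintype ι] [DecidableEq ι] {p : ℂ} {e : ℂ → ℂ}
    (he : AnalyticAt ℂ e p) (he0 : e p = 0) (hκ : deriv e p ≠ 0)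
    {M R : ℂ → Matrix ι ι ℂ} {B C : Matrix ι ι ℂ} {n N : ℕ} (hnN : n < N)
    (hM : ∀ i j, AnalyticAt ℂ (fun z => M z i j) p)
    (hR : ∀ i j, VanishesTo N p (fun z => R z i j))
    (hode : ∀ᶠ z in 𝓝 p, ∀ i j, e z * deriv (fun w => M w i j) z
      = (M z * (deriv e p • B + R z)) i j)
    (hC : ∀ i j, VanishesTo n p (fun z => (M z * C) i j)) (i j : ι) :
    VanishesTo (n + 1) p (fun z => (M z * ((B - (n : ℂ) • (1 : Matrix ι ι ℂ)) * C)) i j) := by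
  have h1 := (hC i j).deriv_sub he he0
  have h2 : VanishesTo (n + 1) p (fun z => (M z * (R z * C)) i j) := by
    have : (fun z => (M z * (R z * C)) i j)
        = fun z => ∑ k, M z i k * ∑ l, C l j * R z k l := by
      ext z
      simp only [Matrix.mul_apply]
      exact Finset.sum_congr rfl fun k _ => by
        congr 1; exact Finset.sum_congr rfl fun l _ => mul_comm _ _
    rw [this]
    exact VanishesTo.sum _ fun k => VanishesTo.mul_left
      (VanishesTo.sum _ fun l => ((hR k l).mono hnN).const_mul _) (hM i k)
  refine ((h1.sub h2).const_mul (deriv e p)⁻¹).congr ?_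
  filter_upwards [hode, Filter.eventually_all.mpr fun k => (hM i k).eventually_analyticAt]
    with z h3 h4
  have h5 : deriv (fun w => (M w * C) i j) z = ∑ k, deriv (fun w => M w i k) z * C k j := by
    simp only [Matrix.mul_apply]
    rw [deriv_fun_sum fun k _ => (h4 k).differentiableAt.mul_const _]
    exact Finset.sum_congr rfl fun k _ => deriv_mul_const (h4 k).differentiableAt _
  have h6 : e z * deriv (fun w => (M w * C) i j) z
      = (M z * (deriv e p • B + R z) * C) i j := by
    rw [h5, Matrix.mul_apply, Finset.mul_sum]
    exact Finset.sum_congr rfl fun k _ => by rw [← h3 i k, mul_assoc]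
  rw [h6, eq_inv_mul_iff_mul_eq₀ hκ]
  have h7 : M z * (deriv e p • B + R z) * C
      = deriv e p • (M z * (B * C)) + M z * (R z * C) := by
    rw [mul_add, add_mul, Matrix.mul_smul, Matrix.smul_mul, Matrix.mul_assoc, Matrix.mul_assoc]
  have h8 : M z * ((B - (n : ℂ) • (1 : Matrix ι ι ℂ)) * C)
      = M z * (B * C) - (n : ℂ) • (M z * C) := by
    rw [sub_mul, mul_sub, Matrix.smul_mul, one_mul, Matrix.mul_smul]
  rw [h7, h8]
  simp only [Matrix.add_apply, Matrix.sub_apply, Matrix.smul_apply, smul_eq_mul]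
  ring

/-- A meromorphic solution `y = (z - p) ^ (-n) u` of the system `e y' = y D` with a regular
singularity at `p` is holomorphic at `p` if `D(p)` has no eigenvalue `-m e'(p)` with `m > 0`:
the leading coefficient at a pole of order `m` would be an eigenvector. -/
theorem exists_eq_pow_mul_of_regularSingular {ι : Type*} [Fintype ι] {p : ℂ} {e : ℂ → ℂ}
    (he : AnalyticAt ℂ e p) (he0 : e p = 0) {D : ℂ → ι → ι → ℂ}
    (hD : ∀ i j, ContinuousAt (fun z => D z i j) p)
    (hspec : ∀ (m : ℕ) (u : ι → ℂ),
      (∀ j, ∑ i, u i * D p i j = -((m + 1 : ℕ) * deriv e p) * u j) → u = 0) (n : ℕ) :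
    ∀ u : ι → ℂ → ℂ, (∀ i, AnalyticAt ℂ (u i) p) →
      (∀ᶠ z in 𝓝[≠] p, ∀ j, e z * ((z - p) * deriv (u j) z - n * u j z)
        = (z - p) * ∑ i, u i z * D z i j) →
      ∀ i, VanishesTo n p (u i) := by
  obtain ⟨e1, he1, he1p, hee⟩ := vanishesTo_one he he0
  induction n with
  | zero => exact fun u hu _ i => VanishesTo.zero (hu i)
  | succ n ih =>
    intro u hu hode
    -- the values `u i p` are the coefficients of the pole of order `n + 1`
    have hu0 : ∀ i, u i p = 0 := by
      refine congrFun (hspec n (fun i => u i p) fun j => ?_)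
      have hL : ContinuousAt (fun z => e1 z * ((z - p) * deriv (u j) z - (n + 1 : ℕ) * u j z)) p :=
        he1.continuousAt.mul (((continuousAt_id.sub continuousAt_const).mul
          (hu j).deriv.continuousAt).sub (continuousAt_const.mul (hu j).continuousAt))
      have hR : ContinuousAt (fun z => ∑ i, u i z * D z i j) p :=
        tendsto_finsetSum _ fun i _ => (hu i).continuousAt.mul (hD i j)
      have hLR := (hL.eventuallyEq_nhds_iff_eventuallyEq_nhdsNE hR).mp ?_
      · have := hLR.self_of_nhds
        simp only [sub_self, zero_mul, zero_sub, he1p] at this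
        rw [← this]; ring
      · filter_upwards [hode, self_mem_nhdsWithin, mem_nhdsWithin_of_mem_nhds hee] with z h1 h2 h3
        have h4 := h1 j
        rw [h3, mul_assoc] at h4
        exact mul_left_cancel₀ (sub_ne_zero.mpr h2) h4
    choose v hv _ huv using fun i => vanishesTo_one (hu i) (hu0 i)
    have hd : ∀ j, deriv (u j) =ᶠ[𝓝 p] deriv fun z => (z - p) * v j z := fun j => (huv j).deriv
    have hvv := ih v hv ?_
    · intro i
      obtain ⟨w, hw, hvw⟩ := hvv i
      refine ⟨w, hw, ?_⟩
      filter_upwards [huv i, hvw] with z h1 h2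
      rw [h1, h2]; ring
    · filter_upwards [hode, self_mem_nhdsWithin,
        mem_nhdsWithin_of_mem_nhds (Filter.eventually_all.mpr huv),
        mem_nhdsWithin_of_mem_nhds (Filter.eventually_all.mpr hd),
        mem_nhdsWithin_of_mem_nhds
          (Filter.eventually_all.mpr fun i => (hv i).eventually_analyticAt)] with z h1 h2 h3 h4 h5 j
      have h6 : HasDerivAt (fun z => (z - p) * v j z) (1 * v j z + (z - p) * deriv (v j) z) z :=
        ((hasDerivAt_id z).sub_const p).mul (h5 j).differentiableAt.hasDerivAt
      have h7 := h1 j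
      rw [h4 j, h6.deriv, h3 j] at h7
      have h8 : ∑ i, u i z * D z i j = (z - p) * ∑ i, v i z * D z i j := by
        rw [Finset.mul_sum]
        exact Finset.sum_congr rfl fun i _ => by rw [h3 i]; ring
      rw [h8] at h7
      apply mul_left_cancel₀ (sub_ne_zero.mpr h2)
      rw [← h7]; push_cast; ring

/-! ### Holomorphic functions on the upper half-plane in the coordinate of `ℂ` -/

theorem analyticAt_comp_ofComplex {f : ℍ → ℂ} (hf : MDiff f) (τ : ℍ) :
    AnalyticAt ℂ (f ∘ ofComplex) τ :=
  (UpperHalfPlane.mdifferentiable_iff.mp hf).analyticAt (isOpen_upperHalfPlaneSet.mem_nhds τ.im_pos)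

theorem eventually_im_pos (τ : ℍ) : ∀ᶠ z in 𝓝 (τ : ℂ), 0 < z.im :=
  isOpen_upperHalfPlaneSet.mem_nhds τ.im_pos

/-- The coefficient `ℰ / 2πi` of `∇ = (ℰ / 2πi) d/dτ`, as a function of a complex variable. -/
def nablaCoeff (z : ℂ) : ℂ := (2 * Real.pi * Complex.I)⁻¹ * curlyE (ofComplex z)

theorem nabla_ofComplex (f : ℍ → ℂ) {z : ℂ} (hz : 0 < z.im) :
    nabla f (ofComplex z) = nablaCoeff z * deriv (f ∘ ofComplex) z := by
  rw [nabla, Derivative.normalizedDerivOfComplex, nablaCoeff]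
  rw [show ((ofComplex z : ℍ) : ℂ) = z by rw [ofComplex_apply_of_im_pos hz]]
  ring

theorem analyticAt_nablaCoeff (τ : ℍ) : AnalyticAt ℂ nablaCoeff τ :=
  analyticAt_const.mul (analyticAt_comp_ofComplex mdifferentiable_curlyE τ)

theorem deriv_nablaCoeff (τ : ℍ) :
    deriv nablaCoeff τ = Derivative.normalizedDerivOfComplex curlyE τ :=
  deriv_const_mul _ (analyticAt_comp_ofComplex mdifferentiable_curlyE τ).differentiableAt

theorem nablaCoeff_coe (τ : ℍ) :
    nablaCoeff τ = (2 * Real.pi * Complex.I)⁻¹ * curlyE τ := by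
  rw [nablaCoeff, ofComplex_apply]

theorem eventually_ne_zero_of_mdifferentiable {f : ℍ → ℂ} (hf : MDiff f) (hne : ∃ τ, f τ ≠ 0)
    (τ : ℍ) : ∀ᶠ z in 𝓝[≠] (τ : ℂ), (f ∘ ofComplex) z ≠ 0 := by
  rcases (analyticAt_comp_ofComplex hf τ).eventually_eq_zero_or_eventually_ne_zero with h | h
  · exfalso
    obtain ⟨w, hw⟩ := hne
    have h1 := ((UpperHalfPlane.mdifferentiable_iff.mp hf).analyticOnNhd
      isOpen_upperHalfPlaneSet).eqOn_zero_of_preconnected_of_eventuallyEq_zero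
      (convex_halfSpace_im_gt 0).isPreconnected τ.im_pos h w.im_pos
    rw [Function.comp_apply, ofComplex_apply] at h1
    exact hw h1
  · exact h

theorem eq_zero_of_eventually_eq_zero {f : ℍ → ℂ} (hf : MDiff f) {τ : ℍ}
    (h : ∀ᶠ z in 𝓝 (τ : ℂ), (f ∘ ofComplex) z = 0) (w : ℍ) : f w = 0 := by
  have h1 := ((UpperHalfPlane.mdifferentiable_iff.mp hf).analyticOnNhd
    isOpen_upperHalfPlaneSet).eqOn_zero_of_preconnected_of_eventuallyEq_zero
    (convex_halfSpace_im_gt 0).isPreconnected τ.im_pos h w.im_pos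
  rwa [Function.comp_apply, ofComplex_apply] at h1

/-- A holomorphic function that is locally divisible by `g` is divisible by `g`. -/
theorem exists_mdifferentiable_eq_mul {f g : ℍ → ℂ} (hg : MDiff g) (hne : ∃ τ, g τ ≠ 0)
    (h : ∀ τ : ℍ, ∃ u : ℂ → ℂ, AnalyticAt ℂ u τ ∧
      ∀ᶠ z in 𝓝 (τ : ℂ), (f ∘ ofComplex) z = (g ∘ ofComplex) z * u z) :
    ∃ k : ℍ → ℂ, MDiff k ∧ ∀ τ, f τ = g τ * k τ := by
  choose u hu hfu using h
  refine ⟨fun τ => u τ τ, fun τ => mdifferentiableAt_iff.mpr ?_, fun τ => ?_⟩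
  · refine (hu τ).differentiableAt.congr_of_eventuallyEq ?_
    filter_upwards [(hfu τ).eventually_nhds, (hu τ).eventually_analyticAt, eventually_im_pos τ]
      with z h1 h2 h3
    have hz : ((ofComplex z : ℍ) : ℂ) = z := by rw [ofComplex_apply_of_im_pos h3]
    simp only [Function.comp_apply]
    have h4 := hfu (ofComplex z)
    have h5 := eventually_ne_zero_of_mdifferentiable hg hne (ofComplex z)
    have h6 := (hu (ofComplex z)).continuousAt
    rw [hz] at h4 h5 h6 ⊢
    refine ((h6.eventuallyEq_nhds_iff_eventuallyEq_nhdsNE h2.continuousAt).mp ?_).self_of_nhds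
    filter_upwards [mem_nhdsWithin_of_mem_nhds h1, mem_nhdsWithin_of_mem_nhds h4, h5]
      with w h7 h8 h9
    exact mul_left_cancel₀ h9 (h8.symm.trans h7)
  · have := (hfu τ).self_of_nhds
    simpa using this

/-! ### Uniqueness of solutions -/

/-- A solution of `∇ y = y M` that vanishes at a point where `ℰ ≠ 0` vanishes identically. -/
theorem eq_zero_of_nabla_eq {ι : Type*} [Fintype ι] {y : ι → ℍ → ℂ} (hy : ∀ i, MDiff (y i))
    {M : ℍ → ι → ι → ℂ} (hM : ∀ i j, MDiff (fun τ => M τ i j))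
    (hode : ∀ τ j, nabla (y j) τ = ∑ i, y i τ * M τ i j) {p : ℍ} (hp : curlyE p ≠ 0)
    (h0 : ∀ i, y i p = 0) (i : ι) (τ : ℍ) : y i τ = 0 := by
  have hY := fun i => analyticAt_comp_ofComplex (hy i) p
  have hE : nablaCoeff p ≠ 0 := by
    rw [nablaCoeff_coe]
    exact mul_ne_zero (inv_ne_zero Complex.two_pi_I_ne_zero) hp
  have hY0 : ∀ i, (y i ∘ ofComplex) p = 0 := fun i => by simpa using h0 i
  -- as `ℰ p ≠ 0`, the equation expresses `y'` through `y`: it vanishes to the same order as `y`, so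
  -- that the order of vanishing of `y` exceeds every `n`
  have key : ∀ n : ℕ, ∀ i, (n : ℕ∞) ≤ analyticOrderAt (y i ∘ ofComplex) p := by
    intro n
    induction n with
    | zero => intro i; simp
    | succ n ih =>
      intro j
      rw [Nat.cast_add, Nat.cast_one, ← analyticOrderAt_deriv_ge_iff (hY j) (hY0 j),
        natCast_le_analyticOrderAt (hY j).deriv]
      choose g hg hyg using fun i => (natCast_le_analyticOrderAt (hY i)).mp (ih i)
      refine ⟨fun z => (∑ i, g i z * M (ofComplex z) i j) / nablaCoeff z,
        (Finset.analyticAt_fun_sum _ fun i _ => (hg i).mul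
          (analyticAt_comp_ofComplex (hM i j) p)).div (analyticAt_nablaCoeff p) hE, ?_⟩
      filter_upwards [Filter.eventually_all.mpr hyg, eventually_im_pos p,
        (analyticAt_nablaCoeff p).continuousAt.eventually_ne hE] with z h1 h2 h3
      have h4 := hode (ofComplex z) j
      rw [nabla_ofComplex _ h2] at h4
      rw [smul_eq_mul, mul_div_assoc', eq_div_iff h3, mul_comm, h4, Finset.mul_sum]
      refine Finset.sum_congr rfl fun i _ => ?_
      have := h1 i
      rw [Function.comp_apply, smul_eq_mul] at this
      rw [this]; ring
  have htop : analyticOrderAt (y i ∘ ofComplex) p = ⊤ :=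
    ENat.eq_top_iff_forall_ge.mpr fun n => key n i
  exact eq_zero_of_eventually_eq_zero (hy i) (analyticOrderAt_eq_top.mp htop) τ

variable {d : ℕ}

/-! ### The duality for pairs of matrices -/

theorem dualPair_involutive : Function.Involutive (dualPair (d := d)) := by
  rintro ⟨Λ, X⟩
  simp only [dualPair, Prod.mk.injEq]
  refine ⟨funext fun ξ => by simp [dualExp], ?_⟩
  simp [dualChar, Matrix.transpose_sub]

theorem transpose_expMat (Λ : Fin d → ℚ) : (expMat Λ).transpose = expMat Λ :=
  Matrix.diagonal_transpose _

theorem commPart_dual (Λ : Fin d → ℚ) (X : Matrix (Fin d) (Fin d) ℂ) :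
    commPart (dualExp Λ) (dualChar X)
      = (4 : ℂ) • (1 : Matrix (Fin d) (Fin d) ℂ) - (commPart Λ X).transpose := by
  simp only [commPart, expMat_dualExp, dualChar, Matrix.transpose_add, Matrix.transpose_sub,
    Matrix.transpose_mul, transpose_expMat, sub_mul, mul_sub, Matrix.smul_mul, Matrix.mul_smul,
    one_mul, mul_one]
  module

theorem matA_dual (Λ : Fin d → ℚ) (X : Matrix (Fin d) (Fin d) ℂ) :
    matA (dualExp Λ) (dualChar X) = 1 - (matA Λ X).transpose := by
  simp only [matA, commPart_dual, expMat_dualExp, Matrix.transpose_sub, Matrix.transpose_smul,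
    Matrix.transpose_one, transpose_expMat]
  module

theorem matB_dual (Λ : Fin d → ℚ) (X : Matrix (Fin d) (Fin d) ℂ) :
    matB (dualExp Λ) (dualChar X)
      = (2 : ℂ) • (1 : Matrix (Fin d) (Fin d) ℂ) - (matB Λ X).transpose := by
  simp only [matB, commPart_dual, expMat_dualExp, Matrix.transpose_sub, Matrix.transpose_smul,
    Matrix.transpose_one, Matrix.transpose_add, transpose_expMat]
  module

/-- The matrix `(J - 240)(Λ - 1) + 𝒳 + [Λ, 𝒳]` of the compatibility equation. -/
def connMat (Λ : Fin d → ℚ) (X : Matrix (Fin d) (Fin d) ℂ) (τ : ℍ) : Matrix (Fin d) (Fin d) ℂ :=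
  (J τ - 240) • (expMat Λ - 1) + commPart Λ X

/-- The connection matrix is `576 ℬ` at the zeros of `j` and `-864 𝒜` at those of `j - 1728`. -/
theorem connMat_eq (Λ : Fin d → ℚ) (X : Matrix (Fin d) (Fin d) ℂ) (τ : ℍ) :
    connMat Λ X τ = (-((jInv τ - 1728) / 3)) • matB Λ X - (jInv τ / 2) • matA Λ X := by
  rw [connMat, matA, matB, J_eq]
  module

/-- The dual connection matrix is the negative transpose, shifted by the logarithmic derivative
`∇s / s` of `s = E₁₄ / Δ^(7/6)` (see `nabla_dualFactor`). -/
theorem connMat_dual (Λ : Fin d → ℚ) (X : Matrix (Fin d) (Fin d) ℂ) (τ : ℍ) :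
    connMat (dualExp Λ) (dualChar X) τ
      = (-((7 * jInv τ - 6912) / 6)) • (1 : Matrix (Fin d) (Fin d) ℂ)
        - (connMat Λ X τ).transpose := by
  simp only [connMat, commPart_dual, expMat_dualExp, J_eq, Matrix.transpose_add,
    Matrix.transpose_smul, Matrix.transpose_sub, Matrix.transpose_one, transpose_expMat]
  module

theorem mdifferentiable_connMat (Λ : Fin d → ℚ) (X : Matrix (Fin d) (Fin d) ℂ) (i j : Fin d) :
    MDiff (fun τ => connMat Λ X τ i j) := by
  obtain ⟨F, hF, -⟩ := exists_hasQForm_J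
  rw [UpperHalfPlane.mdifferentiable_iff]
  have h := UpperHalfPlane.mdifferentiable_iff.mp hF.mdifferentiable
  exact ((h.sub_const 240).mul_const ((expMat Λ - 1) i j)).add_const (commPart Λ X i j)

/-! ### Diagonalizable matrices -/

namespace DiagonalizableWithin

variable {M : Matrix (Fin d) (Fin d) ℂ} {s : Set ℂ}

theorem smul_one_sub_transpose (h : DiagonalizableWithin M s) (c : ℂ) {t : Set ℂ}
    (hst : ∀ z ∈ s, c - z ∈ t) :
    DiagonalizableWithin (c • (1 : Matrix (Fin d) (Fin d) ℂ) - M.transpose) t := by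
  obtain ⟨P, v, hv, rfl⟩ := h
  have h1 : (P : Matrix (Fin d) (Fin d) ℂ) * ((P⁻¹ : GL (Fin d) ℂ) : Matrix _ _ ℂ) = 1 :=
    P.mul_inv
  have h2 : ((P⁻¹ : GL (Fin d) ℂ) : Matrix _ _ ℂ) * (P : Matrix (Fin d) (Fin d) ℂ) = 1 :=
    P.inv_mul
  refine ⟨⟨((P⁻¹ : GL (Fin d) ℂ) : Matrix _ _ ℂ).transpose,
    (P : Matrix (Fin d) (Fin d) ℂ).transpose, by rw [← Matrix.transpose_mul, h1]; simp,
    by rw [← Matrix.transpose_mul, h2]; simp⟩, fun ξ => c - v ξ, fun ξ => hst _ (hv ξ), ?_⟩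
  have h3 : Matrix.diagonal (fun ξ => c - v ξ)
      = c • (1 : Matrix (Fin d) (Fin d) ℂ) - Matrix.diagonal v := by
    rw [Matrix.smul_one_eq_diagonal, Matrix.diagonal_sub]
  rw [h3]
  simp only [Units.inv_mk, mul_sub, sub_mul, Matrix.mul_smul, Matrix.smul_mul, mul_one,
    Matrix.transpose_mul, Matrix.diagonal_transpose]
  rw [← Matrix.transpose_mul, h1, Matrix.transpose_one, mul_assoc]

theorem mono (h : DiagonalizableWithin M s) {t : Set ℂ} (hst : s ⊆ t) :
    DiagonalizableWithin M t := by
  obtain ⟨P, v, hv, e⟩ := h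
  exact ⟨P, v, fun ξ => hst (hv ξ), e⟩

/-- The eigenvalues of a diagonalizable matrix, with eigenvectors written as rows. -/
theorem mem_of_vecMul_eq (h : DiagonalizableWithin M s) {u : Fin d → ℂ} {c : ℂ}
    (hu : ∀ j, ∑ i, u i * M i j = c * u j) (hc : c ∉ s) : u = 0 := by
  obtain ⟨P, v, hv, rfl⟩ := h
  have h1 : (P : Matrix (Fin d) (Fin d) ℂ) * ((P⁻¹ : GL (Fin d) ℂ) : Matrix _ _ ℂ) = 1 :=
    P.mul_inv
  have h2 : ((P⁻¹ : GL (Fin d) ℂ) : Matrix _ _ ℂ) * (P : Matrix (Fin d) (Fin d) ℂ) = 1 :=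
    P.inv_mul
  have h3 : Matrix.vecMul u ((P : Matrix (Fin d) (Fin d) ℂ) * Matrix.diagonal v
      * ((P⁻¹ : GL (Fin d) ℂ) : Matrix _ _ ℂ)) = c • u := funext hu
  have h4 : Matrix.vecMul (Matrix.vecMul u (P : Matrix (Fin d) (Fin d) ℂ)) (Matrix.diagonal v)
      = c • Matrix.vecMul u (P : Matrix (Fin d) (Fin d) ℂ) := by
    rw [← Matrix.smul_vecMul, ← h3, Matrix.vecMul_vecMul, Matrix.vecMul_vecMul, mul_assoc, h2,
      mul_one]
  have h5 : Matrix.vecMul u (P : Matrix (Fin d) (Fin d) ℂ) = 0 := by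
    ext ξ
    have := congrFun h4 ξ
    rw [Matrix.vecMul_diagonal, Pi.smul_apply, smul_eq_mul, mul_comm] at this
    by_contra h6
    exact hc (mul_right_cancel₀ h6 this ▸ hv ξ)
  rw [← Matrix.vecMul_one u, ← h1, ← Matrix.vecMul_vecMul, h5, Matrix.zero_vecMul]

end DiagonalizableWithin

/-- A matrix annihilated by a squarefree polynomial is diagonalizable, with the roots of the
polynomial as its eigenvalues. -/
theorem diagonalizableWithin_of_aeval_eq_zero {M : Matrix (Fin d) (Fin d) ℂ} {p : Polynomial ℂ}
    (hp : Squarefree p) (h : Polynomial.aeval M p = 0) :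
    DiagonalizableWithin M {z | p.IsRoot z} := by
  classical
  set f : Module.End ℂ (Fin d → ℂ) := Matrix.toLinAlgEquiv' M with hf
  have hpf : Polynomial.aeval f p = 0 := by
    rw [hf, Polynomial.aeval_algHom_apply, h, map_zero]
  have hss : f.IsSemisimple := Module.End.isSemisimple_of_squarefree_aeval_eq_zero hp hpf
  have htop : ⨆ μ : ℂ, f.eigenspace μ = ⊤ := by
    rw [← Module.End.iSup_maxGenEigenspace_eq_top f]
    exact iSup_congr fun μ => (Module.End.IsFinitelySemisimple.maxGenEigenspace_eq_eigenspace
      hss.isFinitelySemisimple μ).symm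
  have hint : DirectSum.IsInternal fun μ : ℂ => f.eigenspace μ :=
    DirectSum.isInternal_submodule_of_iSupIndep_of_iSup_eq_top f.eigenspaces_iSupIndep htop
  set b0 := hint.collectedBasis fun μ => Module.finBasis ℂ (f.eigenspace μ) with hb0
  have hfin : Fintype (Σ μ : ℂ, Fin (Module.finrank ℂ (f.eigenspace μ))) :=
    FiniteDimensional.fintypeBasisIndex b0
  have hcard : Fintype.card (Σ μ : ℂ, Fin (Module.finrank ℂ (f.eigenspace μ)))
      = Fintype.card (Fin d) := by
    rw [← Module.finrank_eq_card_basis b0]; simp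
  set e := Fintype.equivOfCardEq hcard with he
  set b := b0.reindex e with hb
  have hev : ∀ i, f (b i) = (e.symm i).1 • b i := fun i => by
    rw [hb, Module.Basis.reindex_apply]
    exact Module.End.mem_eigenspace_iff.mp (hint.collectedBasis_mem _ (e.symm i))
  set P : Matrix (Fin d) (Fin d) ℂ := Matrix.of fun i j => b j i with hP
  have hMP : M * P = P * Matrix.diagonal fun i => (e.symm i).1 := by
    ext i j
    rw [Matrix.mul_diagonal]
    have hfv : ∀ v, f v = M.mulVec v := fun v => Matrix.toLinAlgEquiv'_apply M v
    have := congrFun (hev j) i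
    rw [hfv] at this
    rw [Matrix.mul_apply]
    simp only [hP, Matrix.of_apply]
    rw [mul_comm, ← smul_eq_mul, ← Pi.smul_apply, ← this]
    rfl
  have hPu : IsUnit P := by
    have h1 : P = (Pi.basisFun ℂ (Fin d)).toMatrix b := by
      ext i j; simp [hP, Module.Basis.toMatrix_apply]
    rw [h1]
    have := (Pi.basisFun ℂ (Fin d)).invertibleToMatrix b
    exact isUnit_of_invertible _
  obtain ⟨U, hU⟩ := hPu
  refine ⟨U, fun i => (e.symm i).1, fun i => ?_, ?_⟩
  · have h1 := Module.End.aeval_apply_of_hasEigenvector (p := p)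
      (show f.HasEigenvector (e.symm i).1 (b i) from
        ⟨Module.End.mem_eigenspace_iff.mpr (hev i), b.ne_zero i⟩)
    rw [hpf, LinearMap.zero_apply] at h1
    exact (smul_eq_zero.mp h1.symm).resolve_right (b.ne_zero i)
  · rw [hU, ← hMP, mul_assoc, ← hU, Units.mul_inv, mul_one]

theorem diagonalizableWithin_zero_one {A : Matrix (Fin d) (Fin d) ℂ}
    (h : (A - (1 : ℂ) • (1 : Matrix (Fin d) (Fin d) ℂ)) * A = 0) :
    DiagonalizableWithin A {0, 1} := by
  open Polynomial in
  refine (diagonalizableWithin_of_aeval_eq_zero (p := (X - C 1) * (X - C 0)) ?_ ?_).mono ?_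
  · refine (Polynomial.Separable.mul (separable_X_sub_C) (separable_X_sub_C) ?_).squarefree
    exact isCoprime_X_sub_C_of_isUnit_sub (by simp)
  · rw [map_mul, map_sub, map_sub, aeval_X, aeval_C, aeval_C, map_zero, sub_zero,
      Algebra.algebraMap_eq_smul_one]
    exact h
  · intro z hz
    simp only [Set.mem_ofPred_eq, IsRoot, eval_mul, eval_sub, eval_X, eval_C, mul_eq_zero,
      sub_eq_zero] at hz
    exact hz.symm

theorem diagonalizableWithin_zero_one_two {B : Matrix (Fin d) (Fin d) ℂ}
    (h : (B - (2 : ℂ) • (1 : Matrix (Fin d) (Fin d) ℂ))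
      * ((B - (1 : ℂ) • (1 : Matrix (Fin d) (Fin d) ℂ)) * B) = 0) :
    DiagonalizableWithin B {0, 1, 2} := by
  open Polynomial in
  refine (diagonalizableWithin_of_aeval_eq_zero
    (p := (X - C 2) * ((X - C 1) * (X - C 0))) ?_ ?_).mono ?_
  · refine (Polynomial.Separable.mul (separable_X_sub_C)
      (Polynomial.Separable.mul (separable_X_sub_C) (separable_X_sub_C) ?_) ?_).squarefree
    · exact isCoprime_X_sub_C_of_isUnit_sub (by simp)
    · exact (isCoprime_X_sub_C_of_isUnit_sub (by norm_num)).mul_right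
        (isCoprime_X_sub_C_of_isUnit_sub (by norm_num))
  · rw [map_mul, map_mul, map_sub, map_sub, map_sub, aeval_X, aeval_C, aeval_C, aeval_C, map_zero,
      sub_zero, Algebra.algebraMap_eq_smul_one, Algebra.algebraMap_eq_smul_one]
    exact h
  · intro z hz
    simp only [Set.mem_ofPred_eq, IsRoot, eval_mul, eval_sub, eval_X, eval_C, mul_eq_zero,
      sub_eq_zero] at hz
    rcases hz with h | h | h <;> simp [h]

theorem SpectralCondition.dual {Λ : Fin d → ℚ} {X : Matrix (Fin d) (Fin d) ℂ}
    (h : SpectralCondition Λ X) : SpectralCondition (dualExp Λ) (dualChar X) := by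
  constructor
  · rw [matA_dual, ← one_smul ℂ (1 : Matrix (Fin d) (Fin d) ℂ)]
    refine h.1.smul_one_sub_transpose 1 ?_
    rintro z (rfl | rfl) <;> simp
  · rw [matB_dual]
    refine h.2.smul_one_sub_transpose 2 ?_
    rintro z (rfl | rfl | rfl) <;> norm_num

/-! ### Holomorphic matrix-valued functions -/

theorem mdifferentiable_mul {f g : ℍ → ℂ} (hf : MDiff f) (hg : MDiff g) :
    MDiff (fun τ => f τ * g τ) := by
  rw [UpperHalfPlane.mdifferentiable_iff] at *
  exact hf.mul hg

theorem mdifferentiable_sub {f g : ℍ → ℂ} (hf : MDiff f) (hg : MDiff g) :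
    MDiff (fun τ => f τ - g τ) := by
  rw [UpperHalfPlane.mdifferentiable_iff] at *
  exact hf.sub hg

theorem mdifferentiable_fun_const (c : ℂ) : MDiff (fun _ : ℍ => c) := mdifferentiable_const

theorem mdifferentiable_nabla {f : ℍ → ℂ} (hf : MDiff f) : MDiff (nabla f) :=
  mdifferentiable_mul mdifferentiable_curlyE
    (Derivative.normalizedDerivOfComplex_mdifferentiable hf)

theorem nabla_mul {f g : ℍ → ℂ} (hf : MDiff f) (hg : MDiff g) (τ : ℍ) :
    nabla (fun z => f z * g z) τ = nabla f τ * g τ + f τ * nabla g τ := by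
  rw [nabla, normalizedDeriv_mul hf hg, nabla, nabla]; ring

theorem nabla_const (c : ℂ) (τ : ℍ) : nabla (fun _ => c) τ = 0 := by
  have : ((fun _ : ℍ => c) ∘ ofComplex) = fun _ => c := rfl
  rw [nabla, Derivative.normalizedDerivOfComplex, this, deriv_const, mul_zero, mul_zero]

theorem nabla_sub {f g : ℍ → ℂ} (hf : MDiff f) (hg : MDiff g) (τ : ℍ) :
    nabla (fun z => f z - g z) τ = nabla f τ - nabla g τ := by
  have h : deriv ((fun z => f z - g z) ∘ ofComplex) (τ : ℂ)
      = deriv (f ∘ ofComplex) τ - deriv (g ∘ ofComplex) τ :=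
    deriv_sub (analyticAt_comp_ofComplex hf τ).differentiableAt
      (analyticAt_comp_ofComplex hg τ).differentiableAt
  rw [nabla, nabla, nabla, Derivative.normalizedDerivOfComplex, h,
    Derivative.normalizedDerivOfComplex, Derivative.normalizedDerivOfComplex]
  ring

theorem nabla_sum {ι : Type*} (s : Finset ι) {f : ι → ℍ → ℂ} (hf : ∀ i, MDiff (f i)) (τ : ℍ) :
    nabla (fun z => ∑ i ∈ s, f i z) τ = ∑ i ∈ s, nabla (f i) τ := by
  have h : deriv ((fun z => ∑ i ∈ s, f i z) ∘ ofComplex) (τ : ℂ)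
      = ∑ i ∈ s, deriv (f i ∘ ofComplex) τ :=
    deriv_fun_sum fun i _ => (analyticAt_comp_ofComplex (hf i) τ).differentiableAt
  simp only [nabla, Derivative.normalizedDerivOfComplex]
  rw [h, Finset.mul_sum, Finset.mul_sum]

namespace IsHolomorphic

variable {A B : ℍ → Matrix (Fin d) (Fin d) ℂ}

theorem mul (hA : IsHolomorphic A) (hB : IsHolomorphic B) : IsHolomorphic fun τ => A τ * B τ :=
  fun i j => by
    simp only [Matrix.mul_apply]
    exact mdifferentiable_sum _ fun k _ => mdifferentiable_mul (hA i k) (hB k j)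

theorem sub (hA : IsHolomorphic A) (hB : IsHolomorphic B) : IsHolomorphic fun τ => A τ - B τ :=
  fun i j => mdifferentiable_sub (hA i j) (hB i j)

theorem const (C : Matrix (Fin d) (Fin d) ℂ) : IsHolomorphic fun _ => C :=
  fun i j => mdifferentiable_fun_const (C i j)

theorem transpose (hA : IsHolomorphic A) : IsHolomorphic fun τ => (A τ).transpose :=
  fun i j => hA j i

theorem smul {f : ℍ → ℂ} (hf : MDiff f) (hA : IsHolomorphic A) : IsHolomorphic fun τ => f τ • A τ :=
  fun i j => mdifferentiable_mul hf (hA i j)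

theorem det (hA : IsHolomorphic A) : MDiff fun τ => (A τ).det := by
  simp only [Matrix.det_apply']
  exact mdifferentiable_sum _ fun σ _ => mdifferentiable_mul (mdifferentiable_fun_const _)
    (mdifferentiable_prod _ fun i _ => hA _ _)

theorem adjugate (hA : IsHolomorphic A) : IsHolomorphic fun τ => (A τ).adjugate := by
  intro i j
  simp only [Matrix.adjugate_apply]
  refine IsHolomorphic.det (A := fun τ => (A τ).updateRow j (Pi.single i 1)) fun k l => ?_
  by_cases h : k = j
  · subst h
    simp only [Matrix.updateRow_self]
    exact mdifferentiable_fun_const _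
  · simp only [Matrix.updateRow_ne h]
    exact hA k l

theorem comp_smul (hA : IsHolomorphic A) (γ : SL(2, ℤ)) : IsHolomorphic fun τ => A (γ • τ) :=
  fun i j => mdifferentiable_comp_smul (hA i j) γ

end IsHolomorphic

/-- The operator `∇`, applied to the elements of a matrix. -/
def nablaMat (A : ℍ → Matrix (Fin d) (Fin d) ℂ) (τ : ℍ) : Matrix (Fin d) (Fin d) ℂ :=
  Matrix.of fun i j => nabla (fun z => A z i j) τ

theorem nablaMat_mul {A B : ℍ → Matrix (Fin d) (Fin d) ℂ} (hA : IsHolomorphic A)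
    (hB : IsHolomorphic B) (τ : ℍ) :
    nablaMat (fun z => A z * B z) τ = nablaMat A τ * B τ + A τ * nablaMat B τ := by
  ext i j
  simp only [nablaMat, Matrix.of_apply, Matrix.add_apply, Matrix.mul_apply]
  rw [nabla_sum _ fun k => mdifferentiable_mul (hA i k) (hB k j), ← Finset.sum_add_distrib]
  exact Finset.sum_congr rfl fun k _ => nabla_mul (hA i k) (hB k j) τ

theorem nablaMat_const_mul {A : ℍ → Matrix (Fin d) (Fin d) ℂ} (C : Matrix (Fin d) (Fin d) ℂ)
    (hA : IsHolomorphic A) (τ : ℍ) : nablaMat (fun z => C * A z) τ = C * nablaMat A τ := by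
  have : nablaMat (fun _ => C) τ = 0 := by ext i j; exact nabla_const _ τ
  rw [nablaMat_mul (IsHolomorphic.const C) hA, this, zero_mul, zero_add]

theorem nablaMat_sub {A B : ℍ → Matrix (Fin d) (Fin d) ℂ} (hA : IsHolomorphic A)
    (hB : IsHolomorphic B) (τ : ℍ) :
    nablaMat (fun z => A z - B z) τ = nablaMat A τ - nablaMat B τ := by
  ext i j
  exact nabla_sub (hA i j) (hB i j) τ

theorem nablaMat_smul_one {f : ℍ → ℂ} (hf : MDiff f) (τ : ℍ) :
    nablaMat (fun z => f z • (1 : Matrix (Fin d) (Fin d) ℂ)) τ = nabla f τ • 1 := by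
  ext i j
  have := nabla_mul hf (mdifferentiable_fun_const ((1 : Matrix (Fin d) (Fin d) ℂ) i j)) τ
  rw [nabla_const, mul_zero, add_zero] at this
  exact this

theorem nablaMat_transpose (A : ℍ → Matrix (Fin d) (Fin d) ℂ) (τ : ℍ) :
    nablaMat (fun z => (A z).transpose) τ = (nablaMat A τ).transpose := rfl

/-- A matrix function whose determinant does not vanish identically may be cancelled. -/
theorem eq_of_mul_transpose_eq {A B Ξ : ℍ → Matrix (Fin d) (Fin d) ℂ} (hA : IsHolomorphic A)
    (hB : IsHolomorphic B) (hΞ : IsHolomorphic Ξ) (hne : ∃ τ, (Ξ τ).det ≠ 0)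
    (h : ∀ τ, A τ * (Ξ τ).transpose = B τ * (Ξ τ).transpose) (τ : ℍ) : A τ = B τ := by
  ext i j
  refine eq_of_mul_eq_mul hΞ.det (hA i j) (hB i j) hne (fun z => ?_) τ
  have h1 := congrArg (· * (Ξ z).transpose.adjugate) (h z)
  simp only [mul_assoc, Matrix.mul_adjugate, Matrix.det_transpose, Matrix.mul_smul, mul_one] at h1
  exact congrFun (congrFun h1 i) j

/-! ### The boundary condition -/

/-- The boundary condition, in terms of power series on the unit disc. -/
theorem hasBoundaryExpansion_iff {Λ : Fin d → ℚ} {X : Matrix (Fin d) (Fin d) ℂ}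
    {Ξ : ℍ → Matrix (Fin d) (Fin d) ℂ} :
    HasBoundaryExpansion Λ X Ξ ↔ ∃ F : Fin d → Fin d → ℂ → ℂ, ∀ ξ ν,
      HasQForm (Λ ξ - 1) (F ξ ν) (fun τ => Ξ τ ξ ν) ∧
      F ξ ν 0 = (1 : Matrix (Fin d) (Fin d) ℂ) ξ ν ∧ deriv (F ξ ν) 0 = X ξ ν := by
  constructor
  · intro h
    have : ∀ ξ ν, ∃ F, HasQForm (Λ ξ - 1) F (fun τ => Ξ τ ξ ν) ∧
        F 0 = (1 : Matrix (Fin d) (Fin d) ℂ) ξ ν ∧ deriv F 0 = X ξ ν := by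
      intro ξ ν
      obtain ⟨a, ha, hN, h1, h0⟩ := h ν
      obtain ⟨F, hF, hF0, hF1⟩ := exists_hasQForm_of_hasSum (-1) (fun τ => ha τ ξ)
        (fun n hn => congrFun (hN n hn) ξ)
      refine ⟨F, hF.congr_index (by push_cast; ring), ?_, ?_⟩
      · rw [hF0, h1, Pi.single_apply, Matrix.one_apply]
      · rw [hF1, ← h0]; rfl
    choose F hF using this
    exact ⟨F, hF⟩
  · rintro ⟨F, hF⟩ ν
    choose a ha hN h1 h0 using fun ξ =>
      HasQForm.hasSum (l := (Λ ξ : ℂ)) (-1) ((hF ξ ν).1.congr_index (by push_cast; ring))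
    refine ⟨fun n ξ => a ξ n, fun τ ξ => ha ξ τ, fun n hn => funext fun ξ => hN ξ n hn,
      funext fun ξ => ?_, fun ξ => ?_⟩
    · exact (h1 ξ).trans (by rw [(hF ξ ν).2.1, Pi.single_apply, Matrix.one_apply])
    · rw [← (hF ξ ν).2.2, ← h0]; rfl

theorem hasQForm_det {l : Fin d → ℂ} {F : Fin d → Fin d → ℂ → ℂ}
    {Ξ : ℍ → Matrix (Fin d) (Fin d) ℂ}
    (h : ∀ ξ ν, HasQForm (l ξ) (F ξ ν) (fun τ => Ξ τ ξ ν)) :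
    HasQForm (∑ ξ, l ξ) (fun q => (Matrix.of fun ξ ν => F ξ ν q).det) (fun τ => (Ξ τ).det) := by
  constructor
  · simp only [Matrix.det_apply', Matrix.of_apply]
    exact DifferentiableOn.fun_sum fun σ _ => (differentiableOn_const _).mul
      (DifferentiableOn.fun_finsetProd fun i _ => (h _ _).diff)
  · intro τ
    have h1 : Ξ τ = Matrix.diagonal (fun ξ => Complex.exp (2 * Real.pi * Complex.I * l ξ * τ))
        * Matrix.of fun ξ ν => F ξ ν (qParam 1 τ) := by
      ext ξ ν
      rw [Matrix.diagonal_mul, Matrix.of_apply]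
      exact (h ξ ν).eq τ
    rw [h1, Matrix.det_mul, Matrix.det_diagonal, ← Complex.exp_sum, Finset.mul_sum, Finset.sum_mul]

theorem hasQForm_det_of_boundary {Λ : Fin d → ℚ} {F : Fin d → Fin d → ℂ → ℂ}
    {Ξ : ℍ → Matrix (Fin d) (Fin d) ℂ}
    (hF : ∀ ξ ν, HasQForm (Λ ξ - 1) (F ξ ν) (fun τ => Ξ τ ξ ν) ∧
      F ξ ν 0 = (1 : Matrix (Fin d) (Fin d) ℂ) ξ ν) :
    ∃ P, HasQForm (∑ ξ, ((Λ ξ : ℂ) - 1)) P (fun τ => (Ξ τ).det) ∧ P 0 = 1 := by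
  refine ⟨_, hasQForm_det fun ξ ν => (hF ξ ν).1, ?_⟩
  have : (Matrix.of fun ξ ν => F ξ ν 0) = (1 : Matrix (Fin d) (Fin d) ℂ) := by
    ext ξ ν; exact (hF ξ ν).2
  simp only [this, Matrix.det_one]

theorem HasBoundaryExpansion.exists_det_ne_zero {Λ : Fin d → ℚ} {X : Matrix (Fin d) (Fin d) ℂ}
    {Ξ : ℍ → Matrix (Fin d) (Fin d) ℂ} (h : HasBoundaryExpansion Λ X Ξ) :
    ∃ τ, (Ξ τ).det ≠ 0 := by
  obtain ⟨F, hF⟩ := hasBoundaryExpansion_iff.mp h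
  obtain ⟨P, hP, hP0⟩ := hasQForm_det_of_boundary fun ξ ν => ⟨(hF ξ ν).1, (hF ξ ν).2.1⟩
  exact exists_ne_zero_of_hasQForm hP (by simp [hP0])

theorem exists_curlyE_ne_zero : ∃ τ, curlyE τ ≠ 0 := by
  obtain ⟨F, h, h0, -⟩ := exists_hasQForm_curlyE
  exact exists_ne_zero_of_hasQForm h (by simp [h0])

/-! ### Solutions of the compatibility equation -/

/-- A linear relation between the rows of a solution of `∇ Y = Y D` that holds at a point where
`ℰ ≠ 0` holds everywhere. -/
theorem eq_zero_of_nablaMat_eq {Λ : Fin d → ℚ} {X : Matrix (Fin d) (Fin d) ℂ}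
    {Y : ℍ → Matrix (Fin d) (Fin d) ℂ} (hY : IsHolomorphic Y)
    (hode : ∀ τ, nablaMat Y τ = Y τ * connMat Λ X τ) {p : ℍ} (hp : curlyE p ≠ 0)
    {c : Fin d → ℂ} (h0 : Matrix.vecMul c (Y p) = 0) (τ : ℍ) : Matrix.vecMul c (Y τ) = 0 := by
  ext j
  refine eq_zero_of_nabla_eq (y := fun j τ => ∑ i, c i * Y τ i j)
    (fun j => mdifferentiable_sum _ fun i _ => mdifferentiable_mul (mdifferentiable_fun_const _)
      (hY i j)) (M := fun τ => connMat Λ X τ) (mdifferentiable_connMat Λ X) (fun τ j => ?_) hp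
    (fun j => congrFun h0 j) j τ
  rw [nabla_sum _ fun i => mdifferentiable_mul (mdifferentiable_fun_const _) (hY i j)]
  have h1 : ∀ i, nabla (fun z => c i * Y z i j) τ = c i * (Y τ * connMat Λ X τ) i j := by
    intro i
    rw [nabla_mul (mdifferentiable_fun_const _) (hY i j), nabla_const, zero_mul, zero_add, ← hode]
    rfl
  simp only [h1]
  exact congrFun (Matrix.vecMul_vecMul c (Y τ) (connMat Λ X τ)).symm j

namespace IsFundamentalSolution

variable {Λ : Fin d → ℚ} {X : Matrix (Fin d) (Fin d) ℂ} {Ξ : ℍ → Matrix (Fin d) (Fin d) ℂ}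

theorem nablaMat_eq (h : IsFundamentalSolution Λ X Ξ) (τ : ℍ) :
    nablaMat Ξ τ = Ξ τ * connMat Λ X τ := by
  ext i j; exact h.compat τ i j

/-- A row vector that annihilates `Ξ` at one regular point annihilates it everywhere. -/
theorem det_ne_zero (h : IsFundamentalSolution Λ X Ξ) {p : ℍ} (hp : curlyE p ≠ 0) :
    (Ξ p).det ≠ 0 := by
  intro h0
  obtain ⟨c, hc, hcp⟩ := Matrix.exists_vecMul_eq_zero_iff.mpr h0
  obtain ⟨τ, hτ⟩ := h.expansion.exists_det_ne_zero
  exact hτ (Matrix.exists_vecMul_eq_zero_iff.mp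
    ⟨c, hc, eq_zero_of_nablaMat_eq h.holo h.nablaMat_eq hp hcp τ⟩)

theorem exists_eq_mul (h : IsFundamentalSolution Λ X Ξ) {Y : ℍ → Matrix (Fin d) (Fin d) ℂ}
    (hY : IsHolomorphic Y) (hode : ∀ τ, nablaMat Y τ = Y τ * connMat Λ X τ) :
    ∃ C : Matrix (Fin d) (Fin d) ℂ, ∀ τ, Y τ = C * Ξ τ := by
  obtain ⟨p, hp⟩ := exists_curlyE_ne_zero
  have hu : IsUnit (Ξ p).det := (h.det_ne_zero hp).isUnit
  refine ⟨Y p * (Ξ p)⁻¹, fun τ => ?_⟩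
  have hC := (IsHolomorphic.const (Y p * (Ξ p)⁻¹)).mul h.holo
  have h1 : ∀ τ, nablaMat (fun τ => Y τ - Y p * (Ξ p)⁻¹ * Ξ τ) τ
      = (Y τ - Y p * (Ξ p)⁻¹ * Ξ τ) * connMat Λ X τ := fun τ => by
    rw [nablaMat_sub hY hC, nablaMat_const_mul _ h.holo, hode, h.nablaMat_eq, sub_mul, mul_assoc,
      mul_assoc, mul_assoc]
  have h2 : Y p - Y p * (Ξ p)⁻¹ * Ξ p = 0 := by
    rw [mul_assoc, Matrix.nonsing_inv_mul _ hu, mul_one, sub_self]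
  rw [← sub_eq_zero]
  ext i j
  have h3 := eq_zero_of_nablaMat_eq (hY.sub hC) h1 hp (c := Pi.single i 1)
    (by rw [h2, Matrix.vecMul_zero]) τ
  have := congrFun h3 j
  rwa [Matrix.single_one_vecMul] at this

theorem nablaMat_comp_smul (h : IsFundamentalSolution Λ X Ξ) (γ : SL(2, ℤ)) (τ : ℍ) :
    nablaMat (fun z => Ξ (γ • z)) τ = Ξ (γ • τ) * connMat Λ X τ := by
  have h1 : connMat Λ X τ = connMat Λ X (γ • τ) := by
    rw [connMat, connMat, J_eq, J_eq, jInv_smul]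
  rw [h1, ← h.nablaMat_eq]
  ext i j
  exact nabla_comp_smul (h.holo i j) γ τ

theorem mul_right_cancel (h : IsFundamentalSolution Λ X Ξ) {C C' : Matrix (Fin d) (Fin d) ℂ}
    (e : ∀ τ, C * Ξ τ = C' * Ξ τ) : C = C' := by
  obtain ⟨p, hp⟩ := exists_curlyE_ne_zero
  have hu : IsUnit (Ξ p).det := (h.det_ne_zero hp).isUnit
  rw [← mul_one C, ← mul_one C', ← Matrix.mul_nonsing_inv _ hu, ← mul_assoc, e, mul_assoc]

/-- The monodromy representation: since `∇` is invariant under `SL(2, ℤ)`, the translates of a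
fundamental solution solve the same equation. -/
theorem exists_transformsBy (h : IsFundamentalSolution Λ X Ξ) :
    ∃ ρ : SL(2, ℤ) →* GL (Fin d) ℂ, ∀ ρ', TransformsBy ρ' Ξ ↔ ρ' = ρ := by
  choose C hC using fun γ : SL(2, ℤ) =>
    h.exists_eq_mul (h.holo.comp_smul γ) (h.nablaMat_comp_smul γ)
  set ρ : SL(2, ℤ) →* GL (Fin d) ℂ := MonoidHom.toHomUnits
    { toFun := C
      map_one' := h.mul_right_cancel fun τ => by rw [← hC, one_smul, one_mul]
      map_mul' := fun γ δ => h.mul_right_cancel fun τ => by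
        rw [← hC, mul_assoc, ← hC, ← hC, mul_smul] } with hρ
  refine ⟨ρ, fun ρ' => ⟨fun h' => ?_, ?_⟩⟩
  · ext1 γ
    exact Units.ext (h.mul_right_cancel fun τ => by rw [← h' γ τ, hC]; rfl)
  · rintro rfl γ τ
    exact hC γ τ

end IsFundamentalSolution

/-! ### The dual fundamental matrix -/

/-- If `y = G / δ` solves `e y' = y D` with a regular singularity at `p`, and no eigenvalue of
`D(p)` is a negative integral multiple of `e'(p)`, then `δ` divides `G` at `p`. -/
theorem exists_eq_mul_of_regularSingular {ι : Type*} [Fintype ι] {p : ℂ} {e δ : ℂ → ℂ}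
    (he : AnalyticAt ℂ e p) (he0 : e p = 0) {D : ℂ → ι → ι → ℂ}
    (hD : ∀ i j, ContinuousAt (fun z => D z i j) p)
    (hspec : ∀ (m : ℕ) (u : ι → ℂ),
      (∀ j, ∑ i, u i * D p i j = -((m + 1 : ℕ) * deriv e p) * u j) → u = 0)
    (hδ : AnalyticAt ℂ δ p) (hδ0 : ∀ᶠ z in 𝓝[≠] p, δ z ≠ 0) {G : ι → ℂ → ℂ}
    (hG : ∀ i, AnalyticAt ℂ (G i) p)
    (hode : ∀ᶠ z in 𝓝 p, ∀ j, e z * (δ z * deriv (G j) z - deriv δ z * G j z)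
      = δ z * ∑ i, G i z * D z i j) (i : ι) :
    ∃ v, AnalyticAt ℂ v p ∧ ∀ᶠ z in 𝓝 p, G i z = δ z * v z := by
  obtain ⟨n, h, hh, hhp, hδh⟩ := hδ.exists_eventuallyEq_pow_smul_nonzero_iff.mpr fun h0 =>
    (hδ0.and (mem_nhdsWithin_of_mem_nhds h0)).exists.elim fun z hz => hz.1 hz.2
  have hne := hh.continuousAt.eventually_ne hhp
  set u : ι → ℂ → ℂ := fun i z => G i z / h z with hu
  have hua : ∀ i, AnalyticAt ℂ (u i) p := fun i => (hG i).div hh hhp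
  have hGu : ∀ i, G i =ᶠ[𝓝 p] fun z => h z * u i z := fun i => by
    filter_upwards [hne] with z hz
    exact (mul_div_cancel₀ _ hz).symm
  have key := exists_eq_pow_mul_of_regularSingular he he0 hD hspec n u hua ?_ i
  · obtain ⟨v, hv, huv⟩ := key
    refine ⟨v, hv, ?_⟩
    filter_upwards [hGu i, huv, hδh] with z h1 h2 h3
    rw [h1, h2, h3, smul_eq_mul]; ring
  · have hδd : deriv δ =ᶠ[𝓝 p] deriv fun z => (z - p) ^ n * h z := Filter.EventuallyEq.deriv hδh
    have hGd : ∀ i, deriv (G i) =ᶠ[𝓝 p] deriv fun z => h z * u i z := fun i => (hGu i).deriv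
    filter_upwards [self_mem_nhdsWithin, mem_nhdsWithin_of_mem_nhds hode,
      mem_nhdsWithin_of_mem_nhds hne, mem_nhdsWithin_of_mem_nhds hδh,
      mem_nhdsWithin_of_mem_nhds hδd,
      mem_nhdsWithin_of_mem_nhds (Filter.eventually_all.mpr hGu),
      mem_nhdsWithin_of_mem_nhds (Filter.eventually_all.mpr hGd),
      mem_nhdsWithin_of_mem_nhds hh.eventually_analyticAt,
      mem_nhdsWithin_of_mem_nhds (Filter.eventually_all.mpr fun i => (hua i).eventually_analyticAt)]
      with z h1 h2 h3 h4 h5 h6 h7 h8 h9 j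
    have hz : z - p ≠ 0 := sub_ne_zero.mpr h1
    have hd1 : HasDerivAt (fun z => (z - p) ^ n * h z)
        (n * (z - p) ^ (n - 1) * 1 * h z + (z - p) ^ n * deriv h z) z :=
      (((hasDerivAt_id z).sub_const p).pow n).mul h8.differentiableAt.hasDerivAt
    have hd2 : HasDerivAt (fun z => h z * u j z) (deriv h z * u j z + h z * deriv (u j) z) z :=
      h8.differentiableAt.hasDerivAt.mul (h9 j).differentiableAt.hasDerivAt
    have h10 := h2 j
    have h11 : ∑ i, G i z * D z i j = h z * ∑ i, u i z * D z i j := by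
      rw [Finset.mul_sum]
      exact Finset.sum_congr rfl fun i _ => by rw [h6 i]; ring
    rw [h11, h7 j, hd2.deriv, h5, hd1.deriv, h4, h6 j, smul_eq_mul] at h10
    have hn : (n : ℂ) * (z - p) ^ (n - 1) * (z - p) = n * (z - p) ^ n := by
      rcases n with _ | n
      · simp
      · rw [Nat.add_sub_cancel, pow_succ, mul_assoc]
    apply mul_left_cancel₀ (mul_ne_zero (pow_ne_zero n hz) (pow_ne_zero 2 h3))
    linear_combination (z - p) * h10 + e z * h z ^ 2 * u j z * hn

/-- The spectral condition excludes the eigenvalues of the connection matrix that would allow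
poles at the elliptic points. -/
theorem SpectralCondition.eq_zero_of_vecMul_eq {Λ : Fin d → ℚ} {X : Matrix (Fin d) (Fin d) ℂ}
    (h : SpectralCondition Λ X) {τ : ℍ} (hτ : curlyE τ = 0) (m : ℕ) {u : Fin d → ℂ}
    (hu : ∀ j, ∑ i, u i * connMat Λ X τ i j
      = -((m + 1 : ℕ) * Derivative.normalizedDerivOfComplex curlyE τ) * u j) : u = 0 := by
  have hm : (m : ℂ) + 1 ≠ 0 := by exact_mod_cast m.succ_ne_zero
  have hre : ((m : ℂ) + 1).re = m + 1 := by simp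
  have hnn : (0 : ℝ) ≤ m := m.cast_nonneg
  have hD := ModularForm.discriminant_ne_zero τ
  rcases (curlyE_eq_zero_iff τ).mp hτ with h4 | h6
  · have hj : jInv τ = 0 := by rw [jInv, h4]; simp
    refine h.2.mem_of_vecMul_eq (c := -((m : ℂ) + 1)) (fun j => ?_) ?_
    · have h1 := hu j
      rw [deriv_curlyE_of_E4_eq_zero h4, connMat_eq, hj] at h1
      have h2 : ∀ i, u i * (((-((0 - 1728) / 3 : ℂ)) • matB Λ X - (0 / 2 : ℂ) • matA Λ X) i j)
          = 576 * (u i * matB Λ X i j) := fun i => by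
        simp only [Matrix.sub_apply, Matrix.smul_apply, smul_eq_mul]; ring
      simp only [h2, ← Finset.mul_sum] at h1
      push_cast at h1
      linear_combination h1 / 576
    · rintro (h0 | h0 | h0) <;>
      · have := congrArg Complex.re h0
        rw [Complex.neg_re, hre] at this
        norm_num at this
        linarith
  · have hj : jInv τ = 1728 := by
      have := jInv_sub_mul_discriminant τ
      rw [h6] at this
      simp only [ne_eq, OfNat.ofNat_ne_zero, not_false_eq_true, zero_pow, mul_eq_zero, hD,
        or_false] at this
      linear_combination this
    refine h.1.mem_of_vecMul_eq (c := -((m : ℂ) + 1)) (fun j => ?_) ?_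
    · have h1 := hu j
      rw [deriv_curlyE_of_E6_eq_zero h6, connMat_eq, hj] at h1
      have h2 : ∀ i, u i * (((-((1728 - 1728) / 3 : ℂ)) • matB Λ X
          - (1728 / 2 : ℂ) • matA Λ X) i j) = -864 * (u i * matA Λ X i j) := fun i => by
        simp only [Matrix.sub_apply, Matrix.smul_apply, smul_eq_mul]; ring
      simp only [h2, ← Finset.mul_sum] at h1
      push_cast at h1
      linear_combination h1 / (-864)
    · rintro (h0 | h0) <;>
      · have := congrArg Complex.re h0
        rw [Complex.neg_re, hre] at this
        norm_num at this
        linarith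

namespace IsFundamentalSolution

variable {Λ : Fin d → ℚ} {X : Matrix (Fin d) (Fin d) ℂ} {Ξ : ℍ → Matrix (Fin d) (Fin d) ℂ}

/-- The equation for `G = (E₁₄ / Δ^(7/6)) · ᵗadj Ξ`, obtained from `G · ᵗΞ = (E₁₄ / Δ^(7/6)) det Ξ`
without division. -/
theorem nablaMat_adjugate (h : IsFundamentalSolution Λ X Ξ) (τ : ℍ) :
    (Ξ τ).det • nablaMat (fun z => dualFactor z • (Ξ z).transpose.adjugate) τ
      - nabla (fun z => (Ξ z).det) τ • (dualFactor τ • (Ξ τ).transpose.adjugate)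
      = (Ξ τ).det • (dualFactor τ • (Ξ τ).transpose.adjugate
        * connMat (dualExp Λ) (dualChar X) τ) := by
  set G : ℍ → Matrix (Fin d) (Fin d) ℂ := fun z => dualFactor z • (Ξ z).transpose.adjugate with hG
  have hGh : IsHolomorphic G := IsHolomorphic.smul mdifferentiable_dualFactor
    h.holo.transpose.adjugate
  have hs := mdifferentiable_dualFactor
  have h1 : (fun z => G z * (Ξ z).transpose)
      = fun z => (dualFactor z * (Ξ z).det) • (1 : Matrix (Fin d) (Fin d) ℂ) := by
    ext1 z
    rw [hG]
    simp only [Matrix.smul_mul, Matrix.adjugate_mul, Matrix.det_transpose, smul_smul]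
  have h2 := congrArg (fun f => nablaMat f τ) h1
  simp only [nablaMat_smul_one (mdifferentiable_mul hs h.holo.det),
    nablaMat_mul hGh h.holo.transpose, nablaMat_transpose, h.nablaMat_eq,
    nabla_mul hs h.holo.det, nabla_dualFactor, Matrix.transpose_mul] at h2
  have h3 := congrArg (· * (Ξ τ).transpose.adjugate) h2
  simp only [add_mul, mul_assoc, Matrix.mul_adjugate, Matrix.det_transpose, Matrix.mul_smul,
    mul_one, Matrix.smul_mul, one_mul] at h3
  rw [connMat_dual]
  simp only [mul_sub, Matrix.mul_smul, mul_one]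
  rw [hG] at h3 ⊢
  simp only [Matrix.smul_mul, smul_smul] at h3 ⊢
  rw [← sub_eq_zero] at h3 ⊢
  rw [← h3]
  module

/-- The function `s · ᵗΞ⁻¹ = s · ᵗadj Ξ / det Ξ`, with `s = E₁₄ / Δ^(7/6)`, has no poles. -/
theorem exists_dual (hsp : SpectralCondition Λ X) (h : IsFundamentalSolution Λ X Ξ) :
    ∃ Ξd : ℍ → Matrix (Fin d) (Fin d) ℂ, IsHolomorphic Ξd ∧
      (∀ τ, (Ξ τ).det • Ξd τ = dualFactor τ • (Ξ τ).transpose.adjugate) := by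
  set G : ℍ → Matrix (Fin d) (Fin d) ℂ := fun z => dualFactor z • (Ξ z).transpose.adjugate with hG
  have hGh : IsHolomorphic G := IsHolomorphic.smul mdifferentiable_dualFactor
    h.holo.transpose.adjugate
  have hne := h.expansion.exists_det_ne_zero
  have key : ∀ i j, ∃ k : ℍ → ℂ, MDiff k ∧ ∀ τ, G τ i j = (Ξ τ).det * k τ := by
    intro i j
    refine exists_mdifferentiable_eq_mul h.holo.det hne fun τ => ?_
    have hδ := analyticAt_comp_ofComplex h.holo.det τ
    by_cases hτ : curlyE τ = 0
    · refine exists_eq_mul_of_regularSingular (analyticAt_nablaCoeff τ)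
        (by rw [nablaCoeff_coe, hτ, mul_zero])
        (D := fun z => connMat (dualExp Λ) (dualChar X) (ofComplex z))
        (fun i j => (analyticAt_comp_ofComplex (mdifferentiable_connMat _ _ i j) τ).continuousAt)
        (fun m u hu => hsp.dual.eq_zero_of_vecMul_eq hτ m ?_) hδ
        (eventually_ne_zero_of_mdifferentiable h.holo.det hne τ)
        (G := fun j => (fun z => G z i j) ∘ ofComplex)
        (fun j => analyticAt_comp_ofComplex (hGh i j) τ) ?_ j
      · simpa only [deriv_nablaCoeff, ofComplex_apply] using hu
      · filter_upwards [eventually_im_pos τ] with z hz j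
        have h1 := congrFun (congrFun (h.nablaMat_adjugate (ofComplex z)) i) j
        have h2 := nabla_ofComplex (fun z => (Ξ z).det) hz
        have h3 := nabla_ofComplex (fun z => G z i j) hz
        have h4 : nablaMat G (ofComplex z) i j = nabla (fun z => G z i j) (ofComplex z) := rfl
        have h5 : ∀ M : Matrix (Fin d) (Fin d) ℂ, (G (ofComplex z) * M) i j
          = ∑ k, ((fun z => G z i k) ∘ ofComplex) z * M k j := fun M => rfl
        rw [← hG, Matrix.sub_apply, Matrix.smul_apply, Matrix.smul_apply, Matrix.smul_apply, h4, h2,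
          h3] at h1
        simp only [smul_eq_mul] at h1
        change _ - _ * G (ofComplex z) i j = (Ξ (ofComplex z)).det
          * ((G (ofComplex z) * connMat (dualExp Λ) (dualChar X) (ofComplex z) :
            Matrix (Fin d) (Fin d) ℂ) i j) at h1
        rw [h5] at h1
        simp only [Function.comp_apply] at h1 ⊢
        linear_combination h1
    · have hd0 := h.det_ne_zero hτ
      have hd : ((fun z => (Ξ z).det) ∘ ofComplex) (τ : ℂ) ≠ 0 := by simpa using hd0
      refine ⟨fun z => ((fun z => G z i j) ∘ ofComplex) z / ((fun z => (Ξ z).det) ∘ ofComplex) z,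
        (analyticAt_comp_ofComplex (hGh i j) τ).div hδ hd, ?_⟩
      filter_upwards [hδ.continuousAt.eventually_ne hd] with z hz
      exact (mul_div_cancel₀ _ hz).symm
  choose k hk hGk using key
  refine ⟨fun τ => Matrix.of fun i j => k i j τ, fun i j => hk i j, fun τ => ?_⟩
  ext i j
  exact (hGk i j τ).symm

end IsFundamentalSolution

/-- The relation between a fundamental matrix and its dual that holds everywhere. -/
theorem mul_transpose_eq_of_dual {Ξ Ξd : ℍ → Matrix (Fin d) (Fin d) ℂ} (hΞ : IsHolomorphic Ξ)
    (hΞd : IsHolomorphic Ξd) (hne : ∃ τ, (Ξ τ).det ≠ 0)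
    (h : ∀ τ, (Ξ τ).det • Ξd τ = dualFactor τ • (Ξ τ).transpose.adjugate) (τ : ℍ) :
    Ξd τ * (Ξ τ).transpose = dualFactor τ • (1 : Matrix (Fin d) (Fin d) ℂ) := by
  ext i j
  refine eq_of_mul_eq_mul hΞ.det ((hΞd.mul hΞ.transpose) i j)
    (mdifferentiable_mul mdifferentiable_dualFactor (mdifferentiable_fun_const _)) hne
    (fun z => ?_) τ
  have h1 : (Ξ z).det • (Ξd z * (Ξ z).transpose)
      = (Ξ z).det • (dualFactor z • (1 : Matrix (Fin d) (Fin d) ℂ)) := by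
    rw [← Matrix.smul_mul, h, Matrix.smul_mul, Matrix.adjugate_mul, Matrix.det_transpose,
      smul_comm]
  exact congrFun (congrFun h1 i) j

section Dual

variable {Λ : Fin d → ℚ} {X : Matrix (Fin d) (Fin d) ℂ} {Ξ Ξd : ℍ → Matrix (Fin d) (Fin d) ℂ}

theorem eq_smul_inv_of_mul_transpose_eq {τ : ℍ}
    (hd : Ξd τ * (Ξ τ).transpose = dualFactor τ • (1 : Matrix (Fin d) (Fin d) ℂ))
    (hu : IsUnit (Ξ τ).det) : Ξd τ = dualFactor τ • ((Ξ τ).transpose)⁻¹ := by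
  have hu' : IsUnit (Ξ τ).transpose.det := by rwa [Matrix.det_transpose]
  have := congrArg (· * ((Ξ τ).transpose)⁻¹) hd
  simpa [mul_assoc, Matrix.mul_nonsing_inv _ hu'] using this

/-- The dual equation, by differentiating `Ξd · ᵗΞ = s`. -/
theorem nablaMat_dual (h : IsFundamentalSolution Λ X Ξ) (hΞd : IsHolomorphic Ξd)
    (hd : ∀ τ, Ξd τ * (Ξ τ).transpose = dualFactor τ • (1 : Matrix (Fin d) (Fin d) ℂ)) (τ : ℍ) :
    nablaMat Ξd τ = Ξd τ * connMat (dualExp Λ) (dualChar X) τ := by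
  refine eq_of_mul_transpose_eq (A := nablaMat Ξd)
    (B := fun τ => Ξd τ * connMat (dualExp Λ) (dualChar X) τ)
    (fun i j => mdifferentiable_nabla (hΞd i j))
    (hΞd.mul fun i j => mdifferentiable_connMat _ _ i j) h.holo
    h.expansion.exists_det_ne_zero (fun z => ?_) τ
  have h2 := congrArg (fun f => nablaMat f z) (funext hd)
  simp only [nablaMat_smul_one mdifferentiable_dualFactor, nablaMat_mul hΞd h.holo.transpose,
    nablaMat_transpose, h.nablaMat_eq, nabla_dualFactor, Matrix.transpose_mul] at h2
  rw [connMat_dual, mul_sub, sub_mul, Matrix.mul_smul, mul_one, Matrix.smul_mul, hd, smul_smul,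
    ← h2, mul_assoc]
  abel

/-- The constant term and the linear term of `Ξd · ᵗΞ = s = q^(-7/6) (1 + 4 q + ⋯)` determine those
of `Ξd`. -/
theorem hasBoundaryExpansion_dual (hΞd : IsHolomorphic Ξd) (hX : HasBoundaryExpansion Λ X Ξ)
    (h : ∀ τ, (Ξ τ).det • Ξd τ = dualFactor τ • (Ξ τ).transpose.adjugate)
    (hd : ∀ τ, Ξd τ * (Ξ τ).transpose = dualFactor τ • (1 : Matrix (Fin d) (Fin d) ℂ)) :
    HasBoundaryExpansion (dualExp Λ) (dualChar X) Ξd := by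
  obtain ⟨F, hF⟩ := hasBoundaryExpansion_iff.mp hX
  obtain ⟨P, hP, hP0⟩ := hasQForm_det_of_boundary fun ξ ν => ⟨(hF ξ ν).1, (hF ξ ν).2.1⟩
  obtain ⟨S, hS, hS0, hS1⟩ := exists_hasQForm_dualFactor
  -- each element of `Ξd` is the quotient of a cofactor of `Ξ` by `det Ξ`
  have h1 : ∀ k i, ∃ H, HasQForm ((dualExp Λ k : ℂ) - 1) H (fun τ => Ξd τ k i) := by
    intro k i
    have h2 := hasQForm_det (Ξ := fun τ => (Ξ τ).updateRow k (Pi.single i 1))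
      (l := Function.update (fun ξ => (Λ ξ : ℂ) - 1) k 0)
      (F := Function.update F k (fun ν _ => (Pi.single i 1 : Fin d → ℂ) ν)) ?_
    · have e : ∀ τ, (Ξ τ).det * Ξd τ k i
          = dualFactor τ * ((Ξ τ).updateRow k (Pi.single i 1)).det := fun τ => by
        have := congrFun (congrFun (h τ) k) i
        rw [Matrix.smul_apply, Matrix.smul_apply, smul_eq_mul, smul_eq_mul] at this
        rw [this, ← Matrix.adjugate_transpose, Matrix.transpose_apply, Matrix.adjugate_apply]
      obtain ⟨H, hH, -⟩ := exists_hasQForm_of_mul_eq hP (by simp [hP0]) (hS.mul h2) (hΞd k i) e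
      refine ⟨H, hH.congr_index ?_⟩
      rw [Finset.sum_update_of_mem (Finset.mem_univ k),
        ← Finset.add_sum_erase _ (fun ξ => (Λ ξ : ℂ) - 1) (Finset.mem_univ k),
        Finset.sdiff_singleton_eq_erase]
      simp only [dualExp]
      push_cast
      ring
    · intro ξ ν
      by_cases hk : ξ = k
      · subst hk
        simp only [Function.update_self, Matrix.updateRow_self]
        exact HasQForm.const _
      · simp only [Function.update_of_ne hk, Matrix.updateRow_ne hk]
        exact (hF ξ ν).1
  choose H hH using h1
  have key : ∀ k ξ, Set.EqOn (fun q => ∑ ν, H k ν q * F ξ ν q)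
      (fun q => S q * (1 : Matrix (Fin d) (Fin d) ℂ) k ξ) (Metric.ball 0 1) := by
    intro k ξ
    have h3 := HasQForm.sum Finset.univ fun ν _ => (hH k ν).mul (hF ξ ν).1
    refine h3.unique ⟨hS.diff.mul_const _, fun τ => ?_⟩
    have h4 := congrFun (congrFun (hd τ) k) ξ
    simp only [Matrix.mul_apply, Matrix.transpose_apply, Matrix.smul_apply, smul_eq_mul] at h4
    rw [h4]
    -- the exponents of the two sides agree only on the diagonal; elsewhere both vanish
    by_cases hk : k = ξ
    · subst hk
      rw [hS.eq τ, mul_assoc]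
      congr 3
      simp only [dualExp]
      push_cast
      ring
    · simp [Matrix.one_apply_ne hk]
  have hball : Metric.ball (0 : ℂ) 1 ∈ 𝓝 (0 : ℂ) := Metric.ball_mem_nhds _ one_pos
  have hH0 : ∀ k ξ, H k ξ 0 = (1 : Matrix (Fin d) (Fin d) ℂ) k ξ := by
    intro k ξ
    have h5 := key k ξ (Metric.mem_ball_self one_pos)
    simp only [(hF _ _).2.1, hS0, Matrix.one_apply, mul_ite, mul_one, mul_zero,
      Finset.sum_ite_eq, Finset.mem_univ, if_true] at h5
    rw [h5, Matrix.one_apply]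
  refine hasBoundaryExpansion_iff.mpr ⟨H, fun k ξ => ⟨hH k ξ, hH0 k ξ, ?_⟩⟩
  have h6 := ((key k ξ).eventuallyEq_of_mem hball).deriv_eq
  have h8 : deriv (fun q => ∑ ν, H k ν q * F ξ ν q) 0
      = ∑ ν, deriv (fun q => H k ν q * F ξ ν q) 0 := deriv_fun_sum fun ν _ =>
    (hH k ν).differentiableAt_zero.fun_mul (hF ξ ν).1.differentiableAt_zero
  rw [deriv_mul_const hS.differentiableAt_zero, hS1, h8] at h6
  have h7 : ∀ ν, deriv (fun q => H k ν q * F ξ ν q) 0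
      = deriv (H k ν) 0 * (1 : Matrix (Fin d) (Fin d) ℂ) ξ ν
        + (1 : Matrix (Fin d) (Fin d) ℂ) k ν * X ξ ν := fun ν => by
    rw [← hH0 k ν, ← (hF ξ ν).2.1, ← (hF ξ ν).2.2]
    exact deriv_fun_mul (hH k ν).differentiableAt_zero (hF ξ ν).1.differentiableAt_zero
  simp only [h7, Finset.sum_add_distrib, Matrix.one_apply, mul_ite, mul_one, mul_zero, ite_mul,
    one_mul, zero_mul, Finset.sum_ite_eq, Finset.mem_univ, if_true] at h6
  rw [dualChar, Matrix.sub_apply, Matrix.smul_apply, Matrix.transpose_apply, Matrix.one_apply,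
    smul_eq_mul, mul_ite, mul_one, mul_zero]
  exact eq_sub_of_add_eq h6

theorem dualRep_apply (ρ : SL(2, ℤ) →* GL (Fin d) ℂ) (γ : SL(2, ℤ)) :
    (dualRep ρ γ : Matrix (Fin d) (Fin d) ℂ)
      = (kappa γ : ℂ) • (ρ γ⁻¹ : Matrix (Fin d) (Fin d) ℂ).transpose := rfl

theorem transformsBy_dualRep {ρ : SL(2, ℤ) →* GL (Fin d) ℂ} (hΞ : IsHolomorphic Ξ)
    (hΞd : IsHolomorphic Ξd) (hne : ∃ τ, (Ξ τ).det ≠ 0)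
    (hd : ∀ τ, Ξd τ * (Ξ τ).transpose = dualFactor τ • (1 : Matrix (Fin d) (Fin d) ℂ))
    (hρ : TransformsBy ρ Ξ) : TransformsBy (dualRep ρ) Ξd := by
  intro γ
  refine eq_of_mul_transpose_eq (A := fun τ => Ξd (γ • τ)) (hΞd.comp_smul γ)
    ((IsHolomorphic.const _).mul hΞd) hΞ hne fun τ => ?_
  have h1 : (ρ γ : Matrix (Fin d) (Fin d) ℂ).transpose
      * (ρ γ⁻¹ : Matrix (Fin d) (Fin d) ℂ).transpose = 1 := by
    rw [← Matrix.transpose_mul, ← Units.val_mul, ← map_mul]; simp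
  have h2 := hd (γ • τ)
  rw [hρ, dualFactor_smul, Matrix.transpose_mul, ← mul_assoc] at h2
  have h3 := congrArg (· * (ρ γ⁻¹ : Matrix (Fin d) (Fin d) ℂ).transpose) h2
  simp only [mul_assoc, h1, mul_one, Matrix.smul_mul, one_mul] at h3
  rw [h3, mul_assoc, hd, dualRep_apply]
  simp only [Matrix.mul_smul, mul_one, smul_smul, mul_comm]

end Dual

theorem IsFundamentalSolution.exists_isDualMatrix {Λ : Fin d → ℚ} {X : Matrix (Fin d) (Fin d) ℂ}
    {Ξ : ℍ → Matrix (Fin d) (Fin d) ℂ} (hsp : SpectralCondition Λ X)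
    (h : IsFundamentalSolution Λ X Ξ) :
    ∃ Ξd, IsDualMatrix Ξ Ξd ∧ IsFundamentalSolution (dualExp Λ) (dualChar X) Ξd ∧
      (∀ τ, Ξd τ * (Ξ τ).transpose = dualFactor τ • (1 : Matrix (Fin d) (Fin d) ℂ)) ∧
      ∀ ρ, TransformsBy ρ Ξ → TransformsBy (dualRep ρ) Ξd := by
  obtain ⟨Ξd, hΞd, hadj⟩ := h.exists_dual hsp
  have hne := h.expansion.exists_det_ne_zero
  have hd := mul_transpose_eq_of_dual h.holo hΞd hne hadj
  have hu : ∀ τ, ¬ IsElliptic τ → IsUnit (Ξ τ).det := fun τ hτ =>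
    (h.det_ne_zero (curlyE_ne_zero_of_not_isElliptic hτ)).isUnit
  refine ⟨Ξd, ⟨hΞd, hu, fun τ hτ => eq_smul_inv_of_mul_transpose_eq (hd τ) (hu τ hτ)⟩,
    ⟨hΞd, fun τ ξ ν => ?_, hasBoundaryExpansion_dual hΞd h.expansion hadj hd⟩, hd,
    fun ρ hρ => transformsBy_dualRep h.holo hΞd hne hd hρ⟩
  exact congrFun (congrFun (nablaMat_dual h hΞd hd τ) ξ) ν

/-- Two fundamental solutions of the same equation have equivalent monodromy. -/
theorem IsFundamentalSolution.repEquiv {Λ : Fin d → ℚ} {X : Matrix (Fin d) (Fin d) ℂ}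
    {Ξ Ξ' : ℍ → Matrix (Fin d) (Fin d) ℂ} (h : IsFundamentalSolution Λ X Ξ)
    (h' : IsFundamentalSolution Λ X Ξ') {ρ σ : SL(2, ℤ) →* GL (Fin d) ℂ} (hρ : TransformsBy ρ Ξ)
    (hσ : TransformsBy σ Ξ') : RepEquiv σ ρ := by
  obtain ⟨C, hC⟩ := h.exists_eq_mul h'.holo h'.nablaMat_eq
  obtain ⟨p, hp⟩ := exists_curlyE_ne_zero
  have hCu : IsUnit C := by
    rw [Matrix.isUnit_iff_isUnit_det, isUnit_iff_ne_zero]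
    intro h0
    apply h'.det_ne_zero hp
    rw [hC, Matrix.det_mul, h0, zero_mul]
  obtain ⟨U, rfl⟩ := hCu
  refine ⟨U, fun γ => ?_⟩
  rw [eq_mul_inv_iff_mul_eq]
  refine Units.ext (h.mul_right_cancel fun τ => ?_)
  rw [Units.val_mul, Units.val_mul, mul_assoc, mul_assoc, ← hC, ← hσ, ← hρ, hC]

/-! ### Leading coefficients of expansions -/

/-- `f = q ^ l (a + b q + O(q²))`. -/
def HasLeading (l : ℂ) (f : ℍ → ℂ) (a b : ℂ) : Prop :=
  ∃ F, HasQForm l F f ∧ F 0 = a ∧ deriv F 0 = b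

namespace HasLeading

variable {l m a b a' b' : ℂ} {f g : ℍ → ℂ}

theorem mul (hf : HasLeading l f a b) (hg : HasLeading m g a' b') :
    HasLeading (l + m) (fun τ => f τ * g τ) (a * a') (b * a' + a * b') := by
  obtain ⟨F, hF, rfl, rfl⟩ := hf
  obtain ⟨G, hG, rfl, rfl⟩ := hg
  exact ⟨_, hF.mul hG, rfl, deriv_fun_mul hF.differentiableAt_zero hG.differentiableAt_zero⟩

theorem sub (hf : HasLeading l f a b) (hg : HasLeading l g a' b') :
    HasLeading l (fun τ => f τ - g τ) (a - a') (b - b') := by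
  obtain ⟨F, hF, rfl, rfl⟩ := hf
  obtain ⟨G, hG, rfl, rfl⟩ := hg
  exact ⟨_, hF.sub hG, rfl, deriv_fun_sub hF.differentiableAt_zero hG.differentiableAt_zero⟩

theorem add (hf : HasLeading l f a b) (hg : HasLeading l g a' b') :
    HasLeading l (fun τ => f τ + g τ) (a + a') (b + b') := by
  obtain ⟨F, hF, rfl, rfl⟩ := hf
  obtain ⟨G, hG, rfl, rfl⟩ := hg
  exact ⟨_, hF.add hG, rfl, deriv_fun_add hF.differentiableAt_zero hG.differentiableAt_zero⟩

theorem mul_const (hf : HasLeading l f a b) (c : ℂ) :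
    HasLeading l (fun τ => f τ * c) (a * c) (b * c) := by
  obtain ⟨F, hF, rfl, rfl⟩ := hf
  exact ⟨_, hF.mul_const c, rfl, deriv_mul_const hF.differentiableAt_zero c⟩

/-- A constant, written with the exponent `-1` of `J` and `ℰ`. -/
theorem const (c : ℂ) : HasLeading (-1) (fun _ => c) 0 c := by
  refine ⟨_, HasQForm.shift 1 ((HasQForm.const c).congr_index (by push_cast; ring)), by simp, ?_⟩
  simp

theorem sum {ι : Type*} (s : Finset ι) {f : ι → ℍ → ℂ} {a b : ι → ℂ}
    (h : ∀ i, HasLeading l (f i) (a i) (b i)) :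
    HasLeading l (fun τ => ∑ i ∈ s, f i τ) (∑ i ∈ s, a i) (∑ i ∈ s, b i) := by
  choose F hF ha hb using h
  refine ⟨_, HasQForm.sum s fun i _ => hF i, Finset.sum_congr rfl fun i _ => ha i, ?_⟩
  rw [deriv_fun_sum fun i _ => (hF i).differentiableAt_zero]
  exact Finset.sum_congr rfl fun i _ => hb i

/-- The constants come from `ℰ = q⁻¹ - 240 + ⋯`. -/
theorem nabla (hf : HasLeading l f a b) :
    HasLeading (-1 + l) (VVMF.nabla f) (l * a) (-240 * (l * a) + (l + 1) * b) := by
  obtain ⟨F, hF, rfl, rfl⟩ := hf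
  have h0 : (0 : ℂ) ∈ Metric.ball (0 : ℂ) 1 := Metric.mem_ball_self one_pos
  have h1 : HasLeading l (Derivative.normalizedDerivOfComplex f) (l * F 0)
      ((l + 1) * _root_.deriv F 0) := by
    refine ⟨_, hF.deriv, by simp, ?_⟩
    have h2 : HasDerivAt (fun q => l * F q + q * _root_.deriv F q)
        (l * _root_.deriv F 0
          + (1 * _root_.deriv F 0 + 0 * _root_.deriv (_root_.deriv F) 0)) (0 : ℂ) :=
      (hF.differentiableAt_zero.hasDerivAt.const_mul l).add ((hasDerivAt_id (0 : ℂ)).mul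
        (((hF.diff.deriv Metric.isOpen_ball) 0 h0).differentiableAt
          (Metric.isOpen_ball.mem_nhds h0)).hasDerivAt)
    rw [h2.deriv]; ring
  obtain ⟨G, hG, hG0, hG1⟩ :=
    (show HasLeading (-1) curlyE 1 (-240) from exists_hasQForm_curlyE).mul h1
  exact ⟨G, hG, by rw [hG0]; ring, by rw [hG1]; ring⟩

theorem exists_hasQForm (hf : HasLeading l f 0 0) : ∃ F, HasQForm (l + 1 + 1) F f := by
  obtain ⟨F, hF, h0, h1⟩ := hf
  obtain ⟨G, hG, hG0⟩ := hF.exists_unshift h0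
  obtain ⟨H, hH, -⟩ := hG.exists_unshift (hG0.trans h1)
  exact ⟨H, hH⟩

end HasLeading

theorem hasLeading_J : HasLeading (-1) J 1 0 := exists_hasQForm_J

/-- `j - c` has a simple pole at the cusp. -/
theorem exists_hasQForm_jInv_sub (c : ℂ) :
    ∃ F, HasQForm (-1) F (fun τ => jInv τ - c) ∧ F 0 ≠ 0 := by
  obtain ⟨F, hF, h0, -⟩ := hasLeading_J.add (HasLeading.const (744 - c))
  refine ⟨F, ⟨hF.diff, fun τ => ?_⟩, by rw [h0]; simp⟩
  rw [← hF.eq, J_eq]; ring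

/-! ### Spaces of vector-valued modular functions -/

section Modular

variable {ρ : SL(2, ℤ) →* GL (Fin d) ℂ} {Λ : Fin d → ℚ} {X : Matrix (Fin d) (Fin d) ℂ}
  {Ξ : ℍ → Matrix (Fin d) (Fin d) ℂ}

theorem HasQExpansion.add {𝕏 𝕐 : ℍ → Fin d → ℂ} {a b : ℤ → Fin d → ℂ} (h : HasQExpansion Λ 𝕏 a)
    (h' : HasQExpansion Λ 𝕐 b) : HasQExpansion Λ (fun τ => 𝕏 τ + 𝕐 τ) (fun n => a n + b n) :=
  fun τ ξ => by
    simpa only [Pi.add_apply, add_mul, mul_add] using (h τ ξ).add (h' τ ξ)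

theorem HasQExpansion.sub {𝕏 𝕐 : ℍ → Fin d → ℂ} {a b : ℤ → Fin d → ℂ} (h : HasQExpansion Λ 𝕏 a)
    (h' : HasQExpansion Λ 𝕐 b) : HasQExpansion Λ (fun τ => 𝕏 τ - 𝕐 τ) (fun n => a n - b n) :=
  fun τ ξ => by
    simpa only [Pi.sub_apply, sub_mul, mul_sub] using (h τ ξ).sub (h' τ ξ)

theorem exists_hasQExpansion {𝕏 : ℍ → Fin d → ℂ} {F : Fin d → ℂ → ℂ} (N : ℤ)
    (h : ∀ ξ, HasQForm (Λ ξ + N) (F ξ) (fun τ => 𝕏 τ ξ)) :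
    ∃ a, HasQExpansion Λ 𝕏 a ∧ (∀ n < N, a n = 0) ∧ a N = fun ξ => F ξ 0 := by
  choose a ha hN h0 _ using fun ξ => (h ξ).hasSum N
  exact ⟨fun n ξ => a ξ n, fun τ ξ => ha ξ τ, fun n hn => funext fun ξ => hN ξ n hn, funext h0⟩

theorem MemModular.add {𝕏 𝕐 : ℍ → Fin d → ℂ} (h : MemModular ρ Λ 𝕏) (h' : MemModular ρ Λ 𝕐) :
    MemModular ρ Λ (fun τ => 𝕏 τ + 𝕐 τ) := by
  refine ⟨fun ξ => (h.holo ξ).add (h'.holo ξ), fun γ τ => ?_, ?_⟩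
  · rw [h.trans, h'.trans, Matrix.mulVec_add]
  · obtain ⟨a, ha, N, hN⟩ := h.cusp
    obtain ⟨b, hb, N', hN'⟩ := h'.cusp
    exact ⟨_, ha.add hb, min N N', fun n hn => by
      rw [hN n (lt_of_lt_of_le hn (min_le_left _ _)), hN' n (lt_of_lt_of_le hn (min_le_right _ _)),
        add_zero]⟩

theorem memModular_zero : MemModular ρ Λ (fun _ => 0) :=
  ⟨fun _ => mdifferentiable_fun_const 0, fun _ _ => (Matrix.mulVec_zero _).symm,
    fun _ => 0, fun τ ξ => by simp [hasSum_zero], 0, fun _ _ => rfl⟩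

theorem hasPrincipalPart_zero : HasPrincipalPart Λ (fun _ => 0) fun _ => 0 :=
  ⟨fun _ => 0, fun τ ξ => by simp [hasSum_zero], fun _ => rfl⟩

/-- An element of `ℳ(ρ)` without principal part vanishes. -/
theorem PrincipalPartInvertible.eq_zero (hP : PrincipalPartInvertible ρ Λ) {𝕏 : ℍ → Fin d → ℂ}
    (holo : ∀ ξ, MDiff (fun τ => 𝕏 τ ξ))
    (trans : ∀ (γ : SL(2, ℤ)) (τ : ℍ),
      𝕏 (γ • τ) = (ρ γ : Matrix (Fin d) (Fin d) ℂ).mulVec (𝕏 τ))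
    (hq : ∀ ξ, ∃ F, HasQForm (Λ ξ) F (fun τ => 𝕏 τ ξ)) (τ : ℍ) : 𝕏 τ = 0 := by
  choose F hF using hq
  obtain ⟨a, ha, hN, -⟩ := exists_hasQExpansion (Λ := Λ) (𝕏 := 𝕏) 0
    fun ξ => (hF ξ).congr_index (by push_cast; ring)
  refine congrFun ((hP 0).unique (y₁ := 𝕏) (y₂ := fun _ => 0)
    ⟨⟨holo, trans, a, ha, 0, hN⟩, a, ha, fun n => ?_⟩
    ⟨memModular_zero, hasPrincipalPart_zero⟩) τ
  exact hN _ (by omega)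

theorem IsFundamentalMatrix.isHolomorphic (h : IsFundamentalMatrix ρ Λ X Ξ) : IsHolomorphic Ξ :=
  fun ξ ν => (h.mem ν).holo ξ

theorem IsFundamentalMatrix.transformsBy (h : IsFundamentalMatrix ρ Λ X Ξ) : TransformsBy ρ Ξ := by
  intro γ τ
  ext ξ ν
  exact congrFun ((h.mem ν).trans γ τ) ξ

theorem isFundamentalMatrix_of_transformsBy (holo : IsHolomorphic Ξ) (hρ : TransformsBy ρ Ξ)
    (hX : HasBoundaryExpansion Λ X Ξ) : IsFundamentalMatrix ρ Λ X Ξ := by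
  refine ⟨fun ν => ⟨fun ξ => holo ξ ν, fun γ τ => ?_, ?_⟩, hX⟩
  · ext ξ
    exact congrFun (congrFun (hρ γ τ) ξ) ν
  · obtain ⟨a, ha, hN, -⟩ := hX ν
    exact ⟨a, ha, -1, hN⟩

/-- The compatibility equation: the columns of `∇Ξ - Ξ D` belong to `ℳ(ρ)`, and `D` is chosen so
that their principal parts cancel. -/
theorem IsFundamentalMatrix.nablaMat_eq (hP : PrincipalPartInvertible ρ Λ)
    (h : IsFundamentalMatrix ρ Λ X Ξ) (τ : ℍ) : nablaMat Ξ τ = Ξ τ * connMat Λ X τ := by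
  have holo := h.isHolomorphic
  have hρ := h.transformsBy
  have hconn : IsHolomorphic (connMat Λ X) := mdifferentiable_connMat Λ X
  have hY : IsHolomorphic fun τ => nablaMat Ξ τ - Ξ τ * connMat Λ X τ :=
    IsHolomorphic.sub (A := nablaMat Ξ) (fun i j => mdifferentiable_nabla (holo i j))
      (holo.mul hconn)
  obtain ⟨F, hF⟩ := hasBoundaryExpansion_iff.mp h.expansion
  rw [← sub_eq_zero]
  ext ξ ν
  refine congrFun (hP.eq_zero (𝕏 := fun τ ξ => (nablaMat Ξ τ - Ξ τ * connMat Λ X τ) ξ ν)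
    (fun ξ => hY ξ ν) (fun γ τ => ?_) (fun ξ => ?_) τ) ξ
  · have h1 : nablaMat Ξ (γ • τ) = (ρ γ : Matrix (Fin d) (Fin d) ℂ) * nablaMat Ξ τ := by
      rw [← nablaMat_const_mul _ holo]
      ext i j
      simp only [← hρ γ]
      exact (nabla_comp_smul (holo i j) γ τ).symm
    have h2 : connMat Λ X (γ • τ) = connMat Λ X τ := by
      rw [connMat, connMat, J_eq, J_eq, jInv_smul]
    ext i
    simp only [h1, h2, hρ γ, mul_assoc, ← mul_sub]
    rfl
  · have h1 : ∀ k, HasLeading ((Λ ξ : ℂ) - 1) (fun τ => Ξ τ ξ k)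
        ((1 : Matrix (Fin d) (Fin d) ℂ) ξ k) (X ξ k) := fun k => ⟨F ξ k, hF ξ k⟩
    have h2 : ∀ k, HasLeading (-1) (fun τ => connMat Λ X τ k ν) _ _ := fun k =>
      ((hasLeading_J.sub (HasLeading.const 240)).mul_const ((expMat Λ - 1) k ν)).add
        (HasLeading.const (commPart Λ X k ν))
    have h3 := (h1 ν).nabla.sub ((HasLeading.sum Finset.univ fun k => by
      simpa only [add_comm] using (h1 k).mul (h2 k)))
    have h4 : ∀ k, (expMat Λ - 1) k ν
        = ((Λ ν : ℂ) - 1) * (1 : Matrix (Fin d) (Fin d) ℂ) k ν := fun k => by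
      by_cases hk : k = ν
      · subst hk; simp [expMat]
      · simp [expMat, hk]
    have h5 : commPart Λ X ξ ν = X ξ ν + (Λ ξ * X ξ ν - X ξ ν * Λ ν) := by
      simp [commPart, expMat, Matrix.diagonal_mul, Matrix.mul_diagonal]
    have e0 : ((Λ ξ : ℂ) - 1) * (1 : Matrix (Fin d) (Fin d) ℂ) ξ ν
        - ∑ k, (1 : Matrix (Fin d) (Fin d) ℂ) ξ k * (0 + (1 - 0) * (expMat Λ - 1) k ν) = 0 := by
      simp only [h4, Matrix.one_apply, ite_mul, one_mul, zero_mul, Finset.sum_ite_eq,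
        Finset.mem_univ, if_true, sub_zero, zero_add]
      split_ifs with hk
      · rw [hk]; ring
      · ring
    have e1 : -240 * (((Λ ξ : ℂ) - 1) * (1 : Matrix (Fin d) (Fin d) ℂ) ξ ν)
        + ((Λ ξ : ℂ) - 1 + 1) * X ξ ν - ∑ k, (X ξ k * (0 + (1 - 0) * (expMat Λ - 1) k ν)
          + (1 : Matrix (Fin d) (Fin d) ℂ) ξ k * (commPart Λ X k ν
            + (0 - 240) * (expMat Λ - 1) k ν)) = 0 := by
      simp only [h4, Finset.sum_add_distrib, Matrix.one_apply, ite_mul, mul_ite, one_mul, mul_one,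
        mul_zero, zero_mul, Finset.sum_ite_eq, Finset.sum_ite_eq', Finset.mem_univ, if_true,
        sub_zero, zero_add, h5]
      split_ifs with hk
      · rw [hk]; ring
      · ring
    rw [e0, e1] at h3
    obtain ⟨G, hG⟩ := h3.exists_hasQForm
    exact ⟨G, hG.congr_index (by ring)⟩

end Modular

/-! ### The spectral condition -/

/-- `f = E ^ n / Δ` has a zero of exact order `n` at a simple zero of `E`. -/
theorem exists_eq_pow_mul_of_mul_discriminant {E f : ℍ → ℂ} {n : ℕ} (hE : MDiff E)
    (hf : ∀ τ, f τ * ModularForm.discriminant τ = E τ ^ n) {τ : ℍ} (h0 : E τ = 0)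
    (h1 : Derivative.normalizedDerivOfComplex E τ ≠ 0) :
    ∃ h : ℂ → ℂ, AnalyticAt ℂ h τ ∧ h τ ≠ 0 ∧
      f ∘ ofComplex =ᶠ[𝓝 (τ : ℂ)] fun z => (z - τ) ^ n * h z := by
  obtain ⟨g, hg, hgp, hEg⟩ := vanishesTo_one (analyticAt_comp_ofComplex hE τ) (by simpa using h0)
  have hΔ := analyticAt_comp_ofComplex mdifferentiable_discriminant τ
  have hΔ0 : ((fun z : ℍ => ModularForm.discriminant z) ∘ ofComplex) (τ : ℂ) ≠ 0 := by
    simpa using ModularForm.discriminant_ne_zero τ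
  have hg0 : g τ ≠ 0 := by
    rw [hgp]
    exact fun h => h1 (by rw [Derivative.normalizedDerivOfComplex, h, mul_zero])
  refine ⟨fun z => g z ^ n / ((fun z : ℍ => ModularForm.discriminant z) ∘ ofComplex) z,
    (hg.pow n).div hΔ hΔ0, div_ne_zero (pow_ne_zero n hg0) hΔ0, ?_⟩
  filter_upwards [hEg] with z hz
  simp only [Function.comp_apply] at hz ⊢
  rw [mul_div_assoc', eq_div_iff (ModularForm.discriminant_ne_zero _), hf, hz, mul_pow]

section Modular

variable {ρ : SL(2, ℤ) →* GL (Fin d) ℂ} {Λ : Fin d → ℚ} {X : Matrix (Fin d) (Fin d) ℂ}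
  {Ξ : ℍ → Matrix (Fin d) (Fin d) ℂ}

/-- If `f` is a modular function with a simple pole at the cusp and the elements of `Ξ W` vanish at
least to the order of `f` at every zero of `f`, the columns of `Ξ W / f` belong to `ℳ(ρ)` and have
no principal part, so that `W = 0`. -/
theorem IsFundamentalMatrix.eq_zero_of_vanishesTo (hP : PrincipalPartInvertible ρ Λ)
    (h : IsFundamentalMatrix ρ Λ X Ξ) {f : ℍ → ℂ} (hf : MDiff f)
    (hinv : ∀ (γ : SL(2, ℤ)) (τ : ℍ), f (γ • τ) = f τ)
    (hq : ∃ F, HasQForm (-1) F f ∧ F 0 ≠ 0) {n : ℕ} {W : Matrix (Fin d) (Fin d) ℂ}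
    (hW : ∀ τ : ℍ, f τ = 0 → (∃ h : ℂ → ℂ, AnalyticAt ℂ h τ ∧ h τ ≠ 0 ∧
        f ∘ ofComplex =ᶠ[𝓝 (τ : ℂ)] fun z => (z - τ) ^ n * h z) ∧
      ∀ i j, VanishesTo n τ (fun z => (Ξ (ofComplex z) * W) i j)) : W = 0 := by
  obtain ⟨P, hPq, hP0⟩ := hq
  have hne : ∃ τ, f τ ≠ 0 := exists_ne_zero_of_hasQForm hPq hP0
  have holo := h.isHolomorphic
  have hρ := h.transformsBy
  have hΞW : IsHolomorphic fun τ => Ξ τ * W := holo.mul (IsHolomorphic.const W)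
  have key : ∀ i j, ∃ k : ℍ → ℂ, MDiff k ∧ ∀ τ, (Ξ τ * W) i j = f τ * k τ := by
    intro i j
    refine exists_mdifferentiable_eq_mul hf hne fun τ => ?_
    have ha := analyticAt_comp_ofComplex (hΞW i j) τ
    have hfa := analyticAt_comp_ofComplex hf τ
    by_cases h0 : f τ = 0
    · obtain ⟨⟨g, hg, hg0, hfg⟩, hv⟩ := hW τ h0
      obtain ⟨v, hv, hvv⟩ := hv i j
      refine ⟨fun z => v z / g z, hv.div hg hg0, ?_⟩
      filter_upwards [hfg, hvv, hg.continuousAt.eventually_ne hg0] with z h1 h2 h3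
      rw [h1, Function.comp_apply, h2]
      field_simp
    · have h0' : (f ∘ ofComplex) (τ : ℂ) ≠ 0 := by simpa using h0
      refine ⟨_, ha.div hfa h0', ?_⟩
      filter_upwards [hfa.continuousAt.eventually_ne h0'] with z hz
      exact (mul_div_cancel₀ _ hz).symm
  choose k hk hfk using key
  have hK : IsHolomorphic fun τ => Matrix.of fun i j => k i j τ := fun i j => hk i j
  have hfK : ∀ τ, Ξ τ * W = f τ • Matrix.of fun i j => k i j τ := fun τ => by
    ext i j; exact hfk i j τ
  obtain ⟨F, hF⟩ := hasBoundaryExpansion_iff.mp h.expansion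
  have hzero : ∀ i j τ, k i j τ = 0 := by
    intro i j τ
    refine congrFun (hP.eq_zero (𝕏 := fun τ i => k i j τ) (fun i => hk i j) (fun γ τ => ?_)
      (fun i => ?_) τ) i
    · ext i
      refine eq_of_mul_eq_mul hf (mdifferentiable_comp_smul (hk i j) γ)
        (((IsHolomorphic.const (ρ γ : Matrix (Fin d) (Fin d) ℂ)).mul hK) i j) hne (fun z => ?_) τ
      have h1 : f z • (Matrix.of fun i j => k i j (γ • z))
          = f z • ((ρ γ : Matrix (Fin d) (Fin d) ℂ) * Matrix.of fun i j => k i j z) := by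
        rw [← Matrix.mul_smul, ← hfK, ← mul_assoc, ← hρ, hfK, hinv]
      exact congrFun (congrFun h1 i) j
    · have h2 : HasQForm (Λ i - 1) (fun q => ∑ l, F i l q * W l j) (fun τ => (Ξ τ * W) i j) :=
        HasQForm.sum Finset.univ fun l _ => (hF i l).1.mul_const (W l j)
      obtain ⟨H, hH, -⟩ := exists_hasQForm_of_mul_eq hPq hP0 h2 (hk i j) fun τ => (hfk i j τ).symm
      exact ⟨H, hH.congr_index (by ring)⟩
  obtain ⟨τ, hτ⟩ := h.expansion.exists_det_ne_zero
  have h3 : Ξ τ * W = 0 := by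
    ext i j
    rw [hfk, hzero, mul_zero, Matrix.zero_apply]
  rw [← one_mul W, ← Matrix.nonsing_inv_mul _ (isUnit_iff_ne_zero.mpr hτ), mul_assoc, h3, mul_zero]

/-- One step of the filtration by the order of vanishing at an elliptic point `τ`, if the
connection matrix is `κ B + f R`, where `κ` is the slope of `ℰ` at `τ` and `f` vanishes to order
`N` at `τ`. -/
theorem vanishesTo_fundamental (holo : IsHolomorphic Ξ)
    (hode : ∀ τ, nablaMat Ξ τ = Ξ τ * connMat Λ X τ) {τ : ℍ} (h0 : curlyE τ = 0) {κ : ℂ}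
    (hκ : Derivative.normalizedDerivOfComplex curlyE τ = κ) (hκ0 : κ ≠ 0) {f : ℍ → ℂ}
    {h : ℂ → ℂ} {N : ℕ} (hh : AnalyticAt ℂ h τ)
    (hf : f ∘ ofComplex =ᶠ[𝓝 (τ : ℂ)] fun z => (z - τ) ^ N * h z)
    {B R : Matrix (Fin d) (Fin d) ℂ} (hconn : ∀ z, connMat Λ X z = κ • B + f z • R)
    {C : Matrix (Fin d) (Fin d) ℂ} {n : ℕ} (hn : n < N)
    (hC : ∀ i j, VanishesTo n τ (fun z => (Ξ (ofComplex z) * C) i j)) (i j : Fin d) :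
    VanishesTo (n + 1) τ
      (fun z => (Ξ (ofComplex z) * ((B - (n : ℂ) • (1 : Matrix (Fin d) (Fin d) ℂ)) * C)) i j) := by
  subst hκ
  rw [← deriv_nablaCoeff] at hκ0 hconn
  refine vanishesTo_mul_sub (analyticAt_nablaCoeff τ) (by rw [nablaCoeff_coe, h0, mul_zero]) hκ0
    (M := fun z => Ξ (ofComplex z)) (R := fun z => f (ofComplex z) • R) hn
    (fun i j => analyticAt_comp_ofComplex (holo i j) τ) (fun i j => ?_) ?_ hC i j
  · refine ⟨fun z => h z * R i j, hh.mul analyticAt_const, ?_⟩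
    filter_upwards [hf] with z hz
    rw [Function.comp_apply] at hz
    rw [Matrix.smul_apply, smul_eq_mul, hz, mul_assoc]
  · filter_upwards [eventually_im_pos τ] with z hz i j
    have h1 := congrFun (congrFun (hode (ofComplex z)) i) j
    rw [hconn] at h1
    rw [← h1]
    exact (nabla_ofComplex (fun z => Ξ z i j) hz).symm

/-- Three steps of the filtration at the zeros of `E₄`, where `j` vanishes to order three, and two
steps at the zeros of `E₆`, where `j - 1728` vanishes to order two, give `ℬ(ℬ - 1)(ℬ - 2) = 0` and
`𝒜(𝒜 - 1) = 0`. -/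
theorem IsFundamentalMatrix.spectralCondition (hP : PrincipalPartInvertible ρ Λ)
    (h : IsFundamentalMatrix ρ Λ X Ξ) : SpectralCondition Λ X := by
  have holo := h.isHolomorphic
  have hode := h.nablaMat_eq hP
  have hstart : ∀ (τ : ℍ) i j, VanishesTo 0 τ
      (fun z => (Ξ (ofComplex z) * (1 : Matrix (Fin d) (Fin d) ℂ)) i j) := fun τ i j => by
    simp only [mul_one]
    exact VanishesTo.zero (analyticAt_comp_ofComplex (holo i j) τ)
  constructor
  · refine diagonalizableWithin_zero_one ?_
    have hinv : ∀ (γ : SL(2, ℤ)) (τ : ℍ), jInv (γ • τ) - 1728 = jInv τ - 1728 := fun γ τ => by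
      rw [jInv_smul]
    have hm := mdifferentiable_sub mdifferentiable_jInv (mdifferentiable_fun_const 1728)
    refine h.eq_zero_of_vanishesTo hP hm hinv (exists_hasQForm_jInv_sub 1728) (n := 2)
      fun τ hτ => ?_
    have h6 : E6 τ = 0 := by
      have := jInv_sub_mul_discriminant τ
      rw [hτ, zero_mul] at this
      exact pow_eq_zero_iff (two_ne_zero) |>.mp this.symm
    have hloc := exists_eq_pow_mul_of_mul_discriminant (f := fun τ => jInv τ - 1728)
      mdifferentiable_E6 jInv_sub_mul_discriminant h6 (deriv_E6_ne_zero h6)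
    refine ⟨hloc, ?_⟩
    obtain ⟨g, hg, -, hfg⟩ := hloc
    have hconn : ∀ z, connMat Λ X z = (-864 : ℂ) • matA Λ X
        + (jInv z - 1728) • (-((1 / 3 : ℂ) • matB Λ X + (1 / 2 : ℂ) • matA Λ X)) := fun z => by
      rw [connMat_eq]; module
    have h0 := (curlyE_eq_zero_iff τ).mpr (Or.inr h6)
    have hκ := deriv_curlyE_of_E6_eq_zero h6
    have s1 := vanishesTo_fundamental holo hode h0 hκ (by norm_num) hg hfg hconn (by norm_num)
      (hstart τ)
    have s2 := vanishesTo_fundamental holo hode h0 hκ (by norm_num) hg hfg hconn (by norm_num) s1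
    simpa using s2
  · refine diagonalizableWithin_zero_one_two ?_
    have hinv : ∀ (γ : SL(2, ℤ)) (τ : ℍ), jInv (γ • τ) - 0 = jInv τ - 0 := fun γ τ => by
      rw [jInv_smul]
    have hm := mdifferentiable_sub mdifferentiable_jInv (mdifferentiable_fun_const 0)
    refine h.eq_zero_of_vanishesTo hP hm hinv (exists_hasQForm_jInv_sub 0) (n := 3)
      fun τ hτ => ?_
    have hj : ∀ z, (jInv z - 0) * ModularForm.discriminant z = E4 z ^ 3 := fun z => by
      rw [sub_zero, jInv_mul_discriminant]
    have h4 : E4 τ = 0 := by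
      have := hj τ
      rw [hτ, zero_mul] at this
      exact pow_eq_zero_iff (three_ne_zero) |>.mp this.symm
    have hloc := exists_eq_pow_mul_of_mul_discriminant (f := fun τ => jInv τ - 0)
      mdifferentiable_E4 hj h4 (deriv_E4_ne_zero h4)
    refine ⟨hloc, ?_⟩
    obtain ⟨g, hg, -, hfg⟩ := hloc
    have hconn : ∀ z, connMat Λ X z = (576 : ℂ) • matB Λ X
        + (jInv z - 0) • (-((1 / 3 : ℂ) • matB Λ X + (1 / 2 : ℂ) • matA Λ X)) := fun z => by
      rw [connMat_eq]; module
    have h0 := (curlyE_eq_zero_iff τ).mpr (Or.inl h4)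
    have hκ := deriv_curlyE_of_E4_eq_zero h4
    have s1 := vanishesTo_fundamental holo hode h0 hκ (by norm_num) hg hfg hconn (by norm_num)
      (hstart τ)
    have s2 := vanishesTo_fundamental holo hode h0 hκ (by norm_num) hg hfg hconn (by norm_num) s1
    have s3 := vanishesTo_fundamental holo hode h0 hκ (by norm_num) hg hfg hconn (by norm_num) s2
    simpa using s3

/-! ### The dual representation -/

theorem kappa_neg_one : kappa (-1) = 1 := by
  apply Units.ext
  have h : (kappa (-1) : ℂ) = ZMod.stdAddChar (kappaTwo (-1)) * ZMod.stdAddChar (kappaThree (-1)) :=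
    rfl
  rw [h]
  simp [kappaTwo, kappaThree]

theorem isExponent_dualRep (h : IsExponent ρ Λ) : IsExponent (dualRep ρ) (dualExp Λ) := by
  have h1 : (ρ ModularGroup.T⁻¹ : Matrix (Fin d) (Fin d) ℂ)
      = Matrix.diagonal fun ξ => Complex.exp (-(2 * Real.pi * Complex.I * (Λ ξ : ℂ))) := by
    have h2 : (ρ ModularGroup.T : Matrix (Fin d) (Fin d) ℂ)
        * (ρ ModularGroup.T⁻¹ : Matrix (Fin d) (Fin d) ℂ) = 1 := by
      rw [← Units.val_mul, ← map_mul]; simp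
    have h3 : (Matrix.diagonal fun ξ => Complex.exp (-(2 * Real.pi * Complex.I * (Λ ξ : ℂ))))
        * (ρ ModularGroup.T : Matrix (Fin d) (Fin d) ℂ) = 1 := by
      rw [h, Matrix.diagonal_mul_diagonal]
      simp [← Complex.exp_add]
    exact (left_inv_eq_right_inv h3 h2).symm
  rw [IsExponent, dualRep_apply, h1, kappa_T, Matrix.diagonal_transpose, ← Matrix.diagonal_smul]
  congr 1
  ext ξ
  rw [Pi.smul_apply, smul_eq_mul, ← Complex.exp_add]
  congr 1
  simp only [dualExp]
  push_cast
  ring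

theorem isAdmissible_dualRep (h : IsAdmissible ρ) (hΛ : IsExponent ρ Λ) :
    IsAdmissible (dualRep ρ) := by
  refine ⟨?_, ?_, ?_⟩
  · apply Units.ext
    rw [dualRep_apply, kappa_neg_one, inv_neg, inv_one, h.neg_one]
    simp
  · rw [isExponent_dualRep hΛ]
    exact Matrix.isDiag_diagonal _
  · obtain ⟨m, hm, hm1⟩ := h.finOrder.exists_pow_eq_one
    refine isOfFinOrder_iff_pow_eq_one.mpr ⟨6 * m, by omega, ?_⟩
    have h6 : kappa (ModularGroup.T ^ (6 * m)) = 1 := by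
      apply Units.ext
      rw [map_pow, Units.val_pow_eq_pow_val, kappa_T, pow_mul, ← Complex.exp_nat_mul]
      rw [show ((6 : ℕ) : ℂ) * (2 * Real.pi * Complex.I * (5 / 6))
        = (5 : ℕ) * (2 * Real.pi * Complex.I) by push_cast; ring, Complex.exp_nat_mul_two_pi_mul_I]
      simp
    rw [← map_pow]
    apply Units.ext
    rw [dualRep_apply, h6, map_inv, map_pow ρ, mul_comm 6 m, pow_mul, hm1]
    simp

/-! ### Invertibility of the principal part map -/

/-- The vectors `J ^ n Ξ c` have the leading terms `q^(-(n+1)) c`, so that every principal part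
occurs. -/
theorem IsFundamentalMatrix.exists_hasPrincipalPart (h : IsFundamentalMatrix ρ Λ X Ξ) (N : ℕ) :
    ∀ p : ℕ → Fin d → ℂ, (∀ n, N ≤ n → p n = 0) →
      ∃ 𝕏, MemModular ρ Λ 𝕏 ∧ HasPrincipalPart Λ 𝕏 p := by
  induction N with
  | zero =>
    intro p hp
    obtain rfl : p = fun _ => 0 := funext fun n => hp n n.zero_le
    exact ⟨_, memModular_zero, hasPrincipalPart_zero⟩
  | succ N ih =>
    intro p hp
    obtain ⟨F, hF⟩ := hasBoundaryExpansion_iff.mp h.expansion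
    obtain ⟨Q, hQ, hQ0, -⟩ := hasLeading_J
    have holo := h.isHolomorphic
    have hJ : MDiff J := hQ.mdifferentiable
    set 𝕐 : ℍ → Fin d → ℂ := fun τ => J τ ^ N • (Ξ τ).mulVec (p N) with h𝕐
    have hq : ∀ ξ, HasQForm (Λ ξ + (-((N : ℤ) + 1) : ℤ))
        (fun q => Q q ^ N * ∑ ν, F ξ ν q * p N ν) (fun τ => 𝕐 τ ξ) := fun ξ =>
      ((hQ.pow N).mul (HasQForm.sum Finset.univ fun ν _ =>
        (hF ξ ν).1.mul_const (p N ν))).congr_index (by push_cast; ring)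
    obtain ⟨a, ha, haN, haN0⟩ := exists_hasQExpansion _ hq
    have haN1 : a (-((N : ℤ) + 1)) = p N := by
      rw [haN0]
      ext ξ
      simp [hQ0, (hF _ _).2.1, Matrix.one_apply]
    have hmem : MemModular ρ Λ 𝕐 := by
      refine ⟨fun ξ => (hq ξ).mdifferentiable, fun γ τ => ?_, a, ha, _, haN⟩
      rw [h𝕐]
      simp only [h.transformsBy γ τ]
      rw [← Matrix.mulVec_mulVec, Matrix.mulVec_smul, J_eq, J_eq, jInv_smul]
    obtain ⟨𝕏, h𝕏, b, hb, hbp⟩ := ih (fun n => p n - a (-((n : ℤ) + 1))) fun n hn => by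
      rcases hn.eq_or_lt with rfl | hlt
      · rw [haN1, sub_self]
      · rw [hp n hlt, haN _ (by omega), sub_zero]
    refine ⟨_, h𝕏.add hmem, _, hb.add ha, fun n => ?_⟩
    rw [hbp, sub_add_cancel]

/-- The pairing `Δ^(7/6) · ᵗΞ 𝕐` of `ℳ(ρ)` with an element `𝕐` of `ℳ(ρ^∨)` without principal part
consists of cusp forms of weight 14, hence vanishes. -/
theorem IsFundamentalMatrix.eq_zero_of_dualRep (h : IsFundamentalMatrix ρ Λ X Ξ)
    {𝕐 : ℍ → Fin d → ℂ} (holo : ∀ ξ, MDiff (fun τ => 𝕐 τ ξ))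
    (trans : ∀ (γ : SL(2, ℤ)) (τ : ℍ),
      𝕐 (γ • τ) = (dualRep ρ γ : Matrix (Fin d) (Fin d) ℂ).mulVec (𝕐 τ))
    (hq : ∀ ξ, ∃ F, HasQForm (dualExp Λ ξ) F (fun τ => 𝕐 τ ξ)) (τ : ℍ) : 𝕐 τ = 0 := by
  choose G hG using hq
  obtain ⟨F, hF⟩ := hasBoundaryExpansion_iff.mp h.expansion
  obtain ⟨P, hP, -⟩ := exists_hasQForm_discPow
  have hpair : ∀ ν τ, discPow τ * ∑ ξ, Ξ τ ξ ν * 𝕐 τ ξ = 0 := by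
    intro ν
    have h1 : HasQForm (0 + (1 : ℕ)) (fun q => P q * ∑ ξ, F ξ ν q * G ξ q)
        (fun τ => discPow τ * ∑ ξ, Ξ τ ξ ν * 𝕐 τ ξ) :=
      (hP.mul (HasQForm.sum (l := -(1 / 6)) Finset.univ fun ξ _ =>
        ((hF ξ ν).1.mul (hG ξ)).congr_index (by simp only [dualExp]; push_cast; ring))).congr_index
        (by push_cast; ring)
    refine eq_zero_of_cuspForm cuspForm_fourteen_eq_zero (fun γ τ => ?_) (h1.shift 1) (by simp)
    have h2 : (Ξ (γ • τ)).transpose.mulVec (𝕐 (γ • τ))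
        = (kappa γ : ℂ) • (Ξ τ).transpose.mulVec (𝕐 τ) := by
      have h3 : (ρ γ : Matrix (Fin d) (Fin d) ℂ).transpose
          * (ρ γ⁻¹ : Matrix (Fin d) (Fin d) ℂ).transpose = 1 := by
        rw [← Matrix.transpose_mul, ← Units.val_mul, ← map_mul]; simp
      rw [trans, h.transformsBy, Matrix.mulVec_mulVec, dualRep_apply, Matrix.transpose_mul,
        Matrix.mul_smul, mul_assoc, h3, mul_one, Matrix.smul_mulVec]
    have h4 : ∑ ξ, Ξ (γ • τ) ξ ν * 𝕐 (γ • τ) ξ = (kappa γ : ℂ) * ∑ ξ, Ξ τ ξ ν * 𝕐 τ ξ :=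
      congrFun h2 ν
    have h5 := discPow_smul γ τ
    rw [h4, show (14 : ℤ) = ((14 : ℕ) : ℤ) from rfl, zpow_natCast]
    linear_combination (∑ ξ, Ξ τ ξ ν * 𝕐 τ ξ) * h5
  ext ξ
  refine eq_zero_of_mul_eq_zero h.isHolomorphic.det (holo ξ) h.expansion.exists_det_ne_zero
    (fun z => ?_) τ
  have h6 : (Ξ z).transpose.mulVec (𝕐 z) = 0 := by
    ext ν
    exact (mul_eq_zero.mp (hpair ν z)).resolve_left (discPow_ne_zero z)
  have h7 := congrArg (fun v => (Ξ z).transpose.adjugate.mulVec v) h6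
  simp only [Matrix.mulVec_mulVec, Matrix.adjugate_mul, Matrix.det_transpose, Matrix.smul_mulVec,
    Matrix.one_mulVec, Matrix.mulVec_zero] at h7
  exact congrFun h7 ξ

theorem IsFundamentalMatrix.principalPartInvertible_dual (h : IsFundamentalMatrix ρ Λ X Ξ)
    {X' : Matrix (Fin d) (Fin d) ℂ} {Ξd : ℍ → Matrix (Fin d) (Fin d) ℂ}
    (hd : IsFundamentalMatrix (dualRep ρ) (dualExp Λ) X' Ξd) :
    PrincipalPartInvertible (dualRep ρ) (dualExp Λ) := by
  intro p
  obtain ⟨N, hN⟩ := p.support.exists_nat_subset_range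
  obtain ⟨𝕏, h𝕏⟩ := hd.exists_hasPrincipalPart N p fun n hn => by
    by_contra hne
    exact absurd (Finset.mem_range.mp (hN (Finsupp.mem_support_iff.mpr hne))) (by omega)
  refine ⟨𝕏, h𝕏, fun 𝕐 h𝕐 => funext fun τ => ?_⟩
  obtain ⟨hm, a, ha, hap⟩ := h𝕏
  obtain ⟨hm', b, hb, hbp⟩ := h𝕐
  rw [← sub_eq_zero]
  refine h.eq_zero_of_dualRep (𝕐 := fun τ => 𝕐 τ - 𝕏 τ)
    (fun ξ => mdifferentiable_sub (hm'.holo ξ) (hm.holo ξ)) (fun γ τ => ?_) (fun ξ => ?_) τ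
  · rw [hm.trans, hm'.trans, Matrix.mulVec_sub]
  · obtain ⟨F, hF, -⟩ := exists_hasQForm_of_hasSum 0 (fun τ => (hb.sub ha) τ ξ) fun n hn => by
      obtain ⟨m, rfl⟩ : ∃ m : ℕ, n = -((m : ℤ) + 1) := ⟨(-n - 1).toNat, by omega⟩
      simp only [hap, hbp, sub_self, Pi.zero_apply]
    exact ⟨F, hF.congr_index (by push_cast; ring)⟩

end Modular

end VVMF

end

theorem mainTheorem7 (d : ℕ) :
    -- the transformation is an involution
    Function.Involutive (VVMF.dualPair (d := d)) ∧
    -- its effect on `𝒜` and `ℬ`, and on the spectral condition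
    (∀ (Λ : Fin d → ℚ) (X : Matrix (Fin d) (Fin d) ℂ),
      VVMF.matA (VVMF.dualExp Λ) (VVMF.dualChar X) = 1 - (VVMF.matA Λ X).transpose ∧
      VVMF.matB (VVMF.dualExp Λ) (VVMF.dualChar X)
        = (2 : ℂ) • (1 : Matrix (Fin d) (Fin d) ℂ) - (VVMF.matB Λ X).transpose ∧
      (VVMF.SpectralCondition Λ X →
        VVMF.SpectralCondition (VVMF.dualExp Λ) (VVMF.dualChar X))) ∧
    -- the fundamental matrix and the representation that correspond to the dual pair
    (∀ (Λ : Fin d → ℚ) (X : Matrix (Fin d) (Fin d) ℂ) (Ξ : UpperHalfPlane → Matrix (Fin d) (Fin d) ℂ),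
      VVMF.SpectralCondition Λ X → VVMF.IsFundamentalSolution Λ X Ξ →
      ∃ (ρ : SL(2, ℤ) →* GL (Fin d) ℂ) (Ξd : UpperHalfPlane → Matrix (Fin d) (Fin d) ℂ),
        (∀ ρ' : SL(2, ℤ) →* GL (Fin d) ℂ, VVMF.TransformsBy ρ' Ξ ↔ ρ' = ρ) ∧
        VVMF.IsDualMatrix Ξ Ξd ∧
        VVMF.IsFundamentalSolution (VVMF.dualExp Λ) (VVMF.dualChar X) Ξd ∧
        VVMF.TransformsBy (VVMF.dualRep ρ) Ξd ∧
        ∀ (Ξ' : UpperHalfPlane → Matrix (Fin d) (Fin d) ℂ) (σ : SL(2, ℤ) →* GL (Fin d) ℂ),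
          VVMF.IsFundamentalSolution (VVMF.dualExp Λ) (VVMF.dualChar X) Ξ' →
          VVMF.TransformsBy σ Ξ' → VVMF.RepEquiv σ (VVMF.dualRep ρ)) ∧
    -- the same for the spaces of vector-valued modular functions
    (∀ (ρ : SL(2, ℤ) →* GL (Fin d) ℂ) (Λ : Fin d → ℚ) (X : Matrix (Fin d) (Fin d) ℂ)
        (Ξ : UpperHalfPlane → Matrix (Fin d) (Fin d) ℂ),
      VVMF.IsAdmissible ρ → VVMF.IsExponent ρ Λ → VVMF.PrincipalPartInvertible ρ Λ →
      VVMF.IsFundamentalMatrix ρ Λ X Ξ →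
      VVMF.IsAdmissible (VVMF.dualRep ρ) ∧
      VVMF.IsExponent (VVMF.dualRep ρ) (VVMF.dualExp Λ) ∧
      VVMF.PrincipalPartInvertible (VVMF.dualRep ρ) (VVMF.dualExp Λ) ∧
      ∃ Ξd : UpperHalfPlane → Matrix (Fin d) (Fin d) ℂ,
        VVMF.IsDualMatrix Ξ Ξd ∧
        VVMF.IsFundamentalMatrix (VVMF.dualRep ρ) (VVMF.dualExp Λ) (VVMF.dualChar X) Ξd ∧
        VVMF.IsFundamentalSolution (VVMF.dualExp Λ) (VVMF.dualChar X) Ξd) := by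
  refine ⟨VVMF.dualPair_involutive, fun Λ X => ⟨VVMF.matA_dual Λ X, VVMF.matB_dual Λ X,
    fun h => h.dual⟩, fun Λ X Ξ hsp h => ?_, fun ρ Λ X Ξ hρ hΛ hP h => ?_⟩
  · obtain ⟨ρ, hρ⟩ := h.exists_transformsBy
    obtain ⟨Ξd, hdual, hsol, -, htr⟩ := h.exists_isDualMatrix hsp
    have hρd := htr ρ ((hρ ρ).mpr rfl)
    exact ⟨ρ, Ξd, hρ, hdual, hsol, hρd, fun Ξ' σ h' hσ => hsol.repEquiv h' hρd hσ⟩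
  · have hsol : VVMF.IsFundamentalSolution Λ X Ξ := ⟨h.isHolomorphic, fun τ ξ ν =>
      congrFun (congrFun (h.nablaMat_eq hP τ) ξ) ν, h.expansion⟩
    obtain ⟨Ξd, hdual, hsold, -, htr⟩ := hsol.exists_isDualMatrix (h.spectralCondition hP)
    have hd := VVMF.isFundamentalMatrix_of_transformsBy hsold.holo (htr ρ h.transformsBy)
      hsold.expansion
    exact ⟨VVMF.isAdmissible_dualRep hρ hΛ, VVMF.isExponent_dualRep hΛ,
      h.principalPartInvertible_dual hd, Ξd, hdual, hd, hsold⟩
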